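/- A Jacobi diagram is a finite graph all of whose vertices have valence $1$ or $3$ (loops and multiple edges allowed), with a cyclic order of the three half-edges at every trivalent vertex. Its degree is half its number of vertices; an edge adjacent to a univalent vertex is a leg. A diagram is $3$-loop if it is connected with first Betti number $3$. Let $\mathcal{A}_{3\text{-loop}}$ be the $\mathbb{Q}$-vector space spanned by (isomorphism classes of) $3$-loop Jacobi diagrams modulo the AS and IHX relations. Let $\mathcal{A}(\text{tetrahedron})$ be the $\mathbb{Q}$-vector space spanned by the $3$-loop Jacobi diagrams whose internal graph, obtained by removing the legs, is the tetrahedron, modulo isomorphism of diagrams (in particular modulo the symmetries of the tetrahedron), the AS relation, and the IHX relations on the legs, i.e. those at an edge one of whose ends is adjacent to a leg; here a diagram with a trivalent vertex adjacent to two legs is set to $0$, as AS forces. The superscript $(\mathrm{even})$ denotes the subspace spanned by diagrams of even degree. Both spaces are graded by the number $n$ of legs; for a $3$-loop diagram $n$ equals the degree minus $2$, so that even degree means that $n$ is even. Then: (1) Sending a diagram to its class induces an isomorphism of graded vector spaces $\mathcal{A}(\text{tetrahedron})^{(\mathrm{even})}\cong\mathcal{A}_{3\text{-loop}}^{(\mathrm{even})}$.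 (2) Let $\sigma_i$ be the class of the $i$-th elementary symmetric polynomial in $R=\mathbb{Q}[y_1,y_2,y_3,y_4]/(y_1+y_2+y_3+y_4)$. As a graded vector space, $\mathcal{A}(\text{tetrahedron})^{(\mathrm{even})}$ is isomorphic to the subalgebra $\mathbb{Q}[\sigma_2,\sigma_3^2,\sigma_4]$ of $R$, the number of legs corresponding to the polynomial degree. This subalgebra is the image in $R$ of the space of symmetric polynomials all of whose monomials have even degree, and $\sigma_2,\sigma_3^2,\sigma_4$ are algebraically independent over $\mathbb{Q}$. (3) For every $n$ the part of $\mathcal{A}_{3\text{-loop}}^{(\mathrm{even})}$ with $n$ legs is finite-dimensional, and the generating function of these dimensions is $$\sum_{n\ge 0}\dim\big(\mathcal{A}_{3\text{-loop}}^{(\mathrm{even})}\big)_n\,x^n=\frac{1}{(1-x^2)(1-x^4)(1-x^6)}=\sum_{n\text{ even}}\left(\Big\lfloor\frac{n^2+12n}{48}\Big\rfloor+1\right)x^n .$$ -/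

import Mathlib

/-- A finite Jacobi diagram, presented by its half-edges `Fin card`.

`edge` is the fixed-point-free involution exchanging the two halves of every edge. `rot` sends a
half-edge to the next one in the cyclic order at its vertex. The vertices are the cycles of `rot`;
the condition `rot_cube` says that each of them has one or three half-edges, and at a trivalent
vertex the cycle is the orientation of that vertex. Loops and multiple edges are allowed. -/
structure JacobiDiagram where
  card : ℕ
  rot : Equiv.Perm (Fin card)
  rot_cube : ∀ x, rot (rot (rot x)) = x
  edge : Equiv.Perm (Fin card)
  edge_edge : ∀ x, edge (edge x) = x
  edge_ne : ∀ x, edge x ≠ x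

namespace JacobiDiagram

/-- Isomorphism of Jacobi diagrams (preserving the vertex orientations). -/
def Iso (D D' : JacobiDiagram) : Prop :=
  ∃ φ : Fin D.card ≃ Fin D'.card,
    (∀ x, φ (D.rot x) = D'.rot (φ x)) ∧ ∀ x, φ (D.edge x) = D'.edge (φ x)

/-- The half-edge `x` ends at a univalent vertex. -/
def IsUnivalent (D : JacobiDiagram) (x : Fin D.card) : Prop := D.rot x = x

/-- The number of vertices. -/
noncomputable def numVertices (D : JacobiDiagram) : ℕ :=
  Nat.card (Quotient (Equiv.Perm.SameCycle.setoid D.rot))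

/-- The number of edges. -/
noncomputable def numEdges (D : JacobiDiagram) : ℕ :=
  Nat.card (Quotient (Equiv.Perm.SameCycle.setoid D.edge))

/-- The number of legs, counted by their univalent vertices. -/
noncomputable def numLegs (D : JacobiDiagram) : ℕ := Nat.card {x // D.IsUnivalent x}

/-- The degree: half the number of vertices (which is always even). -/
noncomputable def degree (D : JacobiDiagram) : ℕ := D.numVertices / 2

/-- The underlying graph is nonempty and connected. -/
def IsConnected (D : JacobiDiagram) : Prop :=
  0 < D.card ∧ ∀ x y, Relation.EqvGen (fun a b => b = D.rot a ∨ b = D.edge a) x y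

/-- `D` is `n`-loop: connected with Euler number `1 - n`. -/
def IsLoop (D : JacobiDiagram) (n : ℕ) : Prop :=
  D.IsConnected ∧ (D.numVertices : ℤ) - (D.numEdges : ℤ) = 1 - (n : ℤ)

/-- Redistribute the half-edges among the positions at the vertices: the half-edge `τ x` takes the
position of `x`. The edges are kept. -/
def reattach (D : JacobiDiagram) (τ : Equiv.Perm (Fin D.card)) : JacobiDiagram where
  card := D.card
  rot := τ * D.rot * τ⁻¹
  rot_cube := fun x => by simp [Equiv.Perm.mul_apply, D.rot_cube]
  edge := D.edge
  edge_edge := D.edge_edge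
  edge_ne := D.edge_ne

/-- Reverse the cyclic order at the vertex of `h`: `(h a b)` becomes `(h b a)`. -/
def flip (D : JacobiDiagram) (h : Fin D.card) : JacobiDiagram :=
  D.reattach (Equiv.swap (D.rot h) (D.rot (D.rot h)))

/-- The edge of `h` joins two different trivalent vertices. -/
def IsInner (D : JacobiDiagram) (h : Fin D.card) : Prop :=
  ¬ D.IsUnivalent h ∧ ¬ D.IsUnivalent (D.edge h) ∧ ¬ D.rot.SameCycle h (D.edge h)

/-- View the edge `{h, h'}` of `D` as the vertical bar of the letter "I", with upper vertex
`(h a b)` and lower vertex `(h' c d)`, counterclockwise, so that `a, b, c, d` go to the north-east,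
north-west, south-west and south-east. This is the diagram "H", whose left vertex is `(h b c)` and
whose right vertex is `(h' d a)`. -/
def diagramH (D : JacobiDiagram) (h : Fin D.card) : JacobiDiagram :=
  let a := D.rot h
  let b := D.rot a
  let c := D.rot (D.edge h)
  let d := D.rot c
  D.reattach (Equiv.swap a b * Equiv.swap b c * Equiv.swap c d)

/-- In the situation of `diagramH`, the diagram "X": it is "H" with the two lower ends exchanged,
so its left vertex is `(h b d)` and its right vertex is `(h' c a)`. -/
def diagramX (D : JacobiDiagram) (h : Fin D.card) : JacobiDiagram :=
  let a := D.rot h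
  let b := D.rot a
  let d := D.rot (D.rot (D.edge h))
  D.reattach (Equiv.swap a b * Equiv.swap b d)

/-- Some trivalent vertex is adjacent to two legs. -/
def HasFork (D : JacobiDiagram) : Prop :=
  ∃ x, ¬ D.IsUnivalent x ∧ D.IsUnivalent (D.edge x) ∧ D.IsUnivalent (D.edge (D.rot x))

/-- The half-edge `x` belongs to a trivalent vertex that is not adjacent to a leg. Such vertices
are the vertices of the internal graph. -/
def IsCore (D : JacobiDiagram) (x : Fin D.card) : Prop :=
  ¬ D.IsUnivalent x ∧ ∀ y, D.rot.SameCycle x y → ¬ D.IsUnivalent (D.edge y)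

/-- Crossing the edge that starts with `x` leads to a trivalent vertex carrying a leg `w`, and `z`
is the third half-edge at that vertex. -/
def ArcStep (D : JacobiDiagram) (x z : Fin D.card) : Prop :=
  ∃ w, D.IsUnivalent (D.edge w) ∧
    ((D.rot (D.edge x) = w ∧ D.rot w = z) ∨ (D.rot z = w ∧ D.rot w = D.edge x))

/-- After removing the legs, `x` and `y` are the two ends of one arc. -/
def ArcJoins (D : JacobiDiagram) (x y : Fin D.card) : Prop :=
  ∃ z, Relation.ReflTransGen D.ArcStep x z ∧ D.edge z = y

/-- `D` has no fork and its internal graph, obtained by removing the legs, is the trivalent graph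
`Γ`; the orientations of the vertices are ignored. -/
def HasInternalGraph (D Γ : JacobiDiagram) : Prop :=
  ¬ D.HasFork ∧ ∃ f : Fin Γ.card → Fin D.card,
    Function.Injective f ∧ Set.range f = {x | D.IsCore x} ∧
    (∀ x y, Γ.rot.SameCycle x y ↔ D.rot.SameCycle (f x) (f y)) ∧
    ∀ x, D.ArcJoins (f x) (f (Γ.edge x))

/-- The edge of `h` has an end vertex adjacent to a leg (different from that edge if the edge is
inner). -/
def IsLegSite (D : JacobiDiagram) (h : Fin D.card) : Prop :=
  D.IsUnivalent (D.edge (D.rot h)) ∨ D.IsUnivalent (D.edge (D.rot (D.rot h))) ∨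
  D.IsUnivalent (D.edge (D.rot (D.edge h))) ∨
  D.IsUnivalent (D.edge (D.rot (D.rot (D.edge h))))

/-- The tetrahedron: the half-edges `3 i`, `3 i + 1`, `3 i + 2` at the vertex `i` lead to the other
three vertices in increasing order. -/
def tetrahedron : JacobiDiagram where
  card := 12
  rot := ⟨![1, 2, 0, 4, 5, 3, 7, 8, 6, 10, 11, 9], ![2, 0, 1, 5, 3, 4, 8, 6, 7, 11, 9, 10],
    by decide, by decide⟩
  rot_cube := by decide
  edge := ⟨![3, 6, 9, 0, 7, 10, 1, 4, 11, 2, 5, 8], ![3, 6, 9, 0, 7, 10, 1, 4, 11, 2, 5, 8],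
    by decide, by decide⟩
  edge_edge := by decide
  edge_ne := by decide

/-- The relations among the diagrams of a class `P`: isomorphic diagrams are identified, the AS
relation `D = - D'`, and the IHX relation `I = H - X` at the inner edges allowed by `site`. -/
inductive Relator (P : Set JacobiDiagram) (site : (D : JacobiDiagram) → Fin D.card → Prop) :
    (P →₀ ℚ) → Prop
  | iso (D D' : P) : D.1.Iso D'.1 →
      Relator P site (Finsupp.single D 1 - Finsupp.single D' 1)
  | antisymm (D D' : P) (h : Fin D.1.card) : ¬ D.1.IsUnivalent h → D'.1 = D.1.flip h →
      Relator P site (Finsupp.single D 1 + Finsupp.single D' 1)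
  | ihx (I H X : P) (h : Fin I.1.card) : I.1.IsInner h → site I.1 h →
      H.1 = I.1.diagramH h → X.1 = I.1.diagramX h →
      Relator P site (Finsupp.single I 1 - (Finsupp.single H 1 - Finsupp.single X 1))

/-- The rational vector space spanned by the diagrams of the class `P` subject to these relations. -/
abbrev Space (P : Set JacobiDiagram) (site : (D : JacobiDiagram) → Fin D.card → Prop) : Type :=
  (P →₀ ℚ) ⧸ Submodule.span ℚ {r : P →₀ ℚ | Relator P site r}

/-- The class of a diagram. -/
noncomputable def toSpace (P : Set JacobiDiagram) (site : (D : JacobiDiagram) → Fin D.card → Prop)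
    (D : P) : Space P site :=
  Submodule.Quotient.mk (Finsupp.single D 1)

/-- The subspace spanned by the diagrams of even degree. -/
noncomputable def evenPart (P : Set JacobiDiagram)
    (site : (D : JacobiDiagram) → Fin D.card → Prop) : Submodule ℚ (Space P site) :=
  Submodule.span ℚ {a | ∃ D : P, Even D.1.degree ∧ toSpace P site D = a}

/-- The subspace spanned by the diagrams with `n` legs. -/
noncomputable def legPart (P : Set JacobiDiagram)
    (site : (D : JacobiDiagram) → Fin D.card → Prop) (n : ℕ) : Submodule ℚ (Space P site) :=
  Submodule.span ℚ {a | ∃ D : P, D.1.numLegs = n ∧ toSpace P site D = a}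

/-- The `n`-loop Jacobi diagrams. With `allSites` they give the space of `n`-loop diagrams. -/
def loopDiagrams (n : ℕ) : Set JacobiDiagram := {D | D.IsLoop n}

/-- All inner edges. -/
def allSites : (D : JacobiDiagram) → Fin D.card → Prop := fun _ _ => True

/-- The generators of the space `𝒜(Γ)` for an `n`-loop trivalent graph `Γ`, the relations being AS
and the IHX relations on the legs (`IsLegSite`). An IHX relation on the legs does not change the
internal graph, except that one of its terms may have a trivalent vertex adjacent to two legs; such
diagrams are admitted as generators, which vanish by the AS relation. The symmetries of `Γ` act by
isomorphisms of diagrams. -/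
def internalDiagrams (n : ℕ) (Γ : JacobiDiagram) : Set JacobiDiagram :=
  {D | D.IsLoop n ∧ (D.HasFork ∨ D.HasInternalGraph Γ)}

end JacobiDiagram

namespace FaceAlgebra

/-- The algebra `ℚ[y₁, y₂, y₃, y₄] / (y₁ + y₂ + y₃ + y₄)`. -/
abbrev FaceRing : Type :=
  MvPolynomial (Fin 4) ℚ ⧸ Ideal.span {(∑ i, MvPolynomial.X i : MvPolynomial (Fin 4) ℚ)}

/-- The quotient map. -/
noncomputable def proj : MvPolynomial (Fin 4) ℚ →ₐ[ℚ] FaceRing := Ideal.Quotient.mkₐ ℚ _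

/-- The image of the `i`-th elementary symmetric polynomial. -/
noncomputable def sigma (i : ℕ) : FaceRing := proj (MvPolynomial.esymm (Fin 4) ℚ i)

/-- The subspace of classes of homogeneous polynomials of degree `n`. -/
noncomputable def homogeneous (n : ℕ) : Submodule ℚ FaceRing :=
  (MvPolynomial.homogeneousSubmodule (Fin 4) ℚ n).map proj.toLinearMap

/-- The subalgebra `ℚ[σ₂, σ₃², σ₄]`. -/
noncomputable def sigmaAlgebra : Subalgebra ℚ FaceRing :=
  Algebra.adjoin ℚ {sigma 2, sigma 3 ^ 2, sigma 4}

end FaceAlgebra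

/-!
The idea is to describe a tetrahedron with legs by a polynomial in the four faces of the tetrahedron,
to reduce all three-loop diagrams to tetrahedra, and to recover the polynomial by a weight system.

*Legs as variables.* When one leg is attached to a fixed diagram, the AS and IHX relations on the legs
say that the resulting class, as a function of the half-edge at which the leg is attached, is a flow
(`IsGood.isFlow_cls_attach`): it changes sign when the half-edge is reversed, its sum over the
half-edges at a trivalent vertex vanishes, and it is zero on legs. Attaching legs is commutative, so
that the diagrams with trivalent part `B` are the monomials in the half-edges of `B` (`legMap`), and
modulo the relations these variables form a flow (`isFlow_mk_X`). A diagram is either zero, because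
some vertex is adjacent to two legs, or arises from a trivalent graph by attaching legs
(`exists_graphIso_withLegs`).

*The tetrahedron.* A flow on the tetrahedron is determined by its sums around the faces
(`IsFlow.faceSum_sub`), which add up to zero. Hence the tetrahedra with legs are the image of the
polynomials in the four faces, modulo the sum of the faces (`faceMap`, `faceMap_eq_of_proj_eq`). The
symmetries of the tetrahedron permute the faces, up to the signs of the variables, which do not matter
in even degree (`faceMap_rename`). By averaging, the even part is the image of the symmetric
polynomials of even degree (`evenPart_eq`).

*Surjectivity.* By the IHX relation at the edge next to a loop, loops can be removed from a trivalent
three-loop graph, and the relation at the edge next to a double edge turns a graph without loops into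
tetrahedra. A graph with neither loops nor double edges is the tetrahedron. Legs on the edge in
question are moved out of the way first, so every three-loop diagram is a combination of tetrahedra
with as many legs (`cls_mem_of_isLoop`).

*Injectivity.* Label both sides of every edge by elements of a set, let a trivalent vertex be weighted
by the structure constants of the Lie algebra `gl` and a univalent one by a variable attached to its
label. By the Jacobi identity the sum of the weights over all labellings respects the IHX relation
(`stateSum_ihx`), and a leg multiplies the weight by the difference of the variables on the two sides
of its edge (`stateSum_attach`). The alternating sum over the subsets of a set of four labels keeps
only the labellings by all of the four labels (`surjSum_eq`). On the tetrahedron, the weight of a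
labelling is a signed sum over the cyclic orders at the vertices, each asking for a labelling of the
faces of the corresponding surface. Unless this surface is the sphere, with either orientation, it has
only two faces and does not contribute, and the sphere contributes the numberings of the four faces
(`weightProd_tetrahedron`, `weightMap_withLegs`). Thus the weight system returns, up to a constant,
the class of an even symmetric polynomial in the faces (`faceWeight_faceMap`). The even parts of the
space of tetrahedra and of the space of all three-loop diagrams are both identified with the even
symmetric polynomials modulo the sum of the variables (`bijOn_evenPart`), compatibly with degrees
(`mem_legPart_iff`).

*The algebra.* Modulo the first elementary symmetric polynomial, the even symmetric polynomials form
the subalgebra generated by `σ₂`, `σ₃²` and `σ₄` (`mem_sigmaAlgebra_iff`), which are algebraically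
independent (`algebraicIndependent_sigma_sq`). The dimensions are therefore the numbers of monomials
in variables of the weights `2`, `6` and `4` (`coeff_prod_geometricSeries`), and the closed formula
satisfies the linear recurrence of the generating function (`mk_floor_eq`).
-/

namespace JacobiDiagram

/-! ### Half-edges, vertices and isomorphisms of the underlying graphs -/

attribute [simp] edge_edge rot_cube edge_ne

variable {D D' D'' : JacobiDiagram}

theorem rot_sq_eq_iff (x : Fin D.card) : D.rot (D.rot x) = x ↔ D.rot x = x := by
  refine ⟨fun h => ?_, fun h => by rw [h, h]⟩
  have := D.rot_cube x
  rwa [h] at this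

theorem rot_sq_eq_rot_iff (x : Fin D.card) : D.rot (D.rot x) = D.rot x ↔ D.rot x = x :=
  D.rot.injective.eq_iff

@[simp] theorem isUnivalent_rot (x : Fin D.card) : D.IsUnivalent (D.rot x) ↔ D.IsUnivalent x :=
  D.rot.injective.eq_iff

theorem edge_eq_comm (x y : Fin D.card) : D.edge x = y ↔ x = D.edge y :=
  ⟨fun h => by rw [← h, edge_edge], fun h => by rw [h, edge_edge]⟩

theorem sameCycle_rot_iff {x y : Fin D.card} :
    D.rot.SameCycle x y ↔ y = x ∨ y = D.rot x ∨ y = D.rot (D.rot x) := by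
  constructor
  · intro h
    obtain ⟨i, -, rfl⟩ := h.exists_pow_eq'
    clear h
    induction i with
    | zero => simp
    | succ i ih =>
      rw [pow_succ', Equiv.Perm.mul_apply]
      rcases ih with h | h | h <;> rw [h] <;> simp
  · rintro (rfl | rfl | rfl)
    · exact Equiv.Perm.SameCycle.refl _ _
    · simp [Equiv.Perm.SameCycle.refl]
    · simp [Equiv.Perm.SameCycle.refl]

theorem sameCycle_edge_iff {x y : Fin D.card} :
    D.edge.SameCycle x y ↔ y = x ∨ y = D.edge x := by
  constructor
  · intro h
    obtain ⟨i, -, rfl⟩ := h.exists_pow_eq'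
    clear h
    induction i with
    | zero => simp
    | succ i ih =>
      rw [pow_succ', Equiv.Perm.mul_apply]
      rcases ih with h | h <;> rw [h] <;> simp
  · rintro (rfl | rfl)
    · exact Equiv.Perm.SameCycle.refl _ _
    · simp [Equiv.Perm.SameCycle.refl]

/-- The identity, as a bijection from the half-edges of `D` to those of `D.reattach τ`. -/
def reattachEquiv (D : JacobiDiagram) (τ : Equiv.Perm (Fin D.card)) :
    Fin D.card ≃ Fin (D.reattach τ).card := Equiv.refl _

theorem reattach_rot (τ : Equiv.Perm (Fin D.card)) (y) :
    (D.reattach τ).rot (D.reattachEquiv τ y) = D.reattachEquiv τ (τ (D.rot (τ⁻¹ y))) := rfl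

theorem reattach_edge (τ : Equiv.Perm (Fin D.card)) (y) :
    (D.reattach τ).edge (D.reattachEquiv τ y) = D.reattachEquiv τ (D.edge y) := rfl

/-- The identity, as a bijection from the half-edges of `D` to those of `D.flip h`. -/
def flipEquiv (D : JacobiDiagram) (h : Fin D.card) : Fin D.card ≃ Fin (D.flip h).card :=
  D.reattachEquiv _

theorem flip_rot (h y : Fin D.card) : (D.flip h).rot (D.flipEquiv h y) =
    D.flipEquiv h (if D.rot.SameCycle h y then D.rot (D.rot y) else D.rot y) := by
  refine (reattach_rot _ y).trans (congrArg (D.flipEquiv h) ?_)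
  have h3 := D.rot_cube
  have hinj := D.rot.injective
  simp only [sameCycle_rot_iff, Equiv.swap_inv, Equiv.swap_apply_def]
  grind

theorem flip_edge (h y : Fin D.card) :
    (D.flip h).edge (D.flipEquiv h y) = D.flipEquiv h (D.edge y) := rfl

/-- An isomorphism of the underlying graphs, which may reverse the cyclic order at some of the
vertices. -/
def GraphIso (D D' : JacobiDiagram) (φ : Fin D.card ≃ Fin D'.card) : Prop :=
  (∀ x, φ (D.edge x) = D'.edge (φ x)) ∧
    ∀ x, φ (D.rot x) = D'.rot (φ x) ∨ φ (D.rot x) = D'.rot (D'.rot (φ x))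

namespace GraphIso

variable {φ : Fin D.card ≃ Fin D'.card} {ψ : Fin D'.card ≃ Fin D''.card}

theorem of_iso (h : ∀ x, φ (D.rot x) = D'.rot (φ x)) (h' : ∀ x, φ (D.edge x) = D'.edge (φ x)) :
    GraphIso D D' φ := ⟨h', fun x => Or.inl (h x)⟩

theorem refl (D : JacobiDiagram) : GraphIso D D (Equiv.refl _) := .of_iso (by simp) (by simp)

theorem flip (D : JacobiDiagram) (h : Fin D.card) : GraphIso D (D.flip h) (D.flipEquiv h) := by
  refine ⟨fun x => rfl, fun x => ?_⟩
  by_cases hx : D.rot.SameCycle h x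
  · right
    have hx' : D.rot.SameCycle h (D.rot (D.rot x)) := by simpa using hx
    rw [flip_rot, if_pos hx, flip_rot, if_pos hx', D.rot_cube]
  · left
    rw [flip_rot, if_neg hx]

theorem edge (h : GraphIso D D' φ) (x) : φ (D.edge x) = D'.edge (φ x) := h.1 x

theorem rot_eq (h : GraphIso D D' φ) (x) :
    (φ (D.rot x) = D'.rot (φ x) ∧ φ (D.rot (D.rot x)) = D'.rot (D'.rot (φ x))) ∨
    (φ (D.rot x) = D'.rot (D'.rot (φ x)) ∧ φ (D.rot (D.rot x)) = D'.rot (φ x)) := by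
  have h1 := h.2 x
  have h2 := h.2 (D.rot x)
  have h3 := h.2 (D.rot (D.rot x))
  have := D.rot_cube
  have := D'.rot_cube
  have := D.rot.injective
  have := φ.injective
  have := D'.rot.injective
  grind

theorem symm (h : GraphIso D D' φ) : GraphIso D' D φ.symm := by
  refine ⟨fun x => ?_, fun x => ?_⟩
  · rw [Equiv.symm_apply_eq, h.edge, Equiv.apply_symm_apply]
  · have := h.rot_eq (φ.symm x)
    simp only [Equiv.apply_symm_apply] at this
    rw [Equiv.symm_apply_eq, Equiv.symm_apply_eq]
    tauto

theorem trans (h : GraphIso D D' φ) (h' : GraphIso D' D'' ψ) : GraphIso D D'' (φ.trans ψ) := by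
  refine ⟨fun x => by simp [h.edge, h'.edge], fun x => ?_⟩
  have h1 := h.rot_eq x
  have h2 := h'.rot_eq (φ x)
  simp only [Equiv.trans_apply]
  grind

theorem isUnivalent (h : GraphIso D D' φ) (x) : D'.IsUnivalent (φ x) ↔ D.IsUnivalent x := by
  have h1 := h.rot_eq x
  have := φ.injective
  have := D'.rot.injective
  unfold IsUnivalent
  grind

theorem sameCycle (h : GraphIso D D' φ) (x y) :
    D'.rot.SameCycle (φ x) (φ y) ↔ D.rot.SameCycle x y := by
  simp only [sameCycle_rot_iff, φ.injective.eq_iff]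
  rcases h.rot_eq x with h1 | h1
  · rw [← h1.2, ← h1.1]; simp
  · rw [← h1.1, ← h1.2]; simp; tauto

theorem card_eq (_h : GraphIso D D' φ) : D.card = D'.card := by
  simpa using Fintype.card_congr φ

theorem numLegs_eq (h : GraphIso D D' φ) : D.numLegs = D'.numLegs :=
  Nat.card_congr (φ.subtypeEquiv fun x => (h.isUnivalent x).symm)

end GraphIso

/-! ### Connectedness and the Euler number -/

/-- Every predicate on half-edges that propagates along `rot` and `edge` and holds somewhere holds
everywhere. -/
theorem isConnected_iff : D.IsConnected ↔ 0 < D.card ∧ ∀ p : Fin D.card → Prop,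
    (∀ x, p x → p (D.rot x)) → (∀ x, p x → p (D.edge x)) → ∀ x y, p x → p y := by
  refine and_congr_right fun _ => ⟨fun h p hr he x y hx => ?_, fun h x y => ?_⟩
  · have key : p x ↔ p y := by
      clear hx
      induction h x y with
      | rel a b hab =>
        rcases hab with rfl | rfl
        · exact ⟨hr a, fun h => by simpa using hr _ (hr _ h)⟩
        · exact ⟨he a, fun h => by simpa using he _ h⟩
      | refl => rfl
      | symm _ _ _ ih => exact ih.symm
      | trans _ _ _ _ _ ih1 ih2 => exact ih1.trans ih2
    exact key.1 hx
  · exact h (fun z => Relation.EqvGen _ x z)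
      (fun z hz => hz.trans _ _ _ (.rel _ _ (Or.inl rfl)))
      (fun z hz => hz.trans _ _ _ (.rel _ _ (Or.inr rfl))) x y (.refl _)

theorem two_mul_numEdges (D : JacobiDiagram) : 2 * D.numEdges = D.card := by
  classical
  have h1 := Finset.card_eq_sum_card_fiberwise (s := (Finset.univ : Finset (Fin D.card)))
    (t := (Finset.univ : Finset (Quotient (Equiv.Perm.SameCycle.setoid D.edge))))
    (f := fun x => Quotient.mk _ x) (by simp)
  have h2 : ∀ q ∈ (Finset.univ : Finset (Quotient (Equiv.Perm.SameCycle.setoid D.edge))),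
      (Finset.univ.filter fun x => (Quotient.mk _ x : Quotient _) = q).card = 2 := by
    intro q _
    induction q using Quotient.inductionOn with
    | h x =>
      rw [Finset.card_eq_two]
      refine ⟨x, D.edge x, (D.edge_ne x).symm, ?_⟩
      ext y
      simp only [Finset.mem_filter, Finset.mem_univ, true_and, Finset.mem_insert,
        Finset.mem_singleton, ← sameCycle_edge_iff]
      rw [Quotient.eq]
      exact Equiv.Perm.sameCycle_comm
  rw [Finset.sum_congr rfl h2] at h1
  simp only [Finset.card_univ, Fintype.card_fin, Finset.sum_const, smul_eq_mul] at h1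
  rw [numEdges, Nat.card_eq_fintype_card]
  omega

theorem three_mul_numVertices (D : JacobiDiagram) :
    3 * D.numVertices = D.card + 2 * D.numLegs := by
  classical
  let Q := Quotient (Equiv.Perm.SameCycle.setoid D.rot)
  have h1 := Finset.sum_fiberwise (s := (Finset.univ : Finset (Fin D.card)))
    (g := fun x => (Quotient.mk _ x : Q)) (f := fun x => if D.IsUnivalent x then 3 else 1)
  have h2 : ∀ q ∈ (Finset.univ : Finset Q),
      ∑ x ∈ Finset.univ with (Quotient.mk _ x : Q) = q, (if D.IsUnivalent x then 3 else 1) = 3 := by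
    intro q _
    induction q using Quotient.inductionOn with
    | h x =>
      have h3 : (Finset.univ.filter fun y => (Quotient.mk _ y : Q) = Quotient.mk _ x) =
          {x, D.rot x, D.rot (D.rot x)} := by
        ext y
        simp only [Finset.mem_filter, Finset.mem_univ, true_and, Finset.mem_insert,
          Finset.mem_singleton, ← sameCycle_rot_iff]
        rw [Quotient.eq]
        exact Equiv.Perm.sameCycle_comm
      rw [h3]
      by_cases hx : D.IsUnivalent x
      · have hx' : D.rot x = x := hx
        simp [hx', hx]
      · have e1 := mt (rot_sq_eq_iff x).1 hx
        have e2 := mt (rot_sq_eq_rot_iff x).1 hx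
        rw [Finset.sum_insert, Finset.sum_insert, Finset.sum_singleton]
        · simp [hx]
        · simpa using Ne.symm e2
        · simpa using ⟨Ne.symm hx, Ne.symm e1⟩
  rw [Finset.sum_congr rfl h2] at h1
  have h4 : ∑ x : Fin D.card, (if D.IsUnivalent x then 3 else 1) = D.card + 2 * D.numLegs := by
    have : ∀ x : Fin D.card, (if D.IsUnivalent x then 3 else 1) =
        1 + 2 * (if D.IsUnivalent x then 1 else 0) := by intro x; split_ifs <;> rfl
    rw [Finset.sum_congr rfl fun x _ => this x, Finset.sum_add_distrib, ← Finset.mul_sum,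
      Finset.sum_boole, numLegs, Nat.card_eq_fintype_card, Fintype.card_subtype]
    simp
  rw [h4] at h1
  rw [← h1, numVertices, Nat.card_eq_fintype_card]
  simp [Q, mul_comm]

/-- For a connected diagram, being `3`-loop is a linear condition on the numbers of half-edges and
of legs. -/
theorem isLoop_three_iff : D.IsLoop 3 ↔ D.IsConnected ∧ D.card = 4 * D.numLegs + 12 := by
  have h1 := D.two_mul_numEdges
  have h2 := D.three_mul_numVertices
  unfold IsLoop
  refine and_congr_right fun _ => ?_
  push_cast
  omega

theorem IsLoop.degree_eq (h : D.IsLoop 3) : D.degree = D.numLegs + 2 := by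
  have h2 := D.three_mul_numVertices
  have h3 := (isLoop_three_iff.1 h).2
  unfold degree
  omega

theorem IsLoop.even_degree_iff (h : D.IsLoop 3) : Even D.degree ↔ Even D.numLegs := by
  rw [h.degree_eq]; simp [Nat.even_add]

theorem GraphIso.isConnected {φ : Fin D.card ≃ Fin D'.card} (h : GraphIso D D' φ)
    (hD : D.IsConnected) : D'.IsConnected := by
  rw [isConnected_iff] at *
  refine ⟨h.card_eq ▸ hD.1, fun p hr he x y hx => ?_⟩
  have := hD.2 (fun z => p (φ z)) (fun z hz => ?_) (fun z hz => ?_) (φ.symm x) (φ.symm y)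
    (by simpa using hx)
  · simpa using this
  · rcases h.2 z with h' | h' <;> rw [h']
    · exact hr _ hz
    · exact hr _ (hr _ hz)
  · rw [h.1]; exact he _ hz

theorem GraphIso.isLoop {φ : Fin D.card ≃ Fin D'.card} (h : GraphIso D D' φ)
    (hD : D.IsLoop 3) : D'.IsLoop 3 := by
  rw [isLoop_three_iff] at *
  exact ⟨h.isConnected hD.1, by rw [← h.card_eq, ← h.numLegs_eq]; exact hD.2⟩

end JacobiDiagram

namespace JacobiDiagram

variable {D D' D'' : JacobiDiagram}

/-! ### Attaching a leg -/

/-- The diagram with set of half-edges `α`, which is enumerated by a chosen bijection with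
`Fin (Fintype.card α)`. -/
noncomputable def ofPerms (α : Type) [Fintype α] (rot edge : Equiv.Perm α)
    (h1 : ∀ x, rot (rot (rot x)) = x) (h2 : ∀ x, edge (edge x) = x) (h3 : ∀ x, edge x ≠ x) :
    JacobiDiagram where
  card := Fintype.card α
  rot := (Fintype.equivFin α).permCongr rot
  rot_cube := by simp [h1]
  edge := (Fintype.equivFin α).permCongr edge
  edge_edge := by simp [h2]
  edge_ne := fun x h => h3 ((Fintype.equivFin α).symm x) <| by
    rwa [Equiv.permCongr_apply, ← Equiv.eq_symm_apply] at h

/-- The enumeration of the half-edges of `ofPerms`. -/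
noncomputable def ofPermsEquiv (α : Type) [Fintype α] (rot edge : Equiv.Perm α) (h1 h2 h3) :
    α ≃ Fin (ofPerms α rot edge h1 h2 h3).card := Fintype.equivFin α

section ofPerms

variable {α : Type} [Fintype α] {rot edge : Equiv.Perm α} {h1 h2 h3}

theorem ofPerms_rot (x : α) : (ofPerms α rot edge h1 h2 h3).rot (ofPermsEquiv α rot edge h1 h2 h3 x)
    = ofPermsEquiv α rot edge h1 h2 h3 (rot x) :=
  congrArg (fun z => Fintype.equivFin α (rot z)) ((Fintype.equivFin α).symm_apply_apply x)

theorem ofPerms_edge (x : α) :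
    (ofPerms α rot edge h1 h2 h3).edge (ofPermsEquiv α rot edge h1 h2 h3 x)
    = ofPermsEquiv α rot edge h1 h2 h3 (edge x) :=
  congrArg (fun z => Fintype.equivFin α (edge z)) ((Fintype.equivFin α).symm_apply_apply x)

end ofPerms

/-- The rotation at the two vertices of a new leg: the trivalent vertex is `(0 1 2)`, and the
univalent one is `3`. -/
def legRot : Equiv.Perm (Fin 4) := ⟨![1, 2, 0, 3], ![2, 0, 1, 3], by decide, by decide⟩

/-- The edges after a leg has been attached to the edge of `x`: the half-edges `x` and `edge x` now
lead to the new vertex `(0 1 2)`, and the leg is `{2, 3}`. -/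
def attachEdge (D : JacobiDiagram) (x : Fin D.card) : Fin D.card ⊕ Fin 4 → Fin D.card ⊕ Fin 4
  | .inl y => if y = x then .inr 0 else if y = D.edge x then .inr 1 else .inl (D.edge y)
  | .inr 0 => .inl x
  | .inr 1 => .inl (D.edge x)
  | .inr 2 => .inr 3
  | .inr 3 => .inr 2

theorem attachEdge_attachEdge (D : JacobiDiagram) (x : Fin D.card) (y) :
    D.attachEdge x (D.attachEdge x y) = y := by
  have := D.edge_ne x
  have := D.edge_edge
  have := D.edge.injective
  rcases y with y | k
  · simp only [attachEdge]
    by_cases h1 : y = x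
    · simp [h1]
    · by_cases h2 : y = D.edge x
      · simp [h2, D.edge_ne]
      · have h3 : D.edge y ≠ x := by rwa [Ne, edge_eq_comm]
        simp [h1, h2, h3]
  · fin_cases k <;> simp [attachEdge]

theorem attachEdge_ne (D : JacobiDiagram) (x : Fin D.card) (y) : D.attachEdge x y ≠ y := by
  rcases y with y | k
  · simp only [attachEdge]
    split_ifs <;> simp
  · fin_cases k <;> simp [attachEdge]

/-- Attach a leg to the edge of `x`. At the new vertex, the half-edge towards `x` is followed by
the half-edge towards `edge x` and then by the leg. -/
noncomputable def attach (D : JacobiDiagram) (x : Fin D.card) : JacobiDiagram :=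
  ofPerms (Fin D.card ⊕ Fin 4) (Equiv.sumCongr D.rot legRot)
    ⟨D.attachEdge x, D.attachEdge x, D.attachEdge_attachEdge x, D.attachEdge_attachEdge x⟩
    (by
      rintro (y | k)
      · simp
      · fin_cases k <;> rfl)
    (D.attachEdge_attachEdge x) (D.attachEdge_ne x)

/-- The half-edges of `D.attach x`: those of `D` and four new ones. -/
noncomputable def attachEquiv (D : JacobiDiagram) (x : Fin D.card) :
    Fin D.card ⊕ Fin 4 ≃ Fin (D.attach x).card := ofPermsEquiv _ _ _ _ _ _

/-- A half-edge of `D`, as a half-edge of `D.attach x`. -/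
noncomputable def old (D : JacobiDiagram) (x y : Fin D.card) : Fin (D.attach x).card :=
  D.attachEquiv x (.inl y)

/-- The half-edges of `D.attach x` that are not in `D`. -/
noncomputable def new (D : JacobiDiagram) (x : Fin D.card) (k : Fin 4) : Fin (D.attach x).card :=
  D.attachEquiv x (.inr k)

section attach

variable (x y : Fin D.card)

@[simp] theorem attachEquiv_inl : D.attachEquiv x (.inl y) = D.old x y := rfl

@[simp] theorem attachEquiv_inr (k) : D.attachEquiv x (.inr k) = D.new x k := rfl

@[simp] theorem attachEquiv_symm_old : (D.attachEquiv x).symm (D.old x y) = .inl y := by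
  simp [old, -attachEquiv_inl]

@[simp] theorem attachEquiv_symm_new (k) : (D.attachEquiv x).symm (D.new x k) = .inr k := by
  simp [new, -attachEquiv_inr]

@[elab_as_elim]
theorem attach_cases {p : Fin (D.attach x).card → Prop} (h : ∀ y, p (D.old x y))
    (h0 : p (D.new x 0)) (h1 : p (D.new x 1)) (h2 : p (D.new x 2)) (h3 : p (D.new x 3)) (z) :
    p z := by
  obtain ⟨y | k, rfl⟩ := (D.attachEquiv x).surjective z
  · exact h y
  · fin_cases k
    exacts [h0, h1, h2, h3]

theorem attach_card : (D.attach x).card = D.card + 4 := by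
  simp [attach, ofPerms]

theorem old_injective : Function.Injective (D.old x) :=
  (D.attachEquiv x).injective.comp Sum.inl_injective

@[simp] theorem old_inj {a b : Fin D.card} : D.old x a = D.old x b ↔ a = b :=
  (old_injective x).eq_iff

@[simp] theorem new_inj {a b : Fin 4} : D.new x a = D.new x b ↔ a = b :=
  ((D.attachEquiv x).injective.comp Sum.inr_injective).eq_iff

@[simp] theorem old_ne_new {a : Fin D.card} {k : Fin 4} : D.old x a ≠ D.new x k :=
  fun h => Sum.inl_ne_inr ((D.attachEquiv x).injective h)

@[simp] theorem new_ne_old {a : Fin D.card} {k : Fin 4} : D.new x k ≠ D.old x a :=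
  (old_ne_new x).symm

@[simp] theorem attach_rot_old : (D.attach x).rot (D.old x y) = D.old x (D.rot y) := ofPerms_rot _

theorem attach_rot_new (k : Fin 4) : (D.attach x).rot (D.new x k) = D.new x (legRot k) :=
  ofPerms_rot _

@[simp] theorem attach_rot_new_zero : (D.attach x).rot (D.new x 0) = D.new x 1 := ofPerms_rot _
@[simp] theorem attach_rot_new_one : (D.attach x).rot (D.new x 1) = D.new x 2 := ofPerms_rot _
@[simp] theorem attach_rot_new_two : (D.attach x).rot (D.new x 2) = D.new x 0 := ofPerms_rot _
@[simp] theorem attach_rot_new_three : (D.attach x).rot (D.new x 3) = D.new x 3 := ofPerms_rot _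

theorem attach_edge_equiv (z) :
    (D.attach x).edge (D.attachEquiv x z) = D.attachEquiv x (D.attachEdge x z) := ofPerms_edge _

@[simp] theorem attach_edge_new_zero : (D.attach x).edge (D.new x 0) = D.old x x :=
  attach_edge_equiv x _
@[simp] theorem attach_edge_new_one : (D.attach x).edge (D.new x 1) = D.old x (D.edge x) :=
  attach_edge_equiv x _
@[simp] theorem attach_edge_new_two : (D.attach x).edge (D.new x 2) = D.new x 3 :=
  attach_edge_equiv x _
@[simp] theorem attach_edge_new_three : (D.attach x).edge (D.new x 3) = D.new x 2 :=
  attach_edge_equiv x _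

@[simp] theorem attach_edge_old_self : (D.attach x).edge (D.old x x) = D.new x 0 := by
  rw [← attach_edge_new_zero, edge_edge]

@[simp] theorem attach_edge_old_edge : (D.attach x).edge (D.old x (D.edge x)) = D.new x 1 := by
  rw [← attach_edge_new_one, edge_edge]

variable {x y}

theorem attach_edge_old (h : y ≠ x) (h' : y ≠ D.edge x) :
    (D.attach x).edge (D.old x y) = D.old x (D.edge y) := by
  rw [old, attach_edge_equiv, attachEdge, if_neg h, if_neg h', old]

theorem attach_edge_old_eq_ite (x y : Fin D.card) : (D.attach x).edge (D.old x y) =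
    if y = x then D.new x 0 else if y = D.edge x then D.new x 1 else D.old x (D.edge y) := by
  split_ifs with h h'
  · rw [h, attach_edge_old_self]
  · rw [h', attach_edge_old_edge]
  · exact attach_edge_old h h'

@[simp] theorem isUnivalent_old : (D.attach x).IsUnivalent (D.old x y) ↔ D.IsUnivalent y := by
  simp [IsUnivalent]

@[simp] theorem not_isUnivalent_new_zero : ¬ (D.attach x).IsUnivalent (D.new x 0) := by
  simp [IsUnivalent]
@[simp] theorem not_isUnivalent_new_one : ¬ (D.attach x).IsUnivalent (D.new x 1) := by
  simp [IsUnivalent]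
@[simp] theorem not_isUnivalent_new_two : ¬ (D.attach x).IsUnivalent (D.new x 2) := by
  simp [IsUnivalent]
@[simp] theorem isUnivalent_new_three : (D.attach x).IsUnivalent (D.new x 3) := by
  simp [IsUnivalent]

theorem numLegs_attach (x : Fin D.card) : (D.attach x).numLegs = D.numLegs + 1 := by
  rw [numLegs, numLegs, ← Finite.card_option]
  symm
  refine Nat.card_congr (Equiv.ofBijective (fun o => o.elim ⟨D.new x 3, isUnivalent_new_three⟩
    fun y => ⟨D.old x y.1, isUnivalent_old.2 y.2⟩) ⟨?_, ?_⟩)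
  · rintro (_ | a) (_ | b) h <;> simp_all [Subtype.ext_iff]
  · rintro ⟨z, hz⟩
    induction z using attach_cases with
    | h y => exact ⟨some ⟨y, isUnivalent_old.1 hz⟩, rfl⟩
    | h3 => exact ⟨none, rfl⟩
    | _ => simp at hz

theorem isConnected_attach (x : Fin D.card) : (D.attach x).IsConnected ↔ D.IsConnected := by
  rw [isConnected_iff, isConnected_iff]
  constructor
  · rintro ⟨-, h'⟩
    refine ⟨x.pos, fun p hr he a b ha => ?_⟩
    -- extend the predicate to the new vertex and the new leg by its value on the edge of `x`
    have := h' (fun z => (∃ y, p y ∧ z = D.old x y) ∨ p x ∧ ∃ k, z = D.new x k) ?_ ?_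
      (D.old x a) (D.old x b) (Or.inl ⟨a, ha, rfl⟩)
    · simpa using this
    · refine attach_cases x ?_ ?_ ?_ ?_ ?_ <;> simp <;> grind
    · refine attach_cases x (fun y => ?_) ?_ ?_ ?_ ?_ <;> simp
      · by_cases h1 : y = x
        · subst h1; simp
        · by_cases h2 : y = D.edge x
          · subst h2; intro h; simpa using he _ h
          · rw [attach_edge_old h1 h2]; intro h; simpa using he _ h
      · exact he _
  · rintro ⟨h, h'⟩
    refine ⟨by rw [attach_card]; omega, fun p hr he => ?_⟩
    have hr' : ∀ z, p ((D.attach x).rot z) ↔ p z := fun z =>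
      ⟨fun h => by simpa using hr _ (hr _ h), hr z⟩
    have he' : ∀ z, p ((D.attach x).edge z) ↔ p z := fun z => ⟨fun h => by simpa using he _ h, he z⟩
    have h0 : p (D.new x 0) ↔ p (D.old x x) := by simpa using (he' (D.new x 0)).symm
    have h1 : p (D.new x 1) ↔ p (D.new x 0) := by simpa using hr' (D.new x 0)
    have h2 : p (D.new x 2) ↔ p (D.new x 1) := by simpa using hr' (D.new x 1)
    have h3 : p (D.new x 3) ↔ p (D.new x 2) := by simpa using he' (D.new x 2)
    have h4 : p (D.new x 1) ↔ p (D.old x (D.edge x)) := by simpa using (he' (D.new x 1)).symm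
    have key : ∀ a b, p (D.old x a) → p (D.old x b) := by
      refine h' (fun z => p (D.old x z)) (fun z hz => by simpa using hr _ hz) (fun z hz => ?_)
      by_cases h1 : z = x
      · subst h1; tauto
      · by_cases h2 : z = D.edge x
        · subst h2; simp; tauto
        · simpa [attach_edge_old h1 h2] using he _ hz
    have key' : ∀ z, p z ↔ p (D.old x x) := by
      refine attach_cases x (fun y => ⟨key _ _, key _ _⟩) ?_ ?_ ?_ ?_ <;> tauto
    intro a b ha
    rw [key'] at *
    exact ha

theorem isLoop_attach (x : Fin D.card) : (D.attach x).IsLoop 3 ↔ D.IsLoop 3 := by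
  rw [isLoop_three_iff, isLoop_three_iff, isConnected_attach, attach_card, numLegs_attach]
  refine and_congr_right fun _ => ?_
  omega

/-- An isomorphism of graphs extends over a leg attached to corresponding edges. -/
noncomputable def attachCongr (φ : Fin D.card ≃ Fin D'.card) (x : Fin D.card) :
    Fin (D.attach x).card ≃ Fin (D'.attach (φ x)).card :=
  (D.attachEquiv x).symm.trans ((Equiv.sumCongr φ (Equiv.refl _)).trans (D'.attachEquiv (φ x)))

@[simp] theorem attachCongr_old (φ : Fin D.card ≃ Fin D'.card) (x y : Fin D.card) :
    attachCongr φ x (D.old x y) = D'.old (φ x) (φ y) := by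
  simp [attachCongr]

@[simp] theorem attachCongr_new (φ : Fin D.card ≃ Fin D'.card) (x : Fin D.card) (k) :
    attachCongr φ x (D.new x k) = D'.new (φ x) k := by
  simp [attachCongr]

theorem attachCongr_edge {φ : Fin D.card ≃ Fin D'.card} (h : ∀ x, φ (D.edge x) = D'.edge (φ x))
    (x : Fin D.card) (z) :
    attachCongr φ x ((D.attach x).edge z) = (D'.attach (φ x)).edge (attachCongr φ x z) := by
  revert z
  refine attach_cases x (fun y => ?_) ?_ ?_ ?_ ?_ <;> simp [h]
  by_cases h1 : y = x
  · subst h1; simp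
  · by_cases h2 : y = D.edge x
    · subst h2; simp [h]
    · rw [attach_edge_old h1 h2, attach_edge_old (by simpa using h1)
        (by rw [← h]; simpa using h2)]
      simp [h]

theorem attachCongr_rot_iff {φ : Fin D.card ≃ Fin D'.card} (x : Fin D.card) :
    (∀ z, attachCongr φ x ((D.attach x).rot z) = (D'.attach (φ x)).rot (attachCongr φ x z)) ↔
      ∀ y, φ (D.rot y) = D'.rot (φ y) := by
  constructor
  · intro h y
    simpa using h (D.old x y)
  · intro h
    refine attach_cases x (fun y => ?_) ?_ ?_ ?_ ?_ <;> simp [h]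

theorem GraphIso.attach {φ : Fin D.card ≃ Fin D'.card} (h : GraphIso D D' φ) (x : Fin D.card) :
    GraphIso (D.attach x) (D'.attach (φ x)) (attachCongr φ x) := by
  refine ⟨attachCongr_edge h.1 x, ?_⟩
  refine attach_cases x (fun y => ?_) ?_ ?_ ?_ ?_ <;> simp
  exact h.2 y

/-- Attaching a leg to the edge of `x` from the two sides gives isomorphic graphs. -/
noncomputable def attachEdgeEquiv (D : JacobiDiagram) (x : Fin D.card) :
    Fin (D.attach x).card ≃ Fin (D.attach (D.edge x)).card :=
  (D.attachEquiv x).symm.trans ((Equiv.sumCongr (Equiv.refl _) (Equiv.swap 0 1)).trans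
    (D.attachEquiv (D.edge x)))

@[simp] theorem attachEdgeEquiv_old (x y : Fin D.card) :
    D.attachEdgeEquiv x (D.old x y) = D.old (D.edge x) y := by
  simp [attachEdgeEquiv, -Equiv.Perm.sumCongr_refl_swap]

@[simp] theorem attachEdgeEquiv_new (x : Fin D.card) (k) :
    D.attachEdgeEquiv x (D.new x k) = D.new (D.edge x) (Equiv.swap 0 1 k) := by
  simp [attachEdgeEquiv, -Equiv.Perm.sumCongr_refl_swap]

theorem attachEdgeEquiv_edge (x : Fin D.card) (z) :
    D.attachEdgeEquiv x ((D.attach x).edge z) =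
      (D.attach (D.edge x)).edge (D.attachEdgeEquiv x z) := by
  have h3 : Equiv.swap (0 : Fin 4) 1 3 = 3 := by decide
  have h2 : Equiv.swap (0 : Fin 4) 1 2 = 2 := by decide
  have e := D.edge_edge x
  revert z
  refine attach_cases x (fun y => ?_) ?_ ?_ ?_ ?_ <;> simp [h2, h3]
  · by_cases h1 : y = x
    · subst h1
      have := attach_edge_old_edge (D.edge y)
      rw [e] at this
      simp [this]
    · by_cases h2 : y = D.edge x
      · subst h2; simp
      · rw [attach_edge_old h1 h2, attach_edge_old h2 (by rwa [e])]
        simp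

theorem GraphIso.attach_edge (x : Fin D.card) :
    GraphIso (D.attach x) (D.attach (D.edge x)) (D.attachEdgeEquiv x) := by
  refine ⟨attachEdgeEquiv_edge x, ?_⟩
  have h3 : Equiv.swap (0 : Fin 4) 1 3 = 3 := by decide
  have h2 : Equiv.swap (0 : Fin 4) 1 2 = 2 := by decide
  refine attach_cases x (fun y => ?_) ?_ ?_ ?_ ?_ <;> simp [h2, h3]

/-- The half-edges of two successive attachments, in the two orders. -/
noncomputable def attachCommEquiv (D : JacobiDiagram) (x y : Fin D.card) :
    Fin ((D.attach x).attach (D.old x y)).card ≃ Fin ((D.attach y).attach (D.old y x)).card :=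
  ((D.attach x).attachEquiv _).symm.trans <|
    (Equiv.sumCongr (D.attachEquiv x).symm (Equiv.refl _)).trans <|
    (Equiv.sumAssoc _ _ _).trans <|
    (Equiv.sumCongr (Equiv.refl _) (Equiv.sumComm _ _)).trans <|
    (Equiv.sumAssoc _ _ _).symm.trans <|
    (Equiv.sumCongr (D.attachEquiv y) (Equiv.refl _)).trans
    ((D.attach y).attachEquiv _)

@[simp] theorem attachCommEquiv_old_old (x y z : Fin D.card) :
    D.attachCommEquiv x y ((D.attach x).old _ (D.old x z)) = (D.attach y).old _ (D.old y z) := by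
  simp [attachCommEquiv]

@[simp] theorem attachCommEquiv_old_new (x y : Fin D.card) (k) :
    D.attachCommEquiv x y ((D.attach x).old _ (D.new x k)) = (D.attach y).new _ k := by
  simp [attachCommEquiv]

@[simp] theorem attachCommEquiv_new (x y : Fin D.card) (k) :
    D.attachCommEquiv x y ((D.attach x).new _ k) = (D.attach y).old _ (D.new y k) := by
  simp [attachCommEquiv]

theorem attachCommEquiv_rot (x y : Fin D.card) (z) :
    D.attachCommEquiv x y (((D.attach x).attach (D.old x y)).rot z) =
      ((D.attach y).attach (D.old y x)).rot (D.attachCommEquiv x y z) := by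
  revert z
  refine attach_cases _ (attach_cases _ (fun z => ?_) ?_ ?_ ?_ ?_) ?_ ?_ ?_ ?_ <;> simp

theorem attachCommEquiv_edge {x y : Fin D.card} (hxy : x ≠ y) (z) :
    D.attachCommEquiv x y (((D.attach x).attach (D.old x y)).edge z) =
      ((D.attach y).attach (D.old y x)).edge (D.attachCommEquiv x y z) := by
  have e := D.edge_edge x
  have e1 := D.edge_ne x
  have e2 := D.edge_ne y
  revert z
  by_cases hy : y = D.edge x
  · subst hy
    refine attach_cases _ (attach_cases _ (fun z => ?_) ?_ ?_ ?_ ?_) ?_ ?_ ?_ ?_ <;>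
      simp [attach_edge_old_eq_ite, e1, e1.symm]
    split_ifs <;> simp_all
  · have hx : x ≠ D.edge y := fun h => hy (by rw [h, edge_edge])
    have hy' : D.edge x ≠ y := Ne.symm hy
    refine attach_cases _ (attach_cases _ (fun z => ?_) ?_ ?_ ?_ ?_) ?_ ?_ ?_ ?_ <;>
      simp [attach_edge_old_eq_ite, hxy, hxy.symm, hy, hx]
    split_ifs <;> simp_all

end attach

end JacobiDiagram

namespace JacobiDiagram

variable {D D' D'' : JacobiDiagram}

/-! ### The diagrams of an IHX relation -/

/-- The six half-edges at the two ends of an inner edge are distinct. -/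
theorem IsInner.nodup {h : Fin D.card} (hh : D.IsInner h) :
    [h, D.rot h, D.rot (D.rot h), D.edge h, D.rot (D.edge h), D.rot (D.rot (D.edge h))].Nodup := by
  obtain ⟨h1, h2, h3⟩ := hh
  rw [sameCycle_rot_iff] at h3
  have a1 := rot_sq_eq_iff h
  have a2 := rot_sq_eq_iff (D.edge h)
  have a3 := D.rot_cube h
  have a4 := D.rot_cube (D.edge h)
  have inj := D.rot.injective
  unfold IsUnivalent at h1 h2
  simp only [List.nodup_cons, List.mem_cons, List.not_mem_nil, or_false, not_or, not_false_eq_true,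
    List.nodup_nil, and_true]
  grind

/-- The identity, as a bijection from the half-edges of `D` to those of `D.diagramH h`. -/
def equivH (D : JacobiDiagram) (h : Fin D.card) : Fin D.card ≃ Fin (D.diagramH h).card :=
  D.reattachEquiv _

/-- The identity, as a bijection from the half-edges of `D` to those of `D.diagramX h`. -/
def equivX (D : JacobiDiagram) (h : Fin D.card) : Fin D.card ≃ Fin (D.diagramX h).card :=
  D.reattachEquiv _

theorem edge_equivH (h x : Fin D.card) :
    (D.diagramH h).edge (D.equivH h x) = D.equivH h (D.edge x) := rfl

theorem edge_equivX (h x : Fin D.card) :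
    (D.diagramX h).edge (D.equivX h x) = D.equivX h (D.edge x) := rfl

section conj

variable {α : Type*} [DecidableEq α] (r : Equiv.Perm α) {h a b h' c d : α}

/-- The rotation of "H", computed at the six half-edges of the two vertices: the vertices
`(h a b)` and `(h' c d)` are replaced by `(h b c)` and `(h' d a)`. -/
theorem conj_swaps_H (hn : [h, a, b, h', c, d].Nodup) (h1 : r h = a) (h2 : r a = b) (h3 : r b = h)
    (h4 : r h' = c) (h5 : r c = d) (h6 : r d = h') (x : α) :
    (Equiv.swap a b * Equiv.swap b c * Equiv.swap c d)
      (r ((Equiv.swap a b * Equiv.swap b c * Equiv.swap c d)⁻¹ x)) =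
      if x = h then b else if x = b then c else if x = c then h else
      if x = h' then d else if x = d then a else if x = a then h' else r x := by
  simp only [List.nodup_cons, List.mem_cons, List.not_mem_nil, or_false, not_or, not_false_eq_true,
    List.nodup_nil, and_true] at hn
  obtain ⟨⟨n1, n2, n3, n4, n5⟩, ⟨n6, n7, n8, n9⟩, ⟨n10, n11, n12⟩, ⟨n13, n14⟩, n15⟩ := hn
  simp only [mul_inv_rev, Equiv.swap_inv, Equiv.Perm.mul_apply]
  by_cases e1 : x = h
  · subst e1; simp [Equiv.swap_apply_def, *]
  by_cases e2 : x = a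
  · subst e2; simp [Equiv.swap_apply_def, *, Ne.symm]
  by_cases e3 : x = b
  · subst e3; simp [Equiv.swap_apply_def, *, Ne.symm]
  by_cases e4 : x = h'
  · subst e4; simp [Equiv.swap_apply_def, *, Ne.symm]
  by_cases e5 : x = c
  · subst e5; simp [Equiv.swap_apply_def, *, Ne.symm]
  by_cases e6 : x = d
  · subst e6; simp [Equiv.swap_apply_def, *, Ne.symm]
  have f1 : r x ≠ a := fun h => e1 (r.injective (h.trans h1.symm))
  have f2 : r x ≠ b := fun h => e2 (r.injective (h.trans h2.symm))
  have f3 : r x ≠ c := fun h => e4 (r.injective (h.trans h4.symm))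
  have f4 : r x ≠ d := fun h => e5 (r.injective (h.trans h5.symm))
  simp [Equiv.swap_apply_def, e1, e2, e3, e4, e5, e6, f1, f2, f3, f4]

/-- The rotation of "X", computed at the six half-edges of the two vertices: the vertices
`(h a b)` and `(h' c d)` are replaced by `(h b d)` and `(h' c a)`. -/
theorem conj_swaps_X (hn : [h, a, b, h', c, d].Nodup) (h1 : r h = a) (h2 : r a = b) (h3 : r b = h)
    (h4 : r h' = c) (h5 : r c = d) (h6 : r d = h') (x : α) :
    (Equiv.swap a b * Equiv.swap b d) (r ((Equiv.swap a b * Equiv.swap b d)⁻¹ x)) =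
      if x = h then b else if x = b then d else if x = d then h else
      if x = h' then c else if x = c then a else if x = a then h' else r x := by
  simp only [List.nodup_cons, List.mem_cons, List.not_mem_nil, or_false, not_or, not_false_eq_true,
    List.nodup_nil, and_true] at hn
  obtain ⟨⟨n1, n2, n3, n4, n5⟩, ⟨n6, n7, n8, n9⟩, ⟨n10, n11, n12⟩, ⟨n13, n14⟩, n15⟩ := hn
  simp only [mul_inv_rev, Equiv.swap_inv, Equiv.Perm.mul_apply]
  by_cases e1 : x = h
  · subst e1; simp [Equiv.swap_apply_def, *]
  by_cases e2 : x = a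
  · subst e2; simp [Equiv.swap_apply_def, *, Ne.symm]
  by_cases e3 : x = b
  · subst e3; simp [Equiv.swap_apply_def, *, Ne.symm]
  by_cases e4 : x = h'
  · subst e4; simp [Equiv.swap_apply_def, *, Ne.symm]
  by_cases e5 : x = c
  · subst e5; simp [Equiv.swap_apply_def, *, Ne.symm]
  by_cases e6 : x = d
  · subst e6; simp [Equiv.swap_apply_def, *, Ne.symm]
  have f1 : r x ≠ a := fun h => e1 (r.injective (h.trans h1.symm))
  have f2 : r x ≠ b := fun h => e2 (r.injective (h.trans h2.symm))
  have f4 : r x ≠ d := fun h => e5 (r.injective (h.trans h5.symm))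
  simp [Equiv.swap_apply_def, e1, e2, e3, e4, e5, e6, f1, f2, f4]

end conj

theorem rot_equivH {h : Fin D.card} (hh : D.IsInner h) (x : Fin D.card) :
    (D.diagramH h).rot (D.equivH h x) = D.equivH h (
      if x = h then D.rot (D.rot h) else
      if x = D.rot (D.rot h) then D.rot (D.edge h) else
      if x = D.rot (D.edge h) then h else
      if x = D.edge h then D.rot (D.rot (D.edge h)) else
      if x = D.rot (D.rot (D.edge h)) then D.rot h else
      if x = D.rot h then D.edge h else D.rot x) := by
  refine (reattach_rot _ x).trans (congrArg (D.equivH h) ?_)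
  exact conj_swaps_H D.rot hh.nodup rfl rfl (D.rot_cube h) rfl rfl (D.rot_cube _) x

theorem rot_equivX {h : Fin D.card} (hh : D.IsInner h) (x : Fin D.card) :
    (D.diagramX h).rot (D.equivX h x) = D.equivX h (
      if x = h then D.rot (D.rot h) else
      if x = D.rot (D.rot h) then D.rot (D.rot (D.edge h)) else
      if x = D.rot (D.rot (D.edge h)) then h else
      if x = D.edge h then D.rot (D.edge h) else
      if x = D.rot (D.edge h) then D.rot h else
      if x = D.rot h then D.edge h else D.rot x) := by
  refine (reattach_rot _ x).trans (congrArg (D.equivX h) ?_)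
  exact conj_swaps_X D.rot hh.nodup rfl rfl (D.rot_cube h) rfl rfl (D.rot_cube _) x

end JacobiDiagram

namespace JacobiDiagram

variable {D D' D'' : JacobiDiagram}
variable {P : Set JacobiDiagram} {site : (D : JacobiDiagram) → Fin D.card → Prop}

/-! ### Classes of diagrams -/

open Classical in
/-- The class of a diagram in the space of diagrams of the class `P`, which is zero by convention
if the diagram is not in `P`. -/
noncomputable def cls (P : Set JacobiDiagram) (site : (D : JacobiDiagram) → Fin D.card → Prop)
    (D : JacobiDiagram) : Space P site :=
  if h : D ∈ P then toSpace P site ⟨D, h⟩ else 0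

theorem toSpace_eq_cls (D : P) : toSpace P site D = cls P site D.1 := by
  rw [cls, dif_pos D.2]

/-- The closure properties of a class of `3`-loop diagrams which are needed for moving legs along
its diagrams. -/
structure IsGood (P : Set JacobiDiagram) (site : (D : JacobiDiagram) → Fin D.card → Prop) :
    Prop where
  graphIso : ∀ {D D' : JacobiDiagram} {φ}, GraphIso D D' φ → D ∈ P → D' ∈ P
  attach : ∀ {D : JacobiDiagram} (x : Fin D.card), D ∈ P → D.attach x ∈ P
  site : ∀ {D : JacobiDiagram} {h : Fin D.card}, D.IsLegSite h → site D h
  isLoop : ∀ {D : JacobiDiagram}, D ∈ P → D.IsLoop 3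

namespace IsGood

variable (hP : IsGood P site)
include hP

theorem mem_iff {φ} (h : GraphIso D D' φ) : D ∈ P ↔ D' ∈ P :=
  ⟨hP.graphIso h, hP.graphIso h.symm⟩

theorem cls_eq_of_iso {φ : Fin D.card ≃ Fin D'.card} (h : ∀ x, φ (D.rot x) = D'.rot (φ x))
    (h' : ∀ x, φ (D.edge x) = D'.edge (φ x)) : cls P site D' = cls P site D := by
  have hm := hP.mem_iff (GraphIso.of_iso h h')
  unfold cls
  by_cases hD : D ∈ P
  · rw [dif_pos hD, dif_pos (hm.1 hD), eq_comm]
    refine (Submodule.Quotient.eq _).2 (Submodule.subset_span ?_)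
    exact Relator.iso ⟨D, hD⟩ ⟨D', hm.1 hD⟩ ⟨φ, h, h'⟩
  · rw [dif_neg hD, dif_neg (fun h => hD (hm.2 h))]

theorem cls_flip {h : Fin D.card} (hh : ¬ D.IsUnivalent h) :
    cls P site (D.flip h) = - cls P site D := by
  have hm := hP.mem_iff (GraphIso.flip D h)
  unfold cls
  by_cases hD : D ∈ P
  · rw [dif_pos hD, dif_pos (hm.1 hD), eq_comm, neg_eq_iff_add_eq_zero]
    refine (Submodule.Quotient.mk_eq_zero _).2 (Submodule.subset_span ?_)
    exact Relator.antisymm ⟨D, hD⟩ ⟨_, hm.1 hD⟩ h hh rfl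
  · rw [dif_neg hD, dif_neg (fun h => hD (hm.2 h)), neg_zero]

omit hP in
theorem cls_ihx {h : Fin D.card} (hh : D.IsInner h) (hs : site D h) (hD : D ∈ P)
    (hH : D.diagramH h ∈ P) (hX : D.diagramX h ∈ P) :
    cls P site D = cls P site (D.diagramH h) - cls P site (D.diagramX h) := by
  rw [cls, cls, cls, dif_pos hD, dif_pos hH, dif_pos hX]
  refine (Submodule.Quotient.eq _).2 (Submodule.subset_span ?_)
  exact Relator.ihx ⟨D, hD⟩ ⟨_, hH⟩ ⟨_, hX⟩ h hh hs rfl rfl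

/-- A bijection reversing the cyclic order at exactly one trivalent vertex changes the sign. -/
theorem cls_eq_neg {φ : Fin D.card ≃ Fin D'.card} (h' : ∀ x, φ (D.edge x) = D'.edge (φ x))
    {h : Fin D.card} (hh : ¬ D.IsUnivalent h) (hr : ∀ x, φ (D.rot x) =
      if D.rot.SameCycle h x then D'.rot (D'.rot (φ x)) else D'.rot (φ x)) :
    cls P site D' = - cls P site D := by
  rw [← hP.cls_flip hh]
  refine hP.cls_eq_of_iso (φ := (D.flipEquiv h).symm.trans φ) ?_ ?_
  · intro x
    obtain ⟨x, rfl⟩ := (D.flipEquiv h).surjective x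
    rw [flip_rot]
    simp only [Equiv.trans_apply, Equiv.symm_apply_apply]
    by_cases hx : D.rot.SameCycle h x
    · have hx' : D.rot.SameCycle h (D.rot x) := by simpa using hx
      rw [if_pos hx, hr, if_pos hx', hr, if_pos hx, rot_cube]
    · rw [if_neg hx, hr, if_neg hx]
  · intro x
    obtain ⟨x, rfl⟩ := (D.flipEquiv h).surjective x
    rw [flip_edge]
    simp [h']

/-- A bijection reversing the cyclic order at exactly two trivalent vertices preserves the
class. -/
theorem cls_eq_of_reverse_two {φ : Fin D.card ≃ Fin D'.card}
    (h' : ∀ x, φ (D.edge x) = D'.edge (φ x)) {h k : Fin D.card} (hh : ¬ D.IsUnivalent h)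
    (hk : ¬ D.IsUnivalent k) (hhk : ¬ D.rot.SameCycle h k) (hr : ∀ x, φ (D.rot x) =
      if D.rot.SameCycle h x ∨ D.rot.SameCycle k x then D'.rot (D'.rot (φ x))
      else D'.rot (φ x)) :
    cls P site D' = cls P site D := by
  have hf := GraphIso.flip D h
  rw [← neg_neg (cls P site D), ← hP.cls_flip hh]
  refine hP.cls_eq_neg (φ := (D.flipEquiv h).symm.trans φ) (h := D.flipEquiv h k) ?_
    (by rwa [hf.isUnivalent]) ?_
  · intro x
    obtain ⟨x, rfl⟩ := (D.flipEquiv h).surjective x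
    rw [flip_edge]
    simp [h']
  · intro x
    obtain ⟨x, rfl⟩ := (D.flipEquiv h).surjective x
    rw [flip_rot]
    simp only [hf.sameCycle, Equiv.trans_apply, Equiv.symm_apply_apply]
    by_cases hx : D.rot.SameCycle h x
    · have hx' : D.rot.SameCycle h (D.rot x) := by simpa using hx
      have hkx : ¬ D.rot.SameCycle k x := fun h1 => hhk (hx.trans h1.symm)
      rw [if_pos hx, if_neg hkx, hr, if_pos (Or.inl hx'), hr, if_pos (Or.inl hx), rot_cube]
    · by_cases hkx : D.rot.SameCycle k x
      · rw [if_neg hx, if_pos hkx, hr, if_pos (Or.inr hkx)]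
      · rw [if_neg hx, if_neg hkx, hr, if_neg (by tauto)]

/-- By the AS relation, diagrams with isomorphic underlying graphs agree up to sign. -/
theorem cls_graphIso {φ} (h : GraphIso D D' φ) :
    cls P site D' = cls P site D ∨ cls P site D' = - cls P site D := by
  classical
  -- flip the vertices at which `φ` reverses the cyclic order, one after the other
  generalize hn : (Finset.univ.filter fun x => φ (D.rot x) ≠ D'.rot (φ x)).card = n
  induction n using Nat.strong_induction_on generalizing D' with
  | _ n ih =>
    by_cases hb : ∀ x, φ (D.rot x) = D'.rot (φ x)
    · exact Or.inl (hP.cls_eq_of_iso hb h.1)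
    · push Not at hb
      obtain ⟨x, hx⟩ := hb
      have hu : ¬ D'.IsUnivalent (φ x) := by
        intro hu
        have hu' : D'.rot (φ x) = φ x := hu
        rcases h.2 x with h' | h'
        · exact hx h'
        · rw [hu', hu'] at h'
          exact hx (h'.trans hu'.symm)
      have hlt : (Finset.univ.filter fun y => (φ.trans (D'.flipEquiv (φ x))) (D.rot y) ≠
          (D'.flip (φ x)).rot ((φ.trans (D'.flipEquiv (φ x))) y)).card < n := by
        rw [← hn]
        refine Finset.card_lt_card ?_
        rw [Finset.ssubset_iff_of_subset]
        · refine ⟨x, by simpa using hx, ?_⟩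
          have := h.2 x
          simp only [Finset.mem_filter, Finset.mem_univ, true_and, Equiv.trans_apply, flip_rot,
            (D'.flipEquiv (φ x)).injective.eq_iff, Equiv.Perm.SameCycle.refl, if_true, ne_eq,
            not_not]
          tauto
        · intro y
          simp only [Finset.mem_filter, Finset.mem_univ, true_and, Equiv.trans_apply, flip_rot, ne_eq,
            (D'.flipEquiv (φ x)).injective.eq_iff, sameCycle_rot_iff]
          have h1 := h.rot_eq x
          have h2 := h.rot_eq y
          have h3 := D.rot_cube
          have h4 := D'.rot_cube
          have h5 := φ.injective
          have h6 := D'.rot.injective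
          grind
      have := ih _ hlt (h.trans (GraphIso.flip D' (φ x))) rfl
      rw [hP.cls_flip hu] at this
      rcases this with h1 | h1
      · right; rw [← h1, neg_neg]
      · left; exact neg_injective h1

/-- A trivalent vertex adjacent to two legs gives zero, as exchanging the legs changes the sign. -/
theorem cls_of_hasFork (h : D.HasFork) : cls P site D = 0 := by
  obtain ⟨x, h1, h2, h3⟩ := h
  have h2' : D.rot (D.edge x) = D.edge x := h2
  have h3' : D.rot (D.edge (D.rot x)) = D.edge (D.rot x) := h3
  have h1' : D.rot x ≠ x := h1
  have key : cls P site D = - cls P site D := by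
    refine hP.cls_eq_neg (φ := Equiv.swap x (D.rot x) * Equiv.swap (D.edge x) (D.edge (D.rot x)))
      (h := x) ?_ h1 ?_
    · intro y
      have e := D.edge_edge
      have e' := D.edge_ne
      have e1 : D.edge x ≠ D.rot x := fun h => h1 (by
        have := h2'; rw [h] at this; exact D.rot.injective this)
      have e2 : D.edge (D.rot x) ≠ x := fun h => h1 (by rw [h] at h3'; exact h3')
      simp only [Equiv.Perm.mul_apply, Equiv.swap_apply_def]
      grind
    · intro y
      have e1 : D.edge x ≠ D.rot x := fun h => h1 (by
        have := h2'; rw [h] at this; exact D.rot.injective this)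
      have e2 : D.edge (D.rot x) ≠ x := fun h => h1 (by rw [h] at h3'; exact h3')
      have e3 := D.rot_cube x
      have e4 := D.rot.injective
      simp only [sameCycle_rot_iff, Equiv.Perm.mul_apply, Equiv.swap_apply_def]
      grind
  have key' : (2 : ℚ) • cls P site D = 0 := by
    rw [two_smul]
    nth_rewrite 2 [key]
    exact add_neg_cancel _
  exact (smul_eq_zero.1 key').resolve_left two_ne_zero

end IsGood

/-! ### The flow of legs -/

/-- A function on the half-edges satisfying the relations that the classes of the oriented edges
satisfy in the first cohomology of the graph: opposite half-edges have opposite values, the sum over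
the half-edges at a trivalent vertex is zero, and legs have the value zero. -/
structure IsFlow {A : Type*} [AddCommGroup A] (D : JacobiDiagram) (f : Fin D.card → A) : Prop where
  edge : ∀ x, f (D.edge x) = - f x
  vertex : ∀ x, ¬ D.IsUnivalent x → f x + f (D.rot x) + f (D.rot (D.rot x)) = 0
  leg : ∀ x, D.IsUnivalent x → f x = 0

/-- A flow does not see a leg, so that it restricts to the diagram without the leg. -/
theorem IsFlow.of_attach {A : Type*} [AddCommGroup A] {x : Fin D.card}
    {f : Fin (D.attach x).card → A} (h : IsFlow (D.attach x) f) :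
    IsFlow D fun y => f (D.old x y) := by
  have h0 : f (D.old x x) = - f (D.new x 0) := by simpa using h.edge (D.new x 0)
  have h1 : f (D.old x (D.edge x)) = - f (D.new x 1) := by simpa using h.edge (D.new x 1)
  have h2 : f (D.new x 2) = - f (D.new x 3) := by simpa using h.edge (D.new x 3)
  have h3 : f (D.new x 3) = 0 := h.leg _ (by simp)
  have h4 : f (D.new x 0) + f (D.new x 1) + f (D.new x 2) = 0 := by
    simpa using h.vertex (D.new x 0) (by simp)
  rw [h2, h3, neg_zero, add_zero] at h4
  have h5 : f (D.old x (D.edge x)) = - f (D.old x x) := by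
    rw [h0, h1, neg_neg, eq_comm, ← sub_eq_zero, sub_neg_eq_add, h4]
  refine ⟨fun y => ?_, fun y hy => ?_, fun y hy => h.leg _ (by simpa using hy)⟩
  · by_cases e1 : y = x
    · rw [e1, h5]
    · by_cases e2 : y = D.edge x
      · rw [e2, edge_edge, h5, neg_neg]
      · rw [← h.edge, attach_edge_old e1 e2]
  · simpa using h.vertex (D.old x y) (by simpa using hy)

/-- The half-edges of `D.attach w` and of `D.attach x`, for two half-edges `w` and `x` at the same
vertex: moving the leg across the vertex, the new edge `{x, 0}` of `D.attach x` becomes the edge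
`{w, 0}` of `D.attach w`. -/
noncomputable def moveEquiv (D : JacobiDiagram) (w x : Fin D.card) :
    Fin (D.attach w).card ≃ Fin (D.attach x).card :=
  (D.attachEquiv w).symm.trans
    (Equiv.trans (Equiv.swap (.inl w) (.inl x) * Equiv.swap (.inl x) (.inr 1)) (D.attachEquiv x))

section move

variable {w x y : Fin D.card} (hw : w ≠ x)

@[simp] theorem moveEquiv_old_left (hw : w ≠ x) :
    D.moveEquiv w x (D.old w w) = D.old x x := by
  simp [moveEquiv, Equiv.swap_apply_def, hw]

@[simp] theorem moveEquiv_old_right : D.moveEquiv w x (D.old w x) = D.new x 1 := by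
  rw [moveEquiv, Equiv.trans_apply, attachEquiv_symm_old, Equiv.trans_apply,
    Equiv.Perm.mul_apply, Equiv.swap_apply_left, Equiv.swap_apply_of_ne_of_ne (by simp) (by simp),
    attachEquiv_inr]

theorem moveEquiv_old (h : y ≠ w) (h' : y ≠ x) :
    D.moveEquiv w x (D.old w y) = D.old x y := by
  simp [moveEquiv, Equiv.swap_apply_def, h, h']

@[simp] theorem moveEquiv_new_zero : D.moveEquiv w x (D.new w 0) = D.new x 0 := by
  simp [moveEquiv, Equiv.swap_apply_def]
@[simp] theorem moveEquiv_new_one : D.moveEquiv w x (D.new w 1) = D.old x w := by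
  simp [moveEquiv, Equiv.swap_apply_def]
@[simp] theorem moveEquiv_new_two : D.moveEquiv w x (D.new w 2) = D.new x 2 := by
  simp [moveEquiv, Equiv.swap_apply_def]
@[simp] theorem moveEquiv_new_three : D.moveEquiv w x (D.new w 3) = D.new x 3 := by
  simp [moveEquiv, Equiv.swap_apply_def]

theorem moveEquiv_edge (hw : w ≠ x) (z) :
    D.moveEquiv w x ((D.attach w).edge z) = (D.attach x).edge (D.moveEquiv w x z) := by
  have e := D.edge_ne w
  have e' := D.edge_ne x
  have ee := D.edge_edge
  induction z using attach_cases with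
  | h y =>
    rw [attach_edge_old_eq_ite]
    by_cases h1 : y = w
    · subst h1; simp [hw]
    · by_cases h2 : y = x
      · subst h2
        by_cases h3 : y = D.edge w
        · subst h3; simp
        · rw [if_neg h1, if_neg h3, moveEquiv_old_right, moveEquiv_old _ e', attach_edge_new_one]
          rwa [Ne, edge_eq_comm]
      · rw [if_neg h1, moveEquiv_old h1 h2]
        by_cases h3 : y = D.edge w
        · subst h3
          have h4 : D.edge w ≠ D.edge x := D.edge.injective.ne hw
          rw [if_pos rfl, moveEquiv_new_one, attach_edge_old h2 h4, edge_edge]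
        · rw [if_neg h3]
          by_cases h4 : y = D.edge x
          · subst h4; simp
          · rw [moveEquiv_old, attach_edge_old h2 h4]
            · rwa [Ne, edge_eq_comm]
            · rwa [Ne, edge_eq_comm]
  | h0 => simp [hw]
  | h1 =>
    rw [attach_edge_new_one, moveEquiv_new_one]
    by_cases h2 : D.edge w = x
    · subst h2
      have := attach_edge_old_edge (D.edge w)
      rw [edge_edge] at this
      simp [this]
    · rw [moveEquiv_old e h2, attach_edge_old hw]
      rintro rfl
      simp at h2
  | h2 => simp
  | h3 => simp

end move

theorem sameCycle_new_zero {x : Fin D.card} {z} : (D.attach x).rot.SameCycle (D.new x 0) z ↔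
    z = D.new x 0 ∨ z = D.new x 1 ∨ z = D.new x 2 := by
  simp [sameCycle_rot_iff]

theorem isInner_new_zero {x : Fin D.card} (hx : ¬ D.IsUnivalent x) :
    (D.attach x).IsInner (D.new x 0) :=
  ⟨by simp, by simpa using hx, by simp [sameCycle_new_zero]⟩

section kirchhoff

variable {x : Fin D.card} (hx : ¬ D.IsUnivalent x)
include hx

/-- The diagram with a leg attached at `rot x` is "H" at the edge between `x` and the vertex of the
leg attached at `x`, up to the cyclic order at the vertex of the leg. -/
theorem moveEquiv_rot_H (z) :
    ((D.moveEquiv (D.rot x) x).trans ((D.attach x).equivH (D.new x 0)))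
      ((D.attach (D.rot x)).rot z) =
    if (D.attach (D.rot x)).rot.SameCycle (D.new (D.rot x) 0) z then
      ((D.attach x).diagramH (D.new x 0)).rot (((D.attach x).diagramH (D.new x 0)).rot
        (((D.moveEquiv (D.rot x) x).trans ((D.attach x).equivH (D.new x 0))) z))
    else ((D.attach x).diagramH (D.new x 0)).rot
        (((D.moveEquiv (D.rot x) x).trans ((D.attach x).equivH (D.new x 0))) z) := by
  have hi := isInner_new_zero hx
  have n1 : D.rot x ≠ x := hx
  have n2 : D.rot (D.rot x) ≠ x := mt (rot_sq_eq_iff x).1 hx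
  have n3 : D.rot (D.rot x) ≠ D.rot x := mt (rot_sq_eq_rot_iff x).1 hx
  have n4 := D.rot_cube x
  simp only [sameCycle_new_zero, Equiv.trans_apply]
  induction z using attach_cases with
  | h y =>
    by_cases h1 : y = x
    · subst h1
      simp [rot_equivH hi, n1, n2, n3, n1.symm, n2.symm, n3.symm]
    · by_cases h2 : y = D.rot x
      · subst h2
        simp [rot_equivH hi, n1, n2, n3, n1.symm, n2.symm, n3.symm, moveEquiv_old n3 n2]
      · by_cases h3 : y = D.rot (D.rot x)
        · subst h3
          simp [rot_equivH hi, n1, n2, n3, n1.symm, n2.symm, n3.symm, moveEquiv_old n3 n2]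
        · have m1 : D.rot y ≠ x := fun h => h3 (D.rot.injective (h.trans n4.symm))
          have m2 : D.rot y ≠ D.rot x := D.rot.injective.ne h1
          simp [rot_equivH hi, h1, h2, h3, moveEquiv_old m2 m1, moveEquiv_old h2 h1]
  | h0 => simp [rot_equivH hi, n1, n2, n3, n1.symm, n2.symm, n3.symm]
  | h1 => simp [rot_equivH hi, n1, n2, n3, n1.symm, n2.symm, n3.symm]
  | h2 => simp [rot_equivH hi, n1, n2, n3, n1.symm, n2.symm, n3.symm]
  | h3 => simp [rot_equivH hi]

/-- The diagram with a leg attached at `rot (rot x)` is "X" at the edge between `x` and the vertex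
of the leg attached at `x`, up to the cyclic orders at the two ends of this edge. -/
theorem moveEquiv_rot_X (z) :
    ((D.moveEquiv (D.rot (D.rot x)) x).trans ((D.attach x).equivX (D.new x 0)))
      ((D.attach (D.rot (D.rot x))).rot z) =
    if (D.attach (D.rot (D.rot x))).rot.SameCycle (D.new (D.rot (D.rot x)) 0) z ∨
      (D.attach (D.rot (D.rot x))).rot.SameCycle (D.old (D.rot (D.rot x)) x) z then
      ((D.attach x).diagramX (D.new x 0)).rot (((D.attach x).diagramX (D.new x 0)).rot
        (((D.moveEquiv (D.rot (D.rot x)) x).trans ((D.attach x).equivX (D.new x 0))) z))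
    else ((D.attach x).diagramX (D.new x 0)).rot
        (((D.moveEquiv (D.rot (D.rot x)) x).trans ((D.attach x).equivX (D.new x 0))) z) := by
  have hi := isInner_new_zero hx
  have n1 : D.rot x ≠ x := hx
  have n2 : D.rot (D.rot x) ≠ x := mt (rot_sq_eq_iff x).1 hx
  have n3 : D.rot (D.rot x) ≠ D.rot x := mt (rot_sq_eq_rot_iff x).1 hx
  have n4 := D.rot_cube x
  simp only [sameCycle_new_zero, sameCycle_rot_iff (x := D.old _ x), Equiv.trans_apply]
  induction z using attach_cases with
  | h y =>
    by_cases h1 : y = x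
    · subst h1
      simp [rot_equivX hi, n1, n2, n3, n1.symm, n2.symm, n3.symm, moveEquiv_old n3.symm n1]
    · by_cases h2 : y = D.rot x
      · subst h2
        simp [rot_equivX hi, n1, n2, n3, n1.symm, n2.symm, n3.symm, moveEquiv_old n3.symm n1]
      · by_cases h3 : y = D.rot (D.rot x)
        · subst h3
          simp [rot_equivX hi, n1, n2, n3, n1.symm, n2.symm, n3.symm]
        · have m1 : D.rot y ≠ x := fun h => h3 (D.rot.injective (h.trans n4.symm))
          have m2 : D.rot y ≠ D.rot (D.rot x) := D.rot.injective.ne h2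
          simp [rot_equivX hi, h1, h2, h3, moveEquiv_old m2 m1, moveEquiv_old h3 h1]
  | h0 => simp [rot_equivX hi, n1, n2, n3, n1.symm, n2.symm, n3.symm]
  | h1 => simp [rot_equivX hi, n1, n2, n3, n1.symm, n2.symm, n3.symm]
  | h2 => simp [rot_equivX hi, n1, n2, n3, n1.symm, n2.symm, n3.symm]
  | h3 => simp [rot_equivX hi]

end kirchhoff

namespace IsGood

variable (hP : IsGood P site)
include hP

/-- A leg attached from the other side differs by the cyclic order at its vertex. -/
theorem cls_attach_edge (x : Fin D.card) :
    cls P site (D.attach (D.edge x)) = - cls P site (D.attach x) := by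
  refine hP.cls_eq_neg (attachEdgeEquiv_edge x) (h := D.new x 0) (by simp) fun z => ?_
  have h2 : Equiv.swap (0 : Fin 4) 1 2 = 2 := by decide
  have h3 : Equiv.swap (0 : Fin 4) 1 3 = 3 := by decide
  simp only [sameCycle_new_zero]
  induction z using attach_cases <;> simp [h2, h3]

/-- A leg attached to a leg creates a vertex adjacent to two legs. -/
theorem cls_attach_of_isUnivalent {x : Fin D.card} (hx : D.IsUnivalent x) :
    cls P site (D.attach x) = 0 :=
  hP.cls_of_hasFork ⟨D.new x 2, by simp, by simp, by simpa using hx⟩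

/-- The sum over the three ways of attaching a leg next to a trivalent vertex vanishes, which is an
IHX relation on the legs. -/
theorem cls_attach_vertex (hD : D ∈ P) {x : Fin D.card} (hx : ¬ D.IsUnivalent x) :
    cls P site (D.attach x) + cls P site (D.attach (D.rot x)) +
      cls P site (D.attach (D.rot (D.rot x))) = 0 := by
  have n1 : D.rot x ≠ x := hx
  have n2 : D.rot (D.rot x) ≠ x := mt (rot_sq_eq_iff x).1 hx
  have n3 : D.rot (D.rot x) ≠ D.rot x := mt (rot_sq_eq_rot_iff x).1 hx
  have eH : ∀ z, ((D.moveEquiv (D.rot x) x).trans ((D.attach x).equivH (D.new x 0)))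
      ((D.attach (D.rot x)).edge z) = ((D.attach x).diagramH (D.new x 0)).edge
        (((D.moveEquiv (D.rot x) x).trans ((D.attach x).equivH (D.new x 0))) z) := fun z => by
    rw [Equiv.trans_apply, moveEquiv_edge n1, Equiv.trans_apply, edge_equivH]
  have eX : ∀ z, ((D.moveEquiv (D.rot (D.rot x)) x).trans ((D.attach x).equivX (D.new x 0)))
      ((D.attach (D.rot (D.rot x))).edge z) = ((D.attach x).diagramX (D.new x 0)).edge
        (((D.moveEquiv (D.rot (D.rot x)) x).trans ((D.attach x).equivX (D.new x 0))) z) :=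
    fun z => by rw [Equiv.trans_apply, moveEquiv_edge n2, Equiv.trans_apply, edge_equivX]
  have rH := moveEquiv_rot_H hx
  have rX := moveEquiv_rot_X hx
  have gH := hP.cls_eq_neg eH (h := D.new (D.rot x) 0) (by simp) rH
  have gX := hP.cls_eq_of_reverse_two eX (h := D.new _ 0) (k := D.old _ x) (by simp)
    (by simpa using hx) (by simp [sameCycle_new_zero]) rX
  have mH : (D.attach x).diagramH (D.new x 0) ∈ P := hP.graphIso ⟨eH, fun z => by
    rw [rH]; split_ifs <;> simp⟩ (hP.attach (D.rot x) hD)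
  have mX : (D.attach x).diagramX (D.new x 0) ∈ P := hP.graphIso ⟨eX, fun z => by
    rw [rX]; split_ifs <;> simp⟩ (hP.attach (D.rot (D.rot x)) hD)
  have hs : site (D.attach x) (D.new x 0) := hP.site (Or.inr (Or.inl (by simp)))
  rw [cls_ihx (isInner_new_zero hx) hs (hP.attach x hD) mH mX, gH, gX]
  abel

/-- The classes of the diagrams obtained by attaching one leg to a fixed diagram form a flow: this
is what the AS and IHX relations on the legs say about the position of a leg. -/
theorem isFlow_cls_attach (hD : D ∈ P) : IsFlow D fun x => cls P site (D.attach x) where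
  edge x := hP.cls_attach_edge x
  vertex _ hx := hP.cls_attach_vertex hD hx
  leg _ hx := hP.cls_attach_of_isUnivalent hx

end IsGood

end JacobiDiagram

namespace JacobiDiagram

variable {D D' D'' B B' : JacobiDiagram}
variable {P : Set JacobiDiagram} {site : (D : JacobiDiagram) → Fin D.card → Prop}

/-! ### Attaching several legs -/

/-- An isomorphism of diagrams, compatible with the orientations. -/
def IsIso (D D' : JacobiDiagram) (φ : Fin D.card ≃ Fin D'.card) : Prop :=
  (∀ x, φ (D.rot x) = D'.rot (φ x)) ∧ ∀ x, φ (D.edge x) = D'.edge (φ x)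

namespace IsIso

variable {φ : Fin D.card ≃ Fin D'.card} {ψ : Fin D'.card ≃ Fin D''.card}

theorem graphIso (h : IsIso D D' φ) : GraphIso D D' φ := .of_iso h.1 h.2

theorem trans (h : IsIso D D' φ) (h' : IsIso D' D'' ψ) : IsIso D D'' (φ.trans ψ) :=
  ⟨fun x => by simp [h.1, h'.1], fun x => by simp [h.2, h'.2]⟩

theorem attach (h : IsIso D D' φ) (x) :
    IsIso (D.attach x) (D'.attach (φ x)) (attachCongr φ x) :=
  ⟨(attachCongr_rot_iff x).2 h.1, attachCongr_edge h.2 x⟩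

theorem exists_attach (h : IsIso D D' φ) {x x'} (hx : φ x = x') :
    ∃ χ, IsIso (D.attach x) (D'.attach x') χ ∧ ∀ y, χ (D.old x y) = D'.old x' (φ y) := by
  subst hx
  exact ⟨_, h.attach x, attachCongr_old φ x⟩

end IsIso

theorem GraphIso.exists_attach {φ : Fin D.card ≃ Fin D'.card} (h : GraphIso D D' φ) {x x'}
    (hx : φ x = x') :
    ∃ χ, GraphIso (D.attach x) (D'.attach x') χ ∧ ∀ y, χ (D.old x y) = D'.old x' (φ y) := by
  subst hx
  exact ⟨_, h.attach x, attachCongr_old φ x⟩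

/-- Attach a leg to the edge of every half-edge in a list of half-edges of `B`, beginning with the
end of the list. The result comes with the embedding of the half-edges of `B`. -/
noncomputable def attachList (B : JacobiDiagram) :
    List (Fin B.card) → Σ D : JacobiDiagram, (Fin B.card → Fin D.card)
  | [] => ⟨B, id⟩
  | b :: L => ⟨(B.attachList L).1.attach ((B.attachList L).2 b),
      fun y => (B.attachList L).1.old _ ((B.attachList L).2 y)⟩

/-- The diagram obtained from `B` by attaching legs at the half-edges in a list. -/
noncomputable abbrev withLegs (B : JacobiDiagram) (L : List (Fin B.card)) : JacobiDiagram :=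
  (B.attachList L).1

/-- The half-edges of `B` as half-edges of `B.withLegs L`. -/
noncomputable abbrev base (B : JacobiDiagram) (L : List (Fin B.card)) (y : Fin B.card) :
    Fin (B.withLegs L).card :=
  (B.attachList L).2 y

theorem withLegs_cons (b : Fin B.card) (L : List (Fin B.card)) :
    B.withLegs (b :: L) = (B.withLegs L).attach (B.base L b) := rfl

theorem base_injective (L : List (Fin B.card)) : Function.Injective (B.base L) := by
  induction L with
  | nil => exact Function.injective_id
  | cons b L ih => exact (old_injective _).comp ih

@[simp] theorem rot_base (L : List (Fin B.card)) (y) :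
    (B.withLegs L).rot (B.base L y) = B.base L (B.rot y) := by
  induction L with
  | nil => rfl
  | cons b L ih => exact (attach_rot_old _ _).trans (congrArg _ ih)

/-- The edges without legs remain edges. -/
theorem edge_base {L : List (Fin B.card)} {y : Fin B.card} (h : y ∉ L) (h' : B.edge y ∉ L) :
    (B.withLegs L).edge (B.base L y) = B.base L (B.edge y) := by
  induction L with
  | nil => rfl
  | cons b L ih =>
    simp only [List.mem_cons, not_or] at h h'
    have ih' := ih h.2 h'.2
    refine (attach_edge_old ((base_injective L).ne h.1) fun e => ?_).trans (congrArg _ ih')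
    rw [e, edge_edge] at ih'
    exact h'.1 (base_injective L ih').symm

@[simp] theorem isUnivalent_base (L : List (Fin B.card)) (y) :
    (B.withLegs L).IsUnivalent (B.base L y) ↔ B.IsUnivalent y := by
  rw [IsUnivalent, rot_base, (base_injective L).eq_iff, IsUnivalent]

theorem numLegs_withLegs (L : List (Fin B.card)) :
    (B.withLegs L).numLegs = B.numLegs + L.length := by
  induction L with
  | nil => rfl
  | cons b L ih => rw [withLegs_cons, numLegs_attach, ih, List.length_cons, add_assoc]

theorem IsFlow.base {A : Type*} [AddCommGroup A] (L : List (Fin B.card))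
    {f : Fin (B.withLegs L).card → A} (h : IsFlow _ f) : IsFlow B fun y => f (B.base L y) := by
  induction L with
  | nil => exact h
  | cons b L ih => exact ih h.of_attach

theorem IsGood.withLegs_mem (hP : IsGood P site) (hB : B ∈ P) (L : List (Fin B.card)) :
    B.withLegs L ∈ P := by
  induction L with
  | nil => exact hB
  | cons b L ih => exact hP.attach _ ih

theorem IsIso.withLegs {ψ : Fin B.card ≃ Fin B'.card} (h : IsIso B B' ψ)
    (L : List (Fin B.card)) : ∃ φ, IsIso (B.withLegs L) (B'.withLegs (L.map ψ)) φ ∧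
      ∀ y, φ (B.base L y) = B'.base (L.map ψ) (ψ y) := by
  induction L with
  | nil => exact ⟨ψ, h, fun y => rfl⟩
  | cons b L ih =>
    obtain ⟨φ, h1, h2⟩ := ih
    obtain ⟨χ, h3, h4⟩ := h1.exists_attach (h2 b)
    exact ⟨χ, h3, fun y => (h4 _).trans (congrArg _ (h2 y))⟩

theorem GraphIso.withLegs {ψ : Fin B.card ≃ Fin B'.card} (h : GraphIso B B' ψ)
    (L : List (Fin B.card)) : ∃ φ, GraphIso (B.withLegs L) (B'.withLegs (L.map ψ)) φ ∧
      ∀ y, φ (B.base L y) = B'.base (L.map ψ) (ψ y) := by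
  induction L with
  | nil => exact ⟨ψ, h, fun y => rfl⟩
  | cons b L ih =>
    obtain ⟨φ, h1, h2⟩ := ih
    obtain ⟨χ, h3, h4⟩ := h1.exists_attach (h2 b)
    exact ⟨χ, h3, fun y => (h4 _).trans (congrArg _ (h2 y))⟩

/-- The order in which the legs are attached does not matter. -/
theorem exists_isIso_of_perm {L L' : List (Fin B.card)} (h : L.Perm L') :
    ∃ φ, IsIso (B.withLegs L) (B.withLegs L') φ ∧ ∀ y, φ (B.base L y) = B.base L' y := by
  induction h with
  | nil => exact ⟨Equiv.refl _, ⟨fun _ => rfl, fun _ => rfl⟩, fun _ => rfl⟩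
  | cons b _ ih =>
    obtain ⟨φ, h1, h2⟩ := ih
    obtain ⟨χ, h3, h4⟩ := h1.exists_attach (h2 b)
    exact ⟨χ, h3, fun y => (h4 _).trans (congrArg _ (h2 y))⟩
  | swap a b L =>
    by_cases hab : b = a
    · subst hab
      exact ⟨Equiv.refl _, ⟨fun _ => rfl, fun _ => rfl⟩, fun _ => rfl⟩
    · exact ⟨(B.withLegs L).attachCommEquiv (B.base L a) (B.base L b),
        ⟨attachCommEquiv_rot _ _, attachCommEquiv_edge ((base_injective L).ne (Ne.symm hab))⟩,
        fun y => attachCommEquiv_old_old _ _ _⟩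
  | trans _ _ ih ih' =>
    obtain ⟨φ, h1, h2⟩ := ih
    obtain ⟨φ', h1', h2'⟩ := ih'
    exact ⟨φ.trans φ', h1.trans h1', fun y => by rw [Equiv.trans_apply, h2, h2']⟩

theorem IsGood.cls_withLegs_perm (hP : IsGood P site) {L L' : List (Fin B.card)}
    (h : L.Perm L') : cls P site (B.withLegs L) = cls P site (B.withLegs L') := by
  obtain ⟨φ, h1, -⟩ := exists_isIso_of_perm h
  exact (hP.cls_eq_of_iso h1.1 h1.2).symm

/-! ### Redistributing half-edges before and after attaching legs -/

/-- Extend a permutation of the half-edges by the identity on the new half-edges. -/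
noncomputable def liftPerm (D : JacobiDiagram) (x : Fin D.card) :
    Equiv.Perm (Fin D.card) →* Equiv.Perm (Fin (D.attach x).card) :=
  (D.attachEquiv x).permCongrHom.toMonoidHom.comp
    ((Equiv.Perm.sumCongrHom _ _).comp (MonoidHom.inl _ _))

@[simp] theorem liftPerm_old (x y : Fin D.card) (τ) :
    D.liftPerm x τ (D.old x y) = D.old x (τ y) := by
  simp [liftPerm, Equiv.permCongrHom]

@[simp] theorem liftPerm_new (x : Fin D.card) (k) (τ) :
    D.liftPerm x τ (D.new x k) = D.new x k := by
  simp [liftPerm, Equiv.permCongrHom]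

theorem liftPerm_swap (x a b : Fin D.card) :
    D.liftPerm x (Equiv.swap a b) = Equiv.swap (D.old x a) (D.old x b) := by
  ext1 z
  induction z using attach_cases with
  | h y =>
    rw [liftPerm_old, Equiv.swap_apply_def, Equiv.swap_apply_def]
    simp only [old_inj]
    split_ifs <;> rfl
  | _ => rw [liftPerm_new, Equiv.swap_apply_of_ne_of_ne] <;> simp

theorem isIso_reattach_attach (x : Fin D.card) (τ : Equiv.Perm (Fin D.card)) :
    IsIso ((D.attach x).reattach (D.liftPerm x τ)) ((D.reattach τ).attach (D.reattachEquiv τ x))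
      (((D.attach x).reattachEquiv (D.liftPerm x τ)).symm.trans
        (attachCongr (D.reattachEquiv τ) x)) := by
  constructor
  · intro z
    obtain ⟨z, rfl⟩ := ((D.attach x).reattachEquiv (D.liftPerm x τ)).surjective z
    rw [reattach_rot, ← map_inv]
    simp only [Equiv.trans_apply, Equiv.symm_apply_apply]
    induction z using attach_cases with
    | h y => simp [reattach_rot, -Equiv.Perm.coe_inv, -map_inv]
    | _ => simp [-Equiv.Perm.coe_inv, -map_inv]
  · intro z
    obtain ⟨z, rfl⟩ := ((D.attach x).reattachEquiv (D.liftPerm x τ)).surjective z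
    rw [reattach_edge]
    simp only [Equiv.trans_apply, Equiv.symm_apply_apply]
    exact attachCongr_edge (fun y => (reattach_edge τ y).symm) x z

/-- Redistributing half-edges of `B` commutes with attaching legs. -/
theorem exists_perm_hom (B : JacobiDiagram) (L : List (Fin B.card)) :
    ∃ θ : Equiv.Perm (Fin B.card) →* Equiv.Perm (Fin (B.withLegs L).card),
      (∀ a b, θ (Equiv.swap a b) = Equiv.swap (B.base L a) (B.base L b)) ∧
      ∀ τ, ∃ φ, IsIso ((B.withLegs L).reattach (θ τ))
        ((B.reattach τ).withLegs (L.map (B.reattachEquiv τ))) φ ∧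
        ∀ y, φ ((B.withLegs L).reattachEquiv (θ τ) (B.base L y)) =
          (B.reattach τ).base (L.map (B.reattachEquiv τ)) (B.reattachEquiv τ y) := by
  induction L with
  | nil =>
    refine ⟨MonoidHom.id _, fun a b => rfl, fun τ => ?_⟩
    exact ⟨Equiv.refl _, ⟨fun _ => rfl, fun _ => rfl⟩, fun _ => rfl⟩
  | cons b L ih =>
    obtain ⟨θ, h1, h2⟩ := ih
    refine ⟨((B.withLegs L).liftPerm (B.base L b)).comp θ, fun a c => ?_, fun τ => ?_⟩
    · exact (congrArg _ (h1 a c)).trans (liftPerm_swap _ _ _)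
    · obtain ⟨φ, h3, h4⟩ := h2 τ
      have h5 := isIso_reattach_attach (B.base L b) (θ τ)
      obtain ⟨χ, h6, h7⟩ := h3.exists_attach (h4 b)
      refine ⟨_, h5.trans h6, fun y => Eq.trans ?_ ((h7 _).trans (congrArg _ (h4 y)))⟩
      exact congrArg χ (attachCongr_old _ _ _)

/-! ### Monomials of legs -/

/-- The linear map sending a monomial in the half-edges of `B` to the class of `B` with legs
attached accordingly. -/
noncomputable def legMap (P : Set JacobiDiagram) (site : (D : JacobiDiagram) → Fin D.card → Prop)
    (B : JacobiDiagram) : MvPolynomial (Fin B.card) ℚ →ₗ[ℚ] Space P site :=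
  (MvPolynomial.basisMonomials (Fin B.card) ℚ).constr ℚ
    fun m => cls P site (B.withLegs (Finsupp.toMultiset m).toList)

theorem prod_map_X {σ : Type*} [DecidableEq σ] (L : List σ) :
    (L.map (MvPolynomial.X (R := ℚ))).prod =
      MvPolynomial.monomial (Multiset.toFinsupp (L : Multiset σ)) 1 := by
  induction L with
  | nil => simp
  | cons b L ih =>
    rw [List.map_cons, List.prod_cons, ih, ← Multiset.cons_coe, ← Multiset.singleton_add, map_add,
      Multiset.toFinsupp_singleton, MvPolynomial.X, MvPolynomial.monomial_mul, one_mul]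

theorem linearMap_ext_prod_X {σ A : Type*} [AddCommGroup A] [Module ℚ A]
    {f g : MvPolynomial σ ℚ →ₗ[ℚ] A}
    (h : ∀ L : List σ, f (L.map MvPolynomial.X).prod = g (L.map MvPolynomial.X).prod) : f = g := by
  classical
  refine (MvPolynomial.basisMonomials σ ℚ).ext fun m => ?_
  have := h (Finsupp.toMultiset m).toList
  rw [prod_map_X] at this
  simpa using this

theorem legMap_prod (hP : IsGood P site) (L : List (Fin B.card)) :
    legMap P site B (L.map MvPolynomial.X).prod = cls P site (B.withLegs L) := by
  rw [prod_map_X]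
  refine ((MvPolynomial.basisMonomials _ ℚ).constr_basis ℚ _ _).trans ?_
  refine hP.cls_withLegs_perm ?_
  rw [← Multiset.coe_eq_coe, Multiset.coe_toList]
  simp

/-- The polynomials all of whose multiples give zero: the largest ideal in the kernel of
`legMap`. -/
noncomputable def legIdeal (P : Set JacobiDiagram) (site : (D : JacobiDiagram) → Fin D.card → Prop)
    (B : JacobiDiagram) : Ideal (MvPolynomial (Fin B.card) ℚ) where
  carrier := {p | ∀ q, legMap P site B (q * p) = 0}
  add_mem' h h' q := by rw [mul_add, map_add, h, h', add_zero]
  zero_mem' q := by simp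
  smul_mem' r p h q := by rw [smul_eq_mul, ← mul_assoc, h]

theorem legMap_eq_of_sub_mem {p q : MvPolynomial (Fin B.card) ℚ} (h : p - q ∈ legIdeal P site B) :
    legMap P site B p = legMap P site B q := by
  have := h 1
  rwa [one_mul, map_sub, sub_eq_zero] at this

theorem mem_legIdeal_of_prod {p : MvPolynomial (Fin B.card) ℚ}
    (h : ∀ L : List (Fin B.card), legMap P site B ((L.map MvPolynomial.X).prod * p) = 0) :
    p ∈ legIdeal P site B := by
  intro q
  have : (legMap P site B).comp (LinearMap.mulRight ℚ p) = 0 :=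
    linearMap_ext_prod_X fun L => by simpa using h L
  simpa using LinearMap.congr_fun this q

open MvPolynomial in
/-- The half-edges of `B`, as variables modulo `legIdeal`, form a flow. -/
theorem isFlow_mk_X (hP : IsGood P site) (hB : B ∈ P) :
    IsFlow B fun b => Ideal.Quotient.mk (legIdeal P site B) (X b) := by
  have key : ∀ (L : List (Fin B.card)) (b : Fin B.card),
      legMap P site B ((L.map X).prod * X b) =
        cls P site ((B.withLegs L).attach (B.base L b)) := fun L b => by
    rw [← withLegs_cons, ← legMap_prod hP, List.map_cons, List.prod_cons, mul_comm]
  have hf := fun L => (hP.isFlow_cls_attach (hP.withLegs_mem hB L)).base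
  refine ⟨fun b => ?_, fun b hb => ?_, fun b hb => ?_⟩
  · rw [← map_neg, Ideal.Quotient.eq, sub_neg_eq_add]
    refine mem_legIdeal_of_prod fun L => ?_
    rw [mul_add, map_add, key, key, (hf L).edge, neg_add_cancel]
  · rw [← map_add, ← map_add, Ideal.Quotient.eq_zero_iff_mem]
    refine mem_legIdeal_of_prod fun L => ?_
    rw [mul_add, mul_add, map_add, map_add, key, key, key, (hf L).vertex _ hb]
  · rw [Ideal.Quotient.eq_zero_iff_mem]
    refine mem_legIdeal_of_prod fun L => ?_
    rw [key, (hf L).leg _ hb]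

theorem legMap_rename (hP : IsGood P site) {ψ : Fin B.card ≃ Fin B'.card} (h : IsIso B B' ψ) (p) :
    legMap P site B' (MvPolynomial.rename ψ p) = legMap P site B p := by
  have : (legMap P site B').comp (MvPolynomial.rename ψ).toLinearMap = legMap P site B := by
    refine linearMap_ext_prod_X fun L => ?_
    obtain ⟨φ, h1, -⟩ := h.withLegs L
    rw [legMap_prod hP, ← hP.cls_eq_of_iso h1.1 h1.2, ← legMap_prod hP]
    simp [map_list_prod, Function.comp_def]
  exact LinearMap.congr_fun this p

/-- Reversing a vertex of `B` changes the sign, wherever the legs are attached. -/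
theorem legMap_flip (hP : IsGood P site) {h : Fin B.card} (hh : ¬ B.IsUnivalent h) (p) :
    legMap P site (B.flip h) (MvPolynomial.rename (B.flipEquiv h) p) = - legMap P site B p := by
  have : (legMap P site (B.flip h)).comp (MvPolynomial.rename (B.flipEquiv h)).toLinearMap =
      - legMap P site B := by
    refine linearMap_ext_prod_X fun L => ?_
    obtain ⟨θ, h1, h2⟩ := exists_perm_hom B L
    obtain ⟨φ, h3, -⟩ := h2 (Equiv.swap (B.rot h) (B.rot (B.rot h)))
    have h4 := hP.cls_eq_of_iso h3.1 h3.2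
    have h5 := hP.cls_flip (h := B.base L h) (by simpa using hh)
    rw [h1, ← rot_base, ← rot_base, ← rot_base] at h4
    rw [LinearMap.neg_apply, legMap_prod hP, ← h5, LinearMap.comp_apply]
    refine Eq.trans ?_ h4
    refine Eq.trans ?_ (legMap_prod hP _)
    congr 1
    simp only [AlgHom.toLinearMap_apply, map_list_prod, List.map_map]
    congr 1
    refine List.map_congr_left fun b _ => ?_
    exact MvPolynomial.rename_X _ _
  exact LinearMap.congr_fun this p

end JacobiDiagram

namespace JacobiDiagram

variable {D D' D'' B B' : JacobiDiagram}

/-! ### The IHX relation for three-loop diagrams with legs -/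

theorem isUnivalent_reattach (τ : Equiv.Perm (Fin D.card)) (x) :
    (D.reattach τ).IsUnivalent (D.reattachEquiv τ (τ x)) ↔ D.IsUnivalent x := by
  rw [IsUnivalent, reattach_rot, (D.reattachEquiv τ).injective.eq_iff, Equiv.Perm.inv_def,
    Equiv.symm_apply_apply, τ.injective.eq_iff, IsUnivalent]

theorem numLegs_reattach (τ : Equiv.Perm (Fin D.card)) : (D.reattach τ).numLegs = D.numLegs :=
  (Nat.card_congr ((τ.trans (D.reattachEquiv τ)).subtypeEquiv
    fun x => (isUnivalent_reattach τ x).symm)).symm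

/-- The rotation at the two new vertices of "H". -/
theorem rot_equivH_vertices {h : Fin D.card} (hh : D.IsInner h) :
    (D.diagramH h).rot (D.equivH h h) = D.equivH h (D.rot (D.rot h)) ∧
    (D.diagramH h).rot (D.equivH h (D.rot (D.rot h))) = D.equivH h (D.rot (D.edge h)) ∧
    (D.diagramH h).rot (D.equivH h (D.rot (D.edge h))) = D.equivH h h ∧
    (D.diagramH h).rot (D.equivH h (D.edge h)) = D.equivH h (D.rot (D.rot (D.edge h))) ∧
    (D.diagramH h).rot (D.equivH h (D.rot (D.rot (D.edge h)))) = D.equivH h (D.rot h) ∧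
    (D.diagramH h).rot (D.equivH h (D.rot h)) = D.equivH h (D.edge h) := by
  have hn := hh.nodup
  simp only [List.nodup_cons, List.mem_cons, List.not_mem_nil, or_false, not_or, not_false_eq_true,
    List.nodup_nil, and_true, ← ne_eq] at hn
  obtain ⟨⟨n1, n2, n3, n4, n5⟩, ⟨n6, n7, n8, n9⟩, ⟨n10, n11, n12⟩, ⟨n13, n14⟩, n15⟩ := hn
  simp only [rot_equivH hh]
  simp [n1.symm, n2.symm, n3.symm, n4.symm, n5.symm, n6, n7, n8, n9, n10.symm, n11.symm, n12.symm,
    n13, n13.symm, n14, n14.symm, n15, n15.symm]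

theorem rot_equivH_of_notMem {h x : Fin D.card} (hh : D.IsInner h) (h1 : ¬ D.rot.SameCycle h x)
    (h2 : ¬ D.rot.SameCycle (D.edge h) x) :
    (D.diagramH h).rot (D.equivH h x) = D.equivH h (D.rot x) := by
  rw [sameCycle_rot_iff] at h1 h2
  rw [rot_equivH hh]
  simp only [not_or] at h1 h2
  simp only [h1, h2, if_false]

theorem isConnected_diagramH {h : Fin D.card} (hh : D.IsInner h) (hD : D.IsConnected) :
    (D.diagramH h).IsConnected := by
  rw [isConnected_iff] at *
  refine ⟨hD.1, fun p hr he x y => ?_⟩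
  obtain ⟨r1, r2, r3, r4, r5, r6⟩ := rot_equivH_vertices hh
  have a1 := hr (D.equivH h h)
  have a2 := hr (D.equivH h (D.rot (D.rot h)))
  have a3 := hr (D.equivH h (D.rot (D.edge h)))
  have a4 := hr (D.equivH h (D.edge h))
  have a5 := hr (D.equivH h (D.rot (D.rot (D.edge h))))
  have a6 := hr (D.equivH h (D.rot h))
  rw [r1] at a1; rw [r2] at a2; rw [r3] at a3; rw [r4] at a4; rw [r5] at a5; rw [r6] at a6
  clear r1 r2 r3 r4 r5 r6
  have a7 : p (D.equivH h h) → p (D.equivH h (D.edge h)) := he _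
  have a8 : p (D.equivH h (D.edge h)) → p (D.equivH h h) := fun h' => by
    simpa [edge_equivH] using he _ h'
  have k1 : ∀ z, D.rot.SameCycle h z → (p (D.equivH h z) ↔ p (D.equivH h h)) := by
    intro z hz
    rcases sameCycle_rot_iff.1 hz with rfl | rfl | rfl <;> tauto
  have k2 : ∀ z, D.rot.SameCycle (D.edge h) z → (p (D.equivH h z) ↔ p (D.equivH h h)) := by
    intro z hz
    rcases sameCycle_rot_iff.1 hz with rfl | rfl | rfl <;> tauto
  refine hD.2 (fun z => p (D.equivH h z)) (fun z hz => ?_) (fun z hz => he _ hz) x y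
  by_cases e1 : D.rot.SameCycle h z
  · rw [k1 _ (by simpa using e1)]
    exact (k1 _ e1).1 hz
  by_cases e2 : D.rot.SameCycle (D.edge h) z
  · rw [k2 _ (by simpa using e2)]
    exact (k2 _ e2).1 hz
  · exact rot_equivH_of_notMem hh e1 e2 ▸ hr _ hz

/-- The rotation at the two new vertices of "X". -/
theorem rot_equivX_vertices {h : Fin D.card} (hh : D.IsInner h) :
    (D.diagramX h).rot (D.equivX h h) = D.equivX h (D.rot (D.rot h)) ∧
    (D.diagramX h).rot (D.equivX h (D.rot (D.rot h))) = D.equivX h (D.rot (D.rot (D.edge h))) ∧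
    (D.diagramX h).rot (D.equivX h (D.rot (D.rot (D.edge h)))) = D.equivX h h ∧
    (D.diagramX h).rot (D.equivX h (D.edge h)) = D.equivX h (D.rot (D.edge h)) ∧
    (D.diagramX h).rot (D.equivX h (D.rot (D.edge h))) = D.equivX h (D.rot h) ∧
    (D.diagramX h).rot (D.equivX h (D.rot h)) = D.equivX h (D.edge h) := by
  have hn := hh.nodup
  simp only [List.nodup_cons, List.mem_cons, List.not_mem_nil, or_false, not_or, not_false_eq_true,
    List.nodup_nil, and_true, ← ne_eq] at hn
  obtain ⟨⟨n1, n2, n3, n4, n5⟩, ⟨n6, n7, n8, n9⟩, ⟨n10, n11, n12⟩, ⟨n13, n14⟩, n15⟩ := hn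
  simp only [rot_equivX hh]
  simp [n1.symm, n2.symm, n3.symm, n4.symm, n5.symm, n6, n7, n8, n9, n10.symm, n11.symm, n12.symm,
    n13, n13.symm, n14, n14.symm, n15, n15.symm]

theorem rot_equivX_of_notMem {h x : Fin D.card} (hh : D.IsInner h) (h1 : ¬ D.rot.SameCycle h x)
    (h2 : ¬ D.rot.SameCycle (D.edge h) x) :
    (D.diagramX h).rot (D.equivX h x) = D.equivX h (D.rot x) := by
  rw [sameCycle_rot_iff] at h1 h2
  rw [rot_equivX hh]
  simp only [not_or] at h1 h2
  simp only [h1, h2, if_false]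

theorem isConnected_diagramX {h : Fin D.card} (hh : D.IsInner h) (hD : D.IsConnected) :
    (D.diagramX h).IsConnected := by
  rw [isConnected_iff] at *
  refine ⟨hD.1, fun p hr he x y => ?_⟩
  obtain ⟨r1, r2, r3, r4, r5, r6⟩ := rot_equivX_vertices hh
  have a1 := hr (D.equivX h h)
  have a2 := hr (D.equivX h (D.rot (D.rot h)))
  have a3 := hr (D.equivX h (D.rot (D.rot (D.edge h))))
  have a4 := hr (D.equivX h (D.edge h))
  have a5 := hr (D.equivX h (D.rot (D.edge h)))
  have a6 := hr (D.equivX h (D.rot h))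
  rw [r1] at a1; rw [r2] at a2; rw [r3] at a3; rw [r4] at a4; rw [r5] at a5; rw [r6] at a6
  clear r1 r2 r3 r4 r5 r6
  have a7 : p (D.equivX h h) → p (D.equivX h (D.edge h)) := he _
  have a8 : p (D.equivX h (D.edge h)) → p (D.equivX h h) := fun h' => by
    simpa [edge_equivX] using he _ h'
  have k1 : ∀ z, D.rot.SameCycle h z → (p (D.equivX h z) ↔ p (D.equivX h h)) := by
    intro z hz
    rcases sameCycle_rot_iff.1 hz with rfl | rfl | rfl <;> tauto
  have k2 : ∀ z, D.rot.SameCycle (D.edge h) z → (p (D.equivX h z) ↔ p (D.equivX h h)) := by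
    intro z hz
    rcases sameCycle_rot_iff.1 hz with rfl | rfl | rfl <;> tauto
  refine hD.2 (fun z => p (D.equivX h z)) (fun z hz => ?_) (fun z hz => he _ hz) x y
  by_cases e1 : D.rot.SameCycle h z
  · rw [k1 _ (by simpa using e1)]
    exact (k1 _ e1).1 hz
  by_cases e2 : D.rot.SameCycle (D.edge h) z
  · rw [k2 _ (by simpa using e2)]
    exact (k2 _ e2).1 hz
  · exact rot_equivX_of_notMem hh e1 e2 ▸ hr _ hz

theorem isLoop_diagramH {h : Fin D.card} (hh : D.IsInner h) (hD : D.IsLoop 3) :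
    (D.diagramH h).IsLoop 3 := by
  rw [isLoop_three_iff] at *
  exact ⟨isConnected_diagramH hh hD.1, hD.2.trans (by rw [diagramH, numLegs_reattach])⟩

theorem isLoop_diagramX {h : Fin D.card} (hh : D.IsInner h) (hD : D.IsLoop 3) :
    (D.diagramX h).IsLoop 3 := by
  rw [isLoop_three_iff] at *
  exact ⟨isConnected_diagramX hh hD.1, hD.2.trans (by rw [diagramX, numLegs_reattach])⟩

theorem isGood_loopDiagrams : IsGood (loopDiagrams 3) allSites where
  graphIso h hD := h.isLoop hD
  attach x hD := (isLoop_attach x).2 hD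
  site _ := trivial
  isLoop h := h

theorem sameCycle_base_iff (L : List (Fin B.card)) (x y) :
    (B.withLegs L).rot.SameCycle (B.base L x) (B.base L y) ↔ B.rot.SameCycle x y := by
  simp only [sameCycle_rot_iff, rot_base, (base_injective L).eq_iff]

/-- The IHX relation at an edge of `B`, with legs attached to the other edges. -/
theorem cls_withLegs_ihx (hB : B.IsLoop 3) {h : Fin B.card} (hh : B.IsInner h)
    {L : List (Fin B.card)} (h1 : h ∉ L) (h2 : B.edge h ∉ L) :
    cls (loopDiagrams 3) allSites (B.withLegs L) =
      cls (loopDiagrams 3) allSites ((B.diagramH h).withLegs (L.map (B.equivH h))) -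
      cls (loopDiagrams 3) allSites ((B.diagramX h).withLegs (L.map (B.equivX h))) := by
  have hP := isGood_loopDiagrams
  have he := edge_base h1 h2
  have hi : (B.withLegs L).IsInner (B.base L h) := by
    refine ⟨by simpa using hh.1, ?_, ?_⟩
    · rw [he]; simpa using hh.2.1
    · rw [he, sameCycle_base_iff]; exact hh.2.2
  have hL : (B.withLegs L).IsLoop 3 := hP.withLegs_mem hB L
  obtain ⟨θ, t1, t2⟩ := exists_perm_hom B L
  rw [IsGood.cls_ihx hi trivial hL (isLoop_diagramH hi hL) (isLoop_diagramX hi hL)]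
  congr 1
  · obtain ⟨φ, t3, -⟩ := t2 (Equiv.swap (B.rot h) (B.rot (B.rot h)) *
      Equiv.swap (B.rot (B.rot h)) (B.rot (B.edge h)) *
      Equiv.swap (B.rot (B.edge h)) (B.rot (B.rot (B.edge h))))
    have t4 := hP.cls_eq_of_iso t3.1 t3.2
    simp only [map_mul, t1, ← rot_base, ← he] at t4
    exact t4.symm
  · obtain ⟨φ, t3, -⟩ := t2 (Equiv.swap (B.rot h) (B.rot (B.rot h)) *
      Equiv.swap (B.rot (B.rot h)) (B.rot (B.rot (B.edge h))))
    have t4 := hP.cls_eq_of_iso t3.1 t3.2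
    simp only [map_mul, t1, ← rot_base, ← he] at t4
    exact t4.symm

end JacobiDiagram

namespace JacobiDiagram

variable {D D' Γ : JacobiDiagram}

/-! ### The internal graph -/

section graphIso

variable {φ : Fin D.card ≃ Fin D'.card} (h : GraphIso D D' φ)
include h

theorem GraphIso.hasFork (hD : D.HasFork) : D'.HasFork := by
  obtain ⟨x, h1, h2, h3⟩ := hD
  rcases h.rot_eq x with h4 | h4
  · refine ⟨φ x, by rwa [h.isUnivalent], by rwa [← h.edge, h.isUnivalent], ?_⟩
    rwa [← h4.1, ← h.edge, h.isUnivalent]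
  · refine ⟨φ (D.rot x), by rwa [h.isUnivalent, isUnivalent_rot],
      by rwa [← h.edge, h.isUnivalent], ?_⟩
    rwa [h4.1, rot_cube, ← h.edge, h.isUnivalent]

theorem GraphIso.isCore (x) : D'.IsCore (φ x) ↔ D.IsCore x := by
  simp only [IsCore, h.isUnivalent]
  refine and_congr_right fun _ => ⟨fun h' y hy => ?_, fun h' y hy => ?_⟩
  · rw [← h.isUnivalent, h.edge]
    exact h' _ ((h.sameCycle _ _).2 hy)
  · obtain ⟨y, rfl⟩ := φ.surjective y
    rw [← h.edge, h.isUnivalent]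
    exact h' _ ((h.sameCycle _ _).1 hy)

theorem GraphIso.arcStep {x z} (hs : D.ArcStep x z) : D'.ArcStep (φ x) (φ z) := by
  obtain ⟨w, h1, h2⟩ := hs
  refine ⟨φ w, by rwa [← h.edge, h.isUnivalent], ?_⟩
  rw [← h.edge]
  have e1 := h.rot_eq (D.edge x)
  have e2 := h.rot_eq z
  have c1 := D'.rot_cube (φ z)
  have c2 := D'.rot_cube (φ (D.edge x))
  rcases h2 with ⟨h2, h3⟩ | ⟨h2, h3⟩
  · rw [h2, h3] at e1
    rcases e1 with ⟨e1, e3⟩ | ⟨e1, e3⟩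
    · exact Or.inl ⟨e1.symm, by rw [e1, e3]⟩
    · refine Or.inr ⟨?_, ?_⟩
      · rw [e3, e1]
      · rw [e1, c2]
  · rw [h2, h3] at e2
    rcases e2 with ⟨e1, e3⟩ | ⟨e1, e3⟩
    · exact Or.inr ⟨e1.symm, by rw [e1, e3]⟩
    · refine Or.inl ⟨?_, ?_⟩
      · rw [e3, e1]
      · rw [e1, c1]

theorem GraphIso.arcJoins {x y} (hs : D.ArcJoins x y) : D'.ArcJoins (φ x) (φ y) := by
  obtain ⟨z, h1, rfl⟩ := hs
  exact ⟨φ z, h1.lift φ fun _ _ => h.arcStep, (h.edge z).symm⟩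

theorem GraphIso.hasInternalGraph (hD : D.HasInternalGraph Γ) : D'.HasInternalGraph Γ := by
  obtain ⟨h1, f, h2, h3, h4, h5⟩ := hD
  refine ⟨fun hf => h1 (h.symm.hasFork hf), φ ∘ f, φ.injective.comp h2, ?_, ?_, ?_⟩
  · rw [Set.range_comp, h3]
    ext y
    obtain ⟨y, rfl⟩ := φ.surjective y
    simp [h.isCore]
  · intro x y
    rw [h4, Function.comp_apply, Function.comp_apply, h.sameCycle]
  · exact fun x => h.arcJoins (h5 x)

end graphIso

theorem hasFork_attach_of_isUnivalent {x : Fin D.card}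
    (hx : D.IsUnivalent x ∨ D.IsUnivalent (D.edge x)) : (D.attach x).HasFork := by
  rcases hx with hx | hx
  · exact ⟨D.new x 2, by simp, by simp, by simpa using hx⟩
  · exact ⟨D.new x 1, by simp, by simpa using hx, by simp⟩

section attach

variable {x : Fin D.card} (hx : ¬ D.IsUnivalent x) (hx' : ¬ D.IsUnivalent (D.edge x))
include hx hx'

/-- The half-edges of `D` next to a leg remain those of `D.attach x` next to a leg. -/
theorem isUnivalent_edge_old (y) :
    (D.attach x).IsUnivalent ((D.attach x).edge (D.old x y)) ↔ D.IsUnivalent (D.edge y) := by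
  rw [attach_edge_old_eq_ite]
  split_ifs with h1 h2
  · subst h1; simpa using hx'
  · subst h2; simpa using hx
  · simp

theorem hasFork_attach : (D.attach x).HasFork ↔ D.HasFork := by
  have key := isUnivalent_edge_old hx hx'
  constructor
  · rintro ⟨y, h1, h2, h3⟩
    induction y using attach_cases with
    | h y =>
      refine ⟨y, by simpa using h1, (key _).1 h2, ?_⟩
      rwa [attach_rot_old, key] at h3
    | h0 => simp [hx] at h2
    | h1 => simp [hx'] at h2
    | h2 => simp [hx] at h3
    | h3 => simp at h1
  · rintro ⟨y, h1, h2, h3⟩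
    exact ⟨D.old x y, by simpa using h1, (key _).2 h2, by rwa [attach_rot_old, key]⟩

theorem isCore_old (y) : (D.attach x).IsCore (D.old x y) ↔ D.IsCore y := by
  have key := isUnivalent_edge_old hx hx'
  simp only [IsCore, isUnivalent_old]
  refine and_congr_right fun _ => ⟨fun h z hz => ?_, fun h z hz => ?_⟩
  · rw [← key]
    refine h _ ?_
    rw [sameCycle_rot_iff] at *
    simpa using hz
  · rw [sameCycle_rot_iff, attach_rot_old, attach_rot_old] at hz
    rcases hz with rfl | rfl | rfl <;> rw [key] <;> exact h _ (by simp [Equiv.Perm.SameCycle.refl])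

omit hx hx' in
theorem not_isCore_new (k) : ¬ (D.attach x).IsCore (D.new x k) := by
  rintro ⟨h1, h2⟩
  have h3 : ¬ (D.attach x).rot.SameCycle (D.new x k) (D.new x 2) := fun h => h2 _ h (by simp)
  rw [sameCycle_rot_iff, attach_rot_new, attach_rot_new] at h3
  fin_cases k <;> simp [legRot] at h1 h3

/-- The projection contracting the new vertex: each of its two half-edges on the subdivided edge
goes to the half-edge of this edge that points the same way. The values at the half-edges of the leg
do not matter. -/
noncomputable def unattach (D : JacobiDiagram) (x : Fin D.card) (z : Fin (D.attach x).card) :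
    Fin D.card :=
  Sum.elim id ![D.edge x, x, x, x] ((D.attachEquiv x).symm z)

omit hx hx' in
@[simp] theorem unattach_old (y) : D.unattach x (D.old x y) = y := by simp [unattach]
omit hx hx' in
@[simp] theorem unattach_new_zero : D.unattach x (D.new x 0) = D.edge x := by simp [unattach]
omit hx hx' in
@[simp] theorem unattach_new_one : D.unattach x (D.new x 1) = x := by simp [unattach]

omit hx hx' in
theorem edge_unattach {y u} (h : (D.attach x).edge y = D.old x u) :
    D.edge (D.unattach x y) = u := by
  rw [edge_eq_comm] at h
  subst h
  rw [attach_edge_old_eq_ite]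
  split_ifs with h1 h2
  · simp [h1]
  · simp [h2]
  · simp

theorem arcStep_unattach {y z} (h : (D.attach x).ArcStep y z) :
    Relation.ReflTransGen D.ArcStep (D.unattach x y) (D.unattach x z) := by
  have key := isUnivalent_edge_old hx hx'
  have inj := (D.attach x).rot.injective
  obtain ⟨w, h1, h2⟩ := h
  induction w using attach_cases with
  | h w =>
    rw [key] at h1
    rcases h2 with ⟨h2, rfl⟩ | ⟨h2, h3⟩
    · have h4 : (D.attach x).edge y = D.old x (D.rot (D.rot w)) :=
        inj (by rw [h2, attach_rot_old, rot_cube])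
      have h5 := edge_unattach h4
      refine .single ⟨w, h1, Or.inl ?_⟩
      simp [h5]
    · have h4 : z = D.old x (D.rot (D.rot w)) := inj (by rw [h2, attach_rot_old, rot_cube])
      subst h4
      have h5 := edge_unattach ((attach_rot_old x w).symm.trans h3).symm
      refine .single ⟨w, h1, Or.inr ?_⟩
      simp [h5]
  | h0 => simp [hx] at h1
  | h1 => simp [hx'] at h1
  | h2 =>
    rcases h2 with ⟨h2, rfl⟩ | ⟨h2, h3⟩
    · have h4 : (D.attach x).edge y = D.new x 1 := inj (by rw [h2, attach_rot_new_one])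
      rw [edge_eq_comm, attach_edge_new_one] at h4
      subst h4
      simp [Relation.ReflTransGen.refl]
    · have h4 : z = D.new x 1 := inj (by rw [h2, attach_rot_new_one])
      rw [attach_rot_new_two, eq_comm, edge_eq_comm, attach_edge_new_zero] at h3
      subst h4 h3
      simp [Relation.ReflTransGen.refl]
  | h3 => simp at h1

omit hx hx' in
/-- Across the new vertex. -/
theorem arcStep_old_self : (D.attach x).ArcStep (D.old x x) (D.new x 1) :=
  ⟨D.new x 2, by simp, Or.inr (by simp)⟩

omit hx hx' in
/-- Across the new vertex, in the other direction. -/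
theorem arcStep_old_edge : (D.attach x).ArcStep (D.old x (D.edge x)) (D.new x 0) :=
  ⟨D.new x 2, by simp, Or.inl (by simp)⟩

theorem reflTransGen_arcStep_old {y z} (h : D.ArcStep y z) :
    Relation.ReflTransGen (D.attach x).ArcStep (D.old x y) (D.old x z) := by
  have key := isUnivalent_edge_old hx hx'
  obtain ⟨w, h1, h2⟩ := h
  have step : ∀ u, (D.attach x).edge u = D.old x (D.edge y) →
      (D.attach x).ArcStep u (D.old x z) := fun u hu =>
    ⟨D.old x w, (key w).2 h1, by simpa [hu] using h2⟩
  by_cases e1 : y = x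
  · subst e1
    exact .head arcStep_old_self (.single (step _ (by simp)))
  · by_cases e2 : y = D.edge x
    · subst e2
      exact .head arcStep_old_edge (.single (step _ (by simp)))
    · exact .single (step _ (attach_edge_old e1 e2))

theorem arcJoins_old (y z) :
    (D.attach x).ArcJoins (D.old x y) (D.old x z) ↔ D.ArcJoins y z := by
  constructor
  · rintro ⟨w, h1, h2⟩
    have h3 : Relation.ReflTransGen D.ArcStep (D.unattach x (D.old x y)) (D.unattach x w) :=
      h1.lift' (D.unattach x) fun _ _ => arcStep_unattach hx hx'
    rw [unattach_old] at h3
    exact ⟨_, h3, edge_unattach h2⟩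
  · rintro ⟨w, h1, rfl⟩
    have h3 := h1.lift' (D.old x) fun _ _ => reflTransGen_arcStep_old hx hx'
    by_cases e1 : w = x
    · subst e1
      exact ⟨_, h3.tail arcStep_old_self, by simp⟩
    · by_cases e2 : w = D.edge x
      · subst e2
        exact ⟨_, h3.tail arcStep_old_edge, by simp⟩
      · exact ⟨_, h3, attach_edge_old e1 e2⟩

/-- A leg attached to an edge which is not itself a leg does not change the internal graph. -/
theorem hasInternalGraph_attach : (D.attach x).HasInternalGraph Γ ↔ D.HasInternalGraph Γ := by
  have hr : ∀ y z, (D.attach x).rot.SameCycle (D.old x y) (D.old x z) ↔ D.rot.SameCycle y z :=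
    fun y z => by simp [sameCycle_rot_iff]
  unfold HasInternalGraph
  rw [hasFork_attach hx hx']
  refine and_congr_right fun _ => ⟨?_, ?_⟩
  · rintro ⟨f, h1, h2, h3, h4⟩
    have h5 : ∀ y, ∃ z, D.old x z = f y := by
      intro y
      have h6 : f y ∈ {z | (D.attach x).IsCore z} := h2 ▸ Set.mem_range_self y
      generalize f y = u at h6
      induction u using attach_cases with
      | h z => exact ⟨z, rfl⟩
      | _ => exact absurd h6 (not_isCore_new _)
    choose g hg using h5
    obtain rfl : f = D.old x ∘ g := funext fun y => (hg y).symm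
    refine ⟨g, h1.of_comp, ?_, ?_, ?_⟩
    · ext z
      rw [Set.ext_iff] at h2
      simpa [isCore_old hx hx'] using h2 (D.old x z)
    · intro y z
      rw [h3, Function.comp_apply, Function.comp_apply, hr]
    · exact fun y => (arcJoins_old hx hx' _ _).1 (h4 y)
  · rintro ⟨f, h1, h2, h3, h4⟩
    refine ⟨D.old x ∘ f, (old_injective x).comp h1, ?_, ?_, ?_⟩
    · rw [Set.range_comp, h2]
      ext u
      induction u using attach_cases with
      | h z => simp [isCore_old hx hx']
      | _ => simp [not_isCore_new]
    · intro y z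
      rw [h3, Function.comp_apply, Function.comp_apply, hr]
    · exact fun y => (arcJoins_old hx hx' _ _).2 (h4 y)

end attach

theorem isGood_internalDiagrams (Γ : JacobiDiagram) :
    IsGood (internalDiagrams 3 Γ) IsLegSite where
  graphIso h hD := ⟨h.isLoop hD.1, hD.2.imp h.hasFork h.hasInternalGraph⟩
  attach {D} x hD := by
    refine ⟨(isLoop_attach x).2 hD.1, ?_⟩
    by_cases h : D.IsUnivalent x ∨ D.IsUnivalent (D.edge x)
    · exact Or.inl (hasFork_attach_of_isUnivalent h)
    · rw [not_or] at h
      rw [hasFork_attach h.1 h.2, hasInternalGraph_attach h.1 h.2]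
      exact hD.2
  site h := h
  isLoop h := h.1

end JacobiDiagram

namespace JacobiDiagram

variable {D D' B Γ : JacobiDiagram}

/-! ### Removing a leg -/

/-- A connected three-loop diagram has no small set of half-edges closed under `rot` and `edge`. -/
theorem IsLoop.not_closed (hD : D.IsLoop 3) {S : Finset (Fin D.card)} (hS : S.card < 12)
    {x} (hx : x ∈ S) (hr : ∀ y ∈ S, D.rot y ∈ S) (he : ∀ y ∈ S, D.edge y ∈ S) : False := by
  rw [isLoop_three_iff, isConnected_iff] at hD
  have h1 : S = Finset.univ := Finset.eq_univ_of_forall fun y =>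
    hD.1.2 (· ∈ S) hr he x y hx
  rw [h1, Finset.card_univ, Fintype.card_fin] at hS
  omega

/-- Every leg of a three-loop diagram has been attached to a smaller diagram. With the leg `{r, s}`,
its univalent vertex `s` and its trivalent vertex `(r p q)`, the smaller diagram arises by removing
`p`, `q`, `r`, `s` and joining the other ends of the edges of `p` and `q`. -/
theorem exists_isIso_attach (hD : D.IsLoop 3) {s : Fin D.card} (hs : D.IsUnivalent s) :
    ∃ (D' : JacobiDiagram) (x : Fin D'.card) (φ : _), IsIso (D'.attach x) D φ ∧
      φ (D'.new x 3) = s := by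
  obtain ⟨r, hr⟩ : ∃ r, D.edge s = r := ⟨_, rfl⟩
  obtain ⟨p, hp⟩ : ∃ p, D.rot r = p := ⟨_, rfl⟩
  obtain ⟨q, hq⟩ : ∃ q, D.rot p = q := ⟨_, rfl⟩
  have hq' : D.rot q = r := by rw [← hq, ← hp, rot_cube]
  have hr' : D.edge r = s := by rw [← hr, edge_edge]
  have hs' : D.rot s = s := hs
  have inj := D.rot.injective
  have hrs : r ≠ s := hr ▸ D.edge_ne s
  -- otherwise the leg would be a connected component, with a single edge
  have hrp : p ≠ r := by
    rintro rfl
    refine hD.not_closed (S := {p, s}) (x := s) ?_ (by simp) (by simp [hp, hs'])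
      (by simp [hr, hr'])
    exact (Finset.card_le_two).trans_lt (by norm_num)
  have hqr : q ≠ r := by
    rintro rfl
    exact hrp (hp.symm.trans hq')
  have hpq : p ≠ q := by
    rintro rfl
    exact hrp (hq.symm.trans hq')
  have hps : p ≠ s := by
    rintro rfl
    exact hpq (hs'.symm.trans hq)
  have hqs : q ≠ s := by
    rintro rfl
    exact hrs (hq'.symm.trans hs')
  -- otherwise the leg with a loop at its end would be a connected component
  have hepq : D.edge p ≠ q := by
    intro h
    have h' : D.edge q = p := by rw [← h, edge_edge]
    refine hD.not_closed (S := {p, q, r, s}) (x := s) ?_ (by simp) (by simp [hp, hq, hq', hs'])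
      (by simp [hr, hr', h, h'])
    exact (Finset.card_le_four).trans_lt (by norm_num)
  have hep : D.edge p ≠ p ∧ D.edge p ≠ q ∧ D.edge p ≠ r ∧ D.edge p ≠ s :=
    ⟨D.edge_ne p, hepq, fun h => hps (D.edge.injective (h.trans hr.symm)),
      fun h => hrp (D.edge.injective (h.trans hr'.symm))⟩
  have heq : D.edge q ≠ p ∧ D.edge q ≠ q ∧ D.edge q ≠ r ∧ D.edge q ≠ s :=
    ⟨fun h => hepq (by rw [← h, edge_edge]), D.edge_ne q,
      fun h => hqs (D.edge.injective (h.trans hr.symm)),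
      fun h => hqr (D.edge.injective (h.trans hr'.symm))⟩
  -- the half-edges that remain when the leg and its vertex are removed
  let α := {y : Fin D.card // y ≠ p ∧ y ≠ q ∧ y ≠ r ∧ y ≠ s}
  have hrot : ∀ y, (D.rot y ≠ p ∧ D.rot y ≠ q ∧ D.rot y ≠ r ∧ D.rot y ≠ s) ↔
      (y ≠ p ∧ y ≠ q ∧ y ≠ r ∧ y ≠ s) := by
    intro y
    have e1 : D.rot y = p ↔ y = r := by rw [← hp, inj.eq_iff]
    have e2 : D.rot y = q ↔ y = p := by rw [← hq, inj.eq_iff]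
    have e3 : D.rot y = r ↔ y = q := by rw [← hq', inj.eq_iff]
    have e4 : D.rot y = s ↔ y = s := ⟨fun h => inj (h.trans hs'.symm), fun h => by rw [h, hs']⟩
    simp only [ne_eq, e1, e2, e3, e4]
    tauto
  -- the edges of the smaller diagram
  let ef : α → α := fun y =>
    if h1 : D.edge y = p then ⟨D.edge q, heq⟩ else
    if h2 : D.edge y = q then ⟨D.edge p, hep⟩ else
    ⟨D.edge y, h1, h2, fun h => y.2.2.2.2 (D.edge.injective (h.trans hr.symm)),
      fun h => y.2.2.2.1 (D.edge.injective (h.trans hr'.symm))⟩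
  have ef_val : ∀ y, (ef y).1 = if D.edge y = p then D.edge q else
      if D.edge y = q then D.edge p else D.edge y := by
    intro y
    simp only [ef]
    split_ifs <;> rfl
  have hef : ∀ y, ef (ef y) = y := by
    intro y
    have hy := y.2
    have ee := D.edge_edge
    apply Subtype.ext
    rw [ef_val, ef_val]
    have e1 : D.edge y.1 = p ↔ y.1 = D.edge p := edge_eq_comm _ _
    have e2 : D.edge y.1 = q ↔ y.1 = D.edge q := edge_eq_comm _ _
    by_cases h1 : D.edge y.1 = p
    · rw [if_pos h1, edge_edge, if_neg hpq.symm, if_pos rfl, ← e1.1 h1]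
    · by_cases h2 : D.edge y.1 = q
      · rw [if_neg h1, if_pos h2, edge_edge, if_pos rfl, ← e2.1 h2]
      · rw [if_neg h1, if_neg h2, edge_edge, if_neg hy.1, if_neg hy.2.1]
  have hef' : ∀ y, ef y ≠ y := by
    intro y h
    have h' := congrArg Subtype.val h
    rw [ef_val] at h'
    split_ifs at h' with h1 h2
    · rw [← h', edge_edge] at h1; exact hpq h1.symm
    · rw [← h', edge_edge] at h2; exact hpq h2
    · exact D.edge_ne _ h'
  let D₀ := ofPerms α (D.rot.subtypePerm hrot) ⟨ef, ef, hef, hef⟩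
    (fun y => Subtype.ext (D.rot_cube y.1)) hef hef'
  let e : α ≃ Fin D₀.card := ofPermsEquiv _ _ _ _ _ _
  have e_rot : ∀ y : α, D₀.rot (e y) = e ⟨D.rot y.1, (hrot _).2 y.2⟩ := fun y => ofPerms_rot y
  have e_edge : ∀ y : α, D₀.edge (e y) = e (ef y) := fun y => ofPerms_edge y
  let x : Fin D₀.card := e ⟨D.edge p, hep⟩
  let f : Fin (D₀.attach x).card → Fin D.card := fun z =>
    Sum.elim (fun y => (e.symm y).1) ![p, q, r, s] ((D₀.attachEquiv x).symm z)
  have f_old : ∀ y : α, f (D₀.old x (e y)) = y.1 := fun y => by simp [f]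
  have f0 : f (D₀.new x 0) = p := by simp [f]
  have f1 : f (D₀.new x 1) = q := by simp [f]
  have f2 : f (D₀.new x 2) = r := by simp [f]
  have f3 : f (D₀.new x 3) = s := by simp [f]
  have f_rot : ∀ z, f ((D₀.attach x).rot z) = D.rot (f z) := by
    intro z
    induction z using attach_cases with
    | h y =>
      obtain ⟨y, rfl⟩ := e.surjective y
      rw [attach_rot_old, e_rot, f_old, f_old]
    | h0 => rw [attach_rot_new_zero, f0, f1, hq]
    | h1 => rw [attach_rot_new_one, f1, f2, hq']
    | h2 => rw [attach_rot_new_two, f0, f2, hp]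
    | h3 => rw [attach_rot_new_three, f3, hs']
  have x_edge : D₀.edge x = e ⟨D.edge q, heq⟩ := by
    rw [e_edge]
    congr 1
    apply Subtype.ext
    rw [ef_val]
    simp
  have f_edge : ∀ z, f ((D₀.attach x).edge z) = D.edge (f z) := by
    intro z
    induction z using attach_cases with
    | h y =>
      obtain ⟨y, rfl⟩ := e.surjective y
      rw [attach_edge_old_eq_ite, x_edge]
      simp only [x, e.injective.eq_iff]
      by_cases h1 : y = ⟨D.edge p, hep⟩
      · rw [if_pos h1, h1]
        exact f0.trans ((D.edge_edge p).symm.trans (congrArg D.edge (f_old ⟨D.edge p, hep⟩).symm))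
      · by_cases h2 : y = ⟨D.edge q, heq⟩
        · rw [if_neg h1, if_pos h2, h2]
          exact f1.trans ((D.edge_edge q).symm.trans
            (congrArg D.edge (f_old ⟨D.edge q, heq⟩).symm))
        · rw [if_neg h1, if_neg h2, e_edge]
          refine (f_old _).trans (Eq.trans ?_ (congrArg D.edge (f_old y).symm))
          rw [ef_val, if_neg, if_neg]
          · exact fun h => h2 (Subtype.ext ((edge_eq_comm _ _).1 h))
          · exact fun h => h1 (Subtype.ext ((edge_eq_comm _ _).1 h))
    | h0 => rw [attach_edge_new_zero, f0]; exact f_old _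
    | h1 => rw [attach_edge_new_one, f1, x_edge]; exact f_old _
    | h2 => rw [attach_edge_new_two, f2, f3, hr']
    | h3 => rw [attach_edge_new_three, f2, f3, hr]
  have f_surj : Function.Surjective f := by
    intro y
    by_cases h1 : y = p
    · exact ⟨_, f0.trans h1.symm⟩
    by_cases h2 : y = q
    · exact ⟨_, f1.trans h2.symm⟩
    by_cases h3 : y = r
    · exact ⟨_, f2.trans h3.symm⟩
    by_cases h4 : y = s
    · exact ⟨_, f3.trans h4.symm⟩
    exact ⟨_, f_old ⟨y, h1, h2, h3, h4⟩⟩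
  have f_inj : Function.Injective f := by
    have key : Function.Injective
        (Sum.elim (fun y => (e.symm y).1) ![p, q, r, s] : Fin D₀.card ⊕ Fin 4 → Fin D.card) := by
      refine Function.Injective.sumElim (Subtype.val_injective.comp e.symm.injective) ?_ ?_
      · intro i j
        fin_cases i <;> fin_cases j <;> simp [hpq, hrp, hps, hqr, hqs, hrs, hpq.symm, hrp.symm,
          hps.symm, hqr.symm, hqs.symm, hrs.symm]
      · intro y i
        have := (e.symm y).2
        fin_cases i
        exacts [this.1, this.2.1, this.2.2.1, this.2.2.2]
    exact key.comp (D₀.attachEquiv x).symm.injective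
  exact ⟨D₀, x, Equiv.ofBijective f ⟨f_inj, f_surj⟩, ⟨f_rot, f_edge⟩, f3⟩

end JacobiDiagram

namespace JacobiDiagram

variable {D D' B Γ : JacobiDiagram}

/-! ### Diagrams as trivalent graphs with legs attached -/

/-- Attaching legs to the edges of a trivalent graph does not change its internal graph, which
consists of the half-edges of the original graph. -/
theorem withLegs_internal (hB : ∀ b, ¬ B.IsUnivalent b) (L : List (Fin B.card)) :
    ¬ (B.withLegs L).HasFork ∧ (∀ z, (B.withLegs L).IsCore z ↔ ∃ b, B.base L b = z) ∧
      ((B.withLegs L).HasInternalGraph Γ ↔ B.HasInternalGraph Γ) := by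
  induction L with
  | nil =>
    refine ⟨fun ⟨x, _, h, _⟩ => hB _ h, fun z => ?_, Iff.rfl⟩
    exact ⟨fun _ => ⟨z, rfl⟩, fun _ => ⟨hB _, fun y _ => hB _⟩⟩
  | cons b L ih =>
    obtain ⟨h1, h2, h3⟩ := ih
    have hb := (h2 (B.base L b)).2 ⟨b, rfl⟩
    have hb' := hb.2 _ (Equiv.Perm.SameCycle.refl _ _)
    refine ⟨fun h => h1 ((hasFork_attach hb.1 hb').1 h), fun z => ?_,
      (hasInternalGraph_attach hb.1 hb').trans h3⟩
    have hn := fun k => iff_of_false (not_isCore_new (x := B.base L b) k)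
      (fun ⟨c, hc⟩ => old_ne_new (D := B.withLegs L) (x := B.base L b) (k := k) hc :
        ¬ ∃ c, B.base (b :: L) c = _)
    refine attach_cases (p := fun z => IsCore _ z ↔ ∃ c, B.base (b :: L) c = z) _ (fun y => ?_)
      (hn 0) (hn 1) (hn 2) (hn 3) z
    rw [isCore_old hb.1 hb', h2]
    exact exists_congr fun c => (old_inj _).symm

theorem not_isUnivalent_of_not_hasFork_attach {x : Fin D.card} (h : ¬ (D.attach x).HasFork) :
    ¬ D.IsUnivalent x ∧ ¬ D.IsUnivalent (D.edge x) :=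
  ⟨fun h' => h (hasFork_attach_of_isUnivalent (.inl h')),
    fun h' => h (hasFork_attach_of_isUnivalent (.inr h'))⟩

theorem IsCore.rot {x : Fin D.card} (h : D.IsCore x) : D.IsCore (D.rot x) :=
  ⟨by simpa using h.1, fun y hy => h.2 y ((Equiv.Perm.SameCycle.refl _ _).apply_right.trans hy)⟩

/-- If a diagram has a leg and an internal vertex, then it has a leg next to an internal vertex. -/
theorem exists_leg_next_to_core (hD : D.IsConnected) {x s} (hx : D.IsCore x)
    (hs : D.IsUnivalent s) : ∃ s, D.IsUnivalent s ∧ (D.IsCore (D.edge (D.rot (D.edge s))) ∨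
      D.IsCore (D.edge (D.rot (D.rot (D.edge s))))) := by
  by_contra! h
  refine ((isConnected_iff.1 hD).2 D.IsCore (fun _ => IsCore.rot) (fun y hy => ?_) x s hx).1 hs
  have hy' := hy.2 _ (Equiv.Perm.SameCycle.refl _ _)
  by_contra hc
  simp only [IsCore, hy', not_false_eq_true, true_and, not_forall, not_not] at hc
  obtain ⟨z, hz, hz'⟩ := hc
  have := h _ hz'
  rcases sameCycle_rot_iff.1 hz with rfl | rfl | rfl
  · exact hy.1 (by simpa using hz')
  · exact this.2 (by simpa using hy)
  · exact this.1 (by simpa using hy)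

theorem exists_isUnivalent {n : ℕ} (h : D.numLegs = n + 1) : ∃ s, D.IsUnivalent s := by
  have : Nonempty {x // D.IsUnivalent x} := (Nat.card_pos_iff.1 (by rw [numLegs] at h; omega)).1
  exact ⟨this.some.1, this.some.2⟩

theorem not_isUnivalent_of_numLegs (h : D.numLegs = 0) (b) : ¬ D.IsUnivalent b := fun hb => by
  have : 0 < Nat.card {x // D.IsUnivalent x} := Nat.card_pos_iff.2 ⟨⟨b, hb⟩, inferInstance⟩
  exact this.ne' h

theorem numLegs_of_not_isUnivalent (h : ∀ b, ¬ D.IsUnivalent b) : D.numLegs = 0 := by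
  have : IsEmpty {x // D.IsUnivalent x} := ⟨fun x => h _ x.2⟩
  exact Nat.card_of_isEmpty

/-- Every three-loop diagram without forks is obtained from a trivalent graph by attaching legs to
its edges, one next to the other. -/
theorem exists_graphIso_withLegs (hD : D.IsLoop 3) (hf : ¬ D.HasFork) :
    ∃ (B : JacobiDiagram) (L : List (Fin B.card)) (φ : _), B.IsLoop 3 ∧
      (∀ b, ¬ B.IsUnivalent b) ∧ GraphIso D (B.withLegs L) φ := by
  induction hn : D.numLegs generalizing D with
  | zero => exact ⟨D, [], _, hD, not_isUnivalent_of_numLegs hn, GraphIso.refl D⟩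
  | succ n ih =>
    -- removing a leg of `D`
    have key : ∀ s, D.IsUnivalent s → ∃ (D' : JacobiDiagram) (x : Fin D'.card) (φ : _),
        GraphIso (D'.attach x) D φ ∧ φ (D'.new x 3) = s ∧ ¬ D'.IsUnivalent x ∧
        ¬ D'.IsUnivalent (D'.edge x) ∧ ∃ (B : JacobiDiagram) (L : List (Fin B.card)) (φ : _),
          B.IsLoop 3 ∧ (∀ b, ¬ B.IsUnivalent b) ∧ GraphIso D' (B.withLegs L) φ := by
      intro s hs
      obtain ⟨D', x, φ, h1, h2⟩ := exists_isIso_attach hD hs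
      have h3 : ¬ (D'.attach x).HasFork := fun h => hf (h1.graphIso.hasFork h)
      obtain ⟨h4, h5⟩ := not_isUnivalent_of_not_hasFork_attach h3
      refine ⟨D', x, φ, h1.graphIso, h2, h4, h5, ih ?_ (mt (hasFork_attach h4 h5).2 h3) ?_⟩
      · exact (isLoop_attach x).1 (h1.graphIso.symm.isLoop hD)
      · have := h1.graphIso.numLegs_eq
        rw [numLegs_attach] at this
        omega
    obtain ⟨s, hs⟩ := exists_isUnivalent hn
    obtain ⟨y, hy⟩ : ∃ y, D.IsCore y := by
      obtain ⟨D', x, φ, h1, h2, h4, h5, B, L, χ, hB, hB', h6⟩ := key s hs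
      have b : Fin B.card := ⟨0, (isConnected_iff.1 (isLoop_three_iff.1 hB).1).1⟩
      have h7 := ((withLegs_internal (Γ := B) hB' L).2.1 _).2 ⟨b, rfl⟩
      rw [← χ.apply_symm_apply (B.base L b), h6.isCore, ← isCore_old h4 h5, ← h1.isCore] at h7
      exact ⟨_, h7⟩
    obtain ⟨s, hs, hs'⟩ := exists_leg_next_to_core (isLoop_three_iff.1 hD).1 hy hs
    obtain ⟨D', x, φ, h1, h2, h4, h5, B, L, χ, hB, hB', h6⟩ := key s hs
    have hb : ∀ y, D'.IsCore y → ∃ b, χ y = B.base L b := fun y hy => by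
      rw [← h6.isCore, (withLegs_internal (Γ := B) hB' L).2.1] at hy
      exact hy.imp fun b => Eq.symm
    have e2 : D.edge s = φ (D'.new x 2) := by rw [← h2, ← h1.edge, attach_edge_new_three]
    have e0 : D.edge (φ (D'.new x 0)) = φ (D'.old x x) := by rw [← h1.edge, attach_edge_new_zero]
    have e1 : D.edge (φ (D'.new x 1)) = φ (D'.old x (D'.edge x)) := by
      rw [← h1.edge, attach_edge_new_one]
    have hr := h1.rot_eq (D'.new x 2)
    rw [attach_rot_new_two, attach_rot_new_zero, ← e2] at hr
    have hx : D'.IsCore x ∨ D'.IsCore (D'.edge x) := by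
      rw [← isCore_old h4 h5, ← isCore_old h4 h5, ← h1.isCore, ← h1.isCore, ← e0, ← e1]
      rcases hr with ⟨h7, h8⟩ | ⟨h7, h8⟩
      · rwa [h7, h8]
      · rwa [h7, h8, or_comm]
    rcases hx with hx | hx
    · obtain ⟨b, hb⟩ := hb x hx
      obtain ⟨ω, h7, -⟩ := h6.exists_attach hb
      exact ⟨B, b :: L, _, hB, hB', h1.symm.trans h7⟩
    · obtain ⟨b, hb⟩ := hb _ hx
      obtain ⟨ω, h7, -⟩ := h6.exists_attach hb
      exact ⟨B, b :: L, _, hB, hB', h1.symm.trans ((GraphIso.attach_edge x).trans h7)⟩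

/-! ### The tetrahedron -/

theorem not_isUnivalent_tetrahedron : ∀ b, ¬ tetrahedron.IsUnivalent b := by
  unfold IsUnivalent; decide

theorem isLoop_tetrahedron : tetrahedron.IsLoop 3 := by
  rw [isLoop_three_iff, numLegs_of_not_isUnivalent not_isUnivalent_tetrahedron]
  refine ⟨isConnected_iff.2 ⟨by decide, fun p hr he => ?_⟩, rfl⟩
  have r : ∀ x : Fin 12, p x → p (tetrahedron.rot x) := hr
  have e : ∀ x : Fin 12, p x → p (tetrahedron.edge x) := he
  have h0 : ∀ x : Fin 12, p x → p (0 : Fin 12) := by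
    have c0 : p (0 : Fin 12) → p (0 : Fin 12) := id
    have c2 : p (2 : Fin 12) → p (0 : Fin 12) := r 2
    have c1 : p (1 : Fin 12) → p (0 : Fin 12) := fun h => c2 (r 1 h)
    have c3 : p (3 : Fin 12) → p (0 : Fin 12) := e 3
    have c5 : p (5 : Fin 12) → p (0 : Fin 12) := fun h => c3 (r 5 h)
    have c4 : p (4 : Fin 12) → p (0 : Fin 12) := fun h => c5 (r 4 h)
    have c6 : p (6 : Fin 12) → p (0 : Fin 12) := fun h => c1 (e 6 h)
    have c8 : p (8 : Fin 12) → p (0 : Fin 12) := fun h => c6 (r 8 h)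
    have c7 : p (7 : Fin 12) → p (0 : Fin 12) := fun h => c8 (r 7 h)
    have c9 : p (9 : Fin 12) → p (0 : Fin 12) := fun h => c2 (e 9 h)
    have c11 : p (11 : Fin 12) → p (0 : Fin 12) := fun h => c9 (r 11 h)
    have c10 : p (10 : Fin 12) → p (0 : Fin 12) := fun h => c11 (r 10 h)
    intro x hx
    fin_cases x
    exacts [c0 hx, c1 hx, c2 hx, c3 hx, c4 hx, c5 hx, c6 hx, c7 hx, c8 hx, c9 hx, c10 hx, c11 hx]
  have h1 : p (0 : Fin 12) → ∀ x : Fin 12, p x := by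
    intro c0
    have c1 : p (1 : Fin 12) := r 0 c0
    have c2 : p (2 : Fin 12) := r 1 c1
    have c3 : p (3 : Fin 12) := e 0 c0
    have c4 : p (4 : Fin 12) := r 3 c3
    have c5 : p (5 : Fin 12) := r 4 c4
    have c6 : p (6 : Fin 12) := e 1 c1
    have c7 : p (7 : Fin 12) := r 6 c6
    have c8 : p (8 : Fin 12) := r 7 c7
    have c9 : p (9 : Fin 12) := e 2 c2
    have c10 : p (10 : Fin 12) := r 9 c9
    have c11 : p (11 : Fin 12) := r 10 c10
    intro x
    fin_cases x <;> assumption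
  exact fun x y hx => h1 (h0 x hx) y

theorem tetrahedron_hasInternalGraph : tetrahedron.HasInternalGraph tetrahedron := by
  have hu := not_isUnivalent_tetrahedron
  refine ⟨fun ⟨x, _, h, _⟩ => hu _ h, id, Function.injective_id, ?_, fun x y => Iff.rfl,
    fun x => ⟨x, .refl, rfl⟩⟩
  ext x
  exact iff_of_true ⟨x, rfl⟩ ⟨hu _, fun y _ => hu _⟩

/-- A trivalent graph whose internal graph is the tetrahedron is the tetrahedron. -/
theorem HasInternalGraph.exists_graphIso (h : B.HasInternalGraph Γ) (hB : ∀ b, ¬ B.IsUnivalent b) :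
    ∃ φ, GraphIso Γ B φ := by
  obtain ⟨-, f, h1, h2, h3, h4⟩ := h
  have hs : Function.Surjective f := by
    rw [← Set.range_eq_univ, h2]
    exact Set.eq_univ_of_forall fun x => ⟨hB _, fun y _ => hB _⟩
  refine ⟨Equiv.ofBijective f ⟨h1, hs⟩, fun x => ?_, fun x => ?_⟩
  · obtain ⟨z, h5, h6⟩ := h4 x
    rcases h5.cases_head with rfl | ⟨w, ⟨u, h7, -⟩, -⟩
    · exact h6.symm
    · exact absurd h7 (hB _)
  · have h5 := (h3 x (Γ.rot x)).1 (sameCycle_rot_iff.2 (.inr (.inl rfl)))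
    rcases sameCycle_rot_iff.1 h5 with h6 | h6
    · exfalso
      have h7 : Γ.rot x = x := h1 h6
      obtain ⟨y, hy⟩ := hs (B.rot (f x))
      have h8 := (h3 x y).2 (sameCycle_rot_iff.2 (.inr (.inl hy)))
      have h9 : y = x := by
        rcases sameCycle_rot_iff.1 h8 with h | h | h <;> simpa [h7] using h
      exact hB (f x) (by rw [IsUnivalent, ← hy, h9])
    · exact h6

theorem tetrahedron_mem : tetrahedron ∈ internalDiagrams 3 tetrahedron :=
  ⟨isLoop_tetrahedron, .inr tetrahedron_hasInternalGraph⟩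

theorem GraphIso.cls_mem {P site} (hP : IsGood P site) {φ} (h : GraphIso D D' φ)
    {S : Submodule ℚ (Space P site)} : cls P site D' ∈ S ↔ cls P site D ∈ S := by
  rcases hP.cls_graphIso h with h | h <;> rw [h]
  exact S.neg_mem_iff

/-- The diagrams of tetrahedral type are spanned by the tetrahedra with legs. -/
theorem cls_mem_of_internalDiagrams (hD : D ∈ internalDiagrams 3 tetrahedron)
    {P site} (hP : IsGood P site) {S : Submodule ℚ (Space P site)}
    (hS : ∀ L : List (Fin tetrahedron.card), L.length = D.numLegs →
      cls P site (tetrahedron.withLegs L) ∈ S) : cls P site D ∈ S := by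
  by_cases hf : D.HasFork
  · rw [hP.cls_of_hasFork hf]; exact S.zero_mem
  obtain ⟨B, L, φ, h1, h2, h3⟩ := exists_graphIso_withLegs hD.1 hf
  have h4 := (withLegs_internal h2 L).2.2.1 (h3.hasInternalGraph (hD.2.resolve_left hf))
  obtain ⟨ψ, h5⟩ := h4.exists_graphIso h2
  obtain ⟨χ, h6, -⟩ := h5.symm.withLegs L
  rw [← h3.cls_mem hP, ← h6.cls_mem hP]
  refine hS _ ?_
  rw [h3.numLegs_eq, h6.numLegs_eq, numLegs_withLegs,
    numLegs_of_not_isUnivalent not_isUnivalent_tetrahedron, zero_add]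

end JacobiDiagram

namespace JacobiDiagram

variable {D D' B B' Γ : JacobiDiagram}

/-! ### Reduction of three-loop graphs to the tetrahedron -/

/-- By the IHX relation at the edge of `h`, a graph with legs lies in the submodule `S n` for its
number `n` of legs, provided that "H" and "X" with any legs do. -/
theorem cls_withLegs_mem_of_ihx (hB : B.IsLoop 3) {h : Fin B.card} (hh : B.IsInner h)
    {S : ℕ → Submodule ℚ (Space (loopDiagrams 3) allSites)}
    (hH : ∀ L, cls (loopDiagrams 3) allSites ((B.diagramH h).withLegs L) ∈ S L.length)
    (hX : ∀ L, cls (loopDiagrams 3) allSites ((B.diagramX h).withLegs L) ∈ S L.length)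
    (L : List (Fin B.card)) : cls (loopDiagrams 3) allSites (B.withLegs L) ∈ S L.length := by
  -- the relation needs an edge without legs, so that the legs on the edge of `h` are moved to the
  -- adjacent edges first
  induction hn : L.countP (fun b => b = h ∨ b = B.edge h) generalizing L with
  | zero =>
    simp only [List.countP_eq_zero, decide_eq_true_eq, not_or] at hn
    rw [cls_withLegs_ihx hB hh (fun h' => (hn _ h').1 rfl) (fun h' => (hn _ h').2 rfl)]
    refine sub_mem ?_ ?_
    · have := hH (L.map (B.equivH h)); rwa [List.length_map] at this
    · have := hX (L.map (B.equivX h)); rwa [List.length_map] at this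
  | succ n ih =>
    obtain ⟨b, hb, hb'⟩ := List.countP_pos_iff.1 (n.succ_pos.trans_eq hn.symm)
    rw [decide_eq_true_eq] at hb'
    have hp := List.perm_cons_erase hb
    rw [isGood_loopDiagrams.cls_withLegs_perm hp, hp.length_eq]
    have hf := (isGood_loopDiagrams.isFlow_cls_attach
      (isGood_loopDiagrams.withLegs_mem hB (L.erase b))).base (L.erase b)
    have hbu : ¬ B.IsUnivalent b := by
      rcases hb' with rfl | rfl
      exacts [hh.1, hh.2.1]
    have hv := hf.vertex b hbu
    rw [add_assoc] at hv
    rw [hp.countP_eq, List.countP_cons_of_pos (by simpa using hb')] at hn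
    have hnd := hh.nodup
    have key : ∀ c, c ≠ h → c ≠ B.edge h →
        cls (loopDiagrams 3) allSites (B.withLegs (c :: L.erase b)) ∈
          S (b :: L.erase b).length := by
      intro c h1 h2
      refine ih (c :: L.erase b) ?_
      rw [List.countP_cons_of_neg (by simp [h1, h2])]
      omega
    have e : cls (loopDiagrams 3) allSites (B.withLegs (b :: L.erase b)) = _ :=
      eq_neg_of_add_eq_zero_left hv
    rw [e]
    refine neg_mem (add_mem (key _ ?_ ?_) (key _ ?_ ?_)) <;> rcases hb' with rfl | rfl <;>
      (simp at hnd; grind)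

/-- A map from the tetrahedron to a trivalent three-loop graph which respects the edges and is an
isomorphism near every vertex is an isomorphism of graphs: it is surjective as the graph is
connected, and both graphs have twelve half-edges. -/
theorem exists_graphIso_tetrahedron (hB : B.IsLoop 3) (hu : ∀ b, ¬ B.IsUnivalent b)
    (f : Fin tetrahedron.card → Fin B.card)
    (he : ∀ k, f (tetrahedron.edge k) = B.edge (f k))
    (hr : ∀ k, f (tetrahedron.rot k) = B.rot (f k) ∨ f (tetrahedron.rot k) = B.rot (B.rot (f k))) :
    ∃ φ, GraphIso tetrahedron B φ := by
  have hs : Function.Surjective f := by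
    have k₀ : Fin tetrahedron.card := (0 : Fin 12)
    intro y
    refine (isConnected_iff.1 (isLoop_three_iff.1 hB).1).2 (fun y => ∃ k, f k = y) ?_ ?_ (f k₀) y
      ⟨k₀, rfl⟩
    · rintro _ ⟨k, rfl⟩
      have h1 := hr k
      have h2 := hr (tetrahedron.rot k)
      have h3 := hr (tetrahedron.rot (tetrahedron.rot k))
      rw [rot_cube] at h3
      have h4 := hu (f k)
      rw [IsUnivalent] at h4
      have h5 := B.rot_cube (f k)
      have h6 := mt (rot_sq_eq_iff (f k)).1 h4
      rcases h1 with h1 | h1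
      · exact ⟨_, h1⟩
      · refine ⟨tetrahedron.rot (tetrahedron.rot k), ?_⟩
        rw [h1, h5] at h2
        rcases h2 with h2 | h2
        · rw [h2] at h3
          exact absurd h3 (by rintro (h | h); exacts [h4 h.symm, h6 h.symm])
        · exact h2
    · rintro _ ⟨k, rfl⟩
      exact ⟨_, he k⟩
  have hc : Fintype.card (Fin tetrahedron.card) = Fintype.card (Fin B.card) := by
    rw [Fintype.card_fin, Fintype.card_fin, (isLoop_three_iff.1 hB).2,
      numLegs_of_not_isUnivalent hu]
    rfl
  exact ⟨Equiv.ofBijective f ((Fintype.bijective_iff_surjective_and_card f).2 ⟨hs, hc⟩), he, hr⟩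

/-- The vertices of a trivalent three-loop graph, numbered. -/
theorem exists_vertex_numbering (hB : B.IsLoop 3) (hu : ∀ b, ¬ B.IsUnivalent b) :
    ∃ v : Fin B.card → Fin 4, Function.Surjective v ∧ ∀ x y, v x = v y ↔ B.rot.SameCycle x y := by
  have h1 := B.three_mul_numVertices
  rw [(isLoop_three_iff.1 hB).2, numLegs_of_not_isUnivalent hu] at h1
  have h2 : Nat.card (Quotient (Equiv.Perm.SameCycle.setoid B.rot)) = 4 := by
    rw [numVertices] at h1; omega
  obtain ⟨e⟩ : Nonempty (Quotient (Equiv.Perm.SameCycle.setoid B.rot) ≃ Fin 4) :=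
    Finite.card_eq.1 (by rw [h2, Nat.card_fin])
  refine ⟨fun x => e (Quotient.mk _ x), e.surjective.comp Quotient.mk_surjective, fun x y => ?_⟩
  rw [e.injective.eq_iff, Quotient.eq]
  exact Iff.rfl

theorem rot_cases_of_sameCycle {p q r : Fin B.card} (h1 : B.rot.SameCycle p q)
    (h2 : B.rot.SameCycle p r) (h3 : p ≠ q) (h4 : p ≠ r) (h5 : q ≠ r) :
    (B.rot p = q ∧ B.rot q = r ∧ B.rot r = p) ∨ (B.rot p = r ∧ B.rot r = q ∧ B.rot q = p) := by
  have := B.rot_cube p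
  rw [sameCycle_rot_iff] at h1 h2
  grind

/-- The vertices `s k` and `t k` of the tetrahedron at the two ends of the edge of a half-edge `k`. -/
theorem exists_ends_tetrahedron : ∃ s t : Fin tetrahedron.card → Fin 4, (∀ k, s k ≠ t k) ∧
    (∀ k, s (tetrahedron.edge k) = t k ∧ t (tetrahedron.edge k) = s k) ∧
    ∀ k, s (tetrahedron.rot k) = s k ∧ t (tetrahedron.rot k) ≠ t k := by
  have : ∃ s t : Fin 12 → Fin 4, (∀ k : Fin 12, s k ≠ t k) ∧
      (∀ k : Fin 12, s (tetrahedron.edge k) = t k ∧ t (tetrahedron.edge k) = s k) ∧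
      ∀ k : Fin 12, s (tetrahedron.rot k) = s k ∧ t (tetrahedron.rot k) ≠ t k :=
    ⟨![0, 0, 0, 1, 1, 1, 2, 2, 2, 3, 3, 3], ![1, 2, 3, 0, 2, 3, 0, 1, 3, 0, 1, 2],
      by decide, by decide, by decide⟩
  exact this

/-- A trivalent three-loop graph without loops or double edges is the tetrahedron. -/
theorem exists_graphIso_tetrahedron_of_simple (hB : B.IsLoop 3) (hu : ∀ b, ¬ B.IsUnivalent b)
    (hs : ∀ x y, B.rot.SameCycle x y → B.rot.SameCycle (B.edge x) (B.edge y) → x = y) :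
    ∃ φ, GraphIso tetrahedron B φ := by
  obtain ⟨v, -, hv⟩ := exists_vertex_numbering hB hu
  have hl : ∀ x, v x ≠ v (B.edge x) := fun x hx => by
    rw [hv] at hx
    exact B.edge_ne x (hs _ _ hx (by simpa using hx.symm)).symm
  let T := {p : Fin 4 × Fin 4 // p.1 ≠ p.2}
  let P : Fin B.card → T := fun x => ⟨(v x, v (B.edge x)), hl x⟩
  have hP : Function.Injective P := fun x y h => by
    have h' := congrArg Subtype.val h
    simp only [P, Prod.mk.injEq, hv] at h'
    exact hs x y h'.1 h'.2
  have hc : Fintype.card (Fin B.card) = Fintype.card T := by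
    rw [Fintype.card_fin, (isLoop_three_iff.1 hB).2, numLegs_of_not_isUnivalent hu]
    rfl
  let e : Fin B.card ≃ T := Equiv.ofBijective P ((Fintype.bijective_iff_injective_and_card P).2
    ⟨hP, hc⟩)
  have e_edge : ∀ x, e (B.edge x) = ⟨((e x).1.2, (e x).1.1), (e x).2.symm⟩ := fun x =>
    Subtype.ext (Prod.ext rfl (congrArg v (B.edge_edge x)))
  obtain ⟨s, t, hst, h1, h2⟩ := exists_ends_tetrahedron
  let f : Fin tetrahedron.card → Fin B.card := fun k => e.symm ⟨(s k, t k), hst k⟩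
  have hf : ∀ k, v (f k) = s k ∧ v (B.edge (f k)) = t k := fun k => by
    have := congrArg Subtype.val (e.apply_symm_apply ⟨(s k, t k), hst k⟩)
    exact Prod.ext_iff.1 this
  refine exists_graphIso_tetrahedron hB hu f (fun k => ?_) fun k => ?_
  · refine e.injective ?_
    rw [e_edge]
    simp only [f, Equiv.apply_symm_apply]
    exact Subtype.ext (Prod.ext (h1 k).1 (h1 k).2)
  · have h3 : v (f k) = v (f (tetrahedron.rot k)) := by rw [(hf _).1, (hf _).1, (h2 k).1]
    rw [hv, sameCycle_rot_iff] at h3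
    refine h3.resolve_left fun h => (h2 k).2 ?_
    rw [← (hf _).2, ← (hf _).2, h]

/-- There is only one vertex different from three given ones. -/
theorem fourth : ∀ p q r x y : Fin 4, p ≠ q → p ≠ r → q ≠ r → x ≠ p → x ≠ q → x ≠ r →
    y ≠ p → y ≠ q → y ≠ r → x = y := by
  decide

/-- A vertex different from the fourth one is one of the three given ones. -/
theorem fourth' : ∀ p q r x y : Fin 4, p ≠ q → p ≠ r → q ≠ r → x ≠ p → x ≠ q → x ≠ r →
    y ≠ x → y = p ∨ y = q ∨ y = r := by
  decide

/-- The edges of a graph without loops near a double edge. The double edge joins the vertex of `h` to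
a second vertex, whose remaining half-edge is `z`. The other end of `h` is a third vertex, with
half-edges `edge h`, `c` and `d`, and the edges of `c`, `d` and `z` all lead to the fourth
vertex. -/
theorem bigon_structure (hB : B.IsLoop 3) (hu : ∀ b, ¬ B.IsUnivalent b)
    (hl : ∀ x, ¬ B.rot.SameCycle x (B.edge x)) {h c d : Fin B.card}
    (hb : B.rot.SameCycle (B.edge (B.rot h)) (B.edge (B.rot (B.rot h))))
    (hc : B.rot.SameCycle (B.edge h) c) (hd : B.rot.SameCycle (B.edge h) d)
    (h1 : c ≠ B.edge h) (h2 : d ≠ B.edge h) (h3 : c ≠ d) :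
    ∃ z, B.rot.SameCycle (B.edge (B.rot h)) z ∧ z ≠ B.edge (B.rot h) ∧
      z ≠ B.edge (B.rot (B.rot h)) ∧ B.rot.SameCycle (B.edge c) (B.edge d) ∧
      B.rot.SameCycle (B.edge c) (B.edge z) ∧ z ≠ c ∧ z ≠ d ∧
      ¬ B.rot.SameCycle h (B.edge (B.rot h)) ∧ ¬ B.rot.SameCycle (B.edge h) (B.edge (B.rot h)) ∧
      ¬ B.rot.SameCycle h (B.edge c) ∧ ¬ B.rot.SameCycle (B.edge h) (B.edge c) := by
  obtain ⟨v, -, hv⟩ := exists_vertex_numbering hB hu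
  obtain ⟨a, ha⟩ : ∃ a, B.rot h = a := ⟨_, rfl⟩
  obtain ⟨b, hb'⟩ : ∃ b, B.rot a = b := ⟨_, rfl⟩
  have hbh : B.rot b = h := by rw [← hb', ← ha, rot_cube]
  have hu' : ∀ x, B.rot x ≠ x := hu
  have hu2 : ∀ x, B.rot (B.rot x) ≠ x := fun x => mt (rot_sq_eq_iff x).1 (hu x)
  have ee := B.edge_edge
  have mem := fun x y : Fin B.card => (hv x y).trans sameCycle_rot_iff
  simp only [← hv] at *
  rw [ha, hb'] at hb ⊢
  clear hv
  obtain ⟨z, hz, hz1, hz2⟩ : ∃ z, v (B.edge a) = v z ∧ z ≠ B.edge a ∧ z ≠ B.edge b := by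
    have := hu' (B.edge a)
    have := hu2 (B.edge a)
    rcases (mem _ _).1 hb with h | h | h
    · exact absurd (B.edge.injective h) (by rw [← hb']; exact hu' a)
    · exact ⟨B.rot (B.rot (B.edge a)), (mem _ _).2 (by simp), hu2 _, by rw [h]; exact hu' _⟩
    · exact ⟨B.rot (B.edge a), (mem _ _).2 (by simp), hu' _, by rw [h]; exact (hu' _).symm⟩
  have s_h : ∀ y, v h = v y ↔ y = h ∨ y = a ∨ y = b := fun y => by rw [mem, ha, hb']
  have third : ∀ p q r : Fin B.card, v p = v q → v p = v r → p ≠ q → p ≠ r → q ≠ r →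
      ∀ y, v p = v y ↔ y = p ∨ y = q ∨ y = r := by
    intro p q r m1 m2 m3 m4 m5 y
    rw [mem] at m1 m2 ⊢
    grind
  have nab : a ≠ b := hb' ▸ (hu' a).symm
  have s_s := third (B.edge h) c d hc hd h1.symm h2.symm h3
  have s_w := third (B.edge a) (B.edge b) z hb hz (fun h => nab (B.edge.injective h)) hz1.symm
    hz2.symm
  have va : v h = v a := (s_h a).2 (by simp)
  have vb : v h = v b := (s_h b).2 (by simp)
  have n1 : v h ≠ v (B.edge a) := va ▸ hl a
  have n2 : v h ≠ v (B.edge h) := hl h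
  have nha : h ≠ a := ha ▸ (hu' h).symm
  have nhb : h ≠ b := hbh ▸ (hu' b)
  have n3 : v (B.edge a) ≠ v (B.edge h) := by
    -- otherwise two vertices would form a connected component
    intro hws
    have hz' : B.edge h = z := by
      rcases (s_w _).1 hws with h | h | h
      · exact absurd (B.edge.injective h) nha
      · exact absurd (B.edge.injective h) nhb
      · exact h
    refine hB.not_closed (S := {h, a, b, B.edge a, B.edge b, z}) (x := h) ?_ (by simp) ?_ ?_
    · exact Finset.card_le_six.trans_lt (by norm_num)
    · have hrot : ∀ x, v x = v (B.rot x) := fun x => (mem _ _).2 (by simp)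
      intro y hy
      simp only [Finset.mem_insert, Finset.mem_singleton] at hy ⊢
      have hy' : v h = v y ∨ v (B.edge a) = v y := by
        rw [s_h, s_w]
        rcases hy with h | h | h | h | h | h <;> simp only [h, true_or, or_true]
      rw [hrot y, s_h, s_w] at hy'
      rcases hy' with (h | h | h) | (h | h | h) <;> simp only [h, true_or, or_true]
    · intro y hy
      simp only [Finset.mem_insert, Finset.mem_singleton] at hy ⊢
      have hz'' : B.edge z = h := by rw [← hz', ee]
      rcases hy with h | h | h | h | h | h <;> rw [h] <;> simp [hz', hz'']
  -- if `c` were joined to `z`, no free half-edges would be left for the fourth vertex except `d`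
  have inj : ∀ x y, B.edge x = y → x = B.edge y := fun x y => (edge_eq_comm x y).1
  have key : ∀ c d : Fin B.card, (∀ y, v (B.edge h) = v y ↔ y = B.edge h ∨ y = c ∨ y = d) →
      c ≠ B.edge h → d ≠ B.edge h → c ≠ d → B.edge c ≠ z := by
    intro c d s_s h1 h2 h3 hcz
    have vc : v (B.edge h) = v c := (s_s c).2 (by simp)
    have vd : v (B.edge h) = v d := (s_s d).2 (by simp)
    have hrot : ∀ x, v x = v (B.rot x) := fun x => (mem _ _).2 (by simp)
    have g1 : v h ≠ v (B.edge d) := by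
      rw [Ne, s_h]; rintro (h | h | h) <;> have := inj _ _ h <;> grind
    have g2 : v (B.edge h) ≠ v (B.edge d) := by rw [vd]; exact hl d
    have g3 : v (B.edge a) ≠ v (B.edge d) := by
      rw [Ne, s_w]; rintro (h | h | h) <;> have := inj _ _ h <;> grind
    have g4 : ∀ y, v (B.edge d) = v y → v (B.edge y) = v (B.edge h) ∨ v (B.edge y) = v h ∨
        v (B.edge y) = v (B.edge a) := by
      intro y hy
      have := hl y
      rw [← hy] at this
      exact fourth' _ _ _ _ _ n2.symm n3.symm n1 g2.symm g1.symm g3.symm (Ne.symm this)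
    have g5 := hrot (B.edge d)
    rcases g4 _ g5 with h | h | h
    · rcases (s_s _).1 h.symm with h | h | h <;> have := inj _ _ h <;> grind
    · rcases (s_h _).1 h.symm with h | h | h <;> have := inj _ _ h <;> grind
    · rcases (s_w _).1 h.symm with h | h | h <;> have := inj _ _ h <;> grind
  have kc := key c d s_s h1 h2 h3
  have kd := key d c (fun y => (s_s y).trans (by tauto)) h2 h1 h3.symm
  have far : ∀ c, v (B.edge h) = v c → c ≠ B.edge h → B.edge c ≠ z →
      v h ≠ v (B.edge c) ∧ v (B.edge h) ≠ v (B.edge c) ∧ v (B.edge a) ≠ v (B.edge c) := by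
    intro c hc h1 kc
    refine ⟨?_, hc ▸ hl c, ?_⟩
    · rw [Ne, s_h]; rintro (h | h | h) <;> have := inj _ _ h <;> grind
    · rw [Ne, s_w]; rintro (h | h | h) <;> have := inj _ _ h <;> grind
  have fc := far c hc h1 kc
  have fd := far d hd h2 kd
  have fz : v h ≠ v (B.edge z) ∧ v (B.edge h) ≠ v (B.edge z) ∧ v (B.edge a) ≠ v (B.edge z) := by
    refine ⟨?_, ?_, hz ▸ hl z⟩
    · rw [Ne, s_h]; rintro (h | h | h) <;> have := inj _ _ h <;> grind
    · rw [Ne, s_s]; rintro (h | h | h) <;> have := inj _ _ h <;> grind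
  refine ⟨z, hz, hz1, hz2, fourth _ _ _ _ _ n1 n2 n3 fc.1.symm fc.2.2.symm fc.2.1.symm fd.1.symm
    fd.2.2.symm fd.2.1.symm, fourth _ _ _ _ _ n1 n2 n3 fc.1.symm fc.2.2.symm fc.2.1.symm fz.1.symm
    fz.2.2.symm fz.2.1.symm, ?_, ?_, n1, n3.symm, fc.1, fc.2.1⟩
  · rintro rfl; exact n3 (hz.trans hc.symm)
  · rintro rfl; exact n3 (hz.trans hd.symm)

/-- The graphs "H" and "X" at the edge of `h` next to a double edge are tetrahedra. Both arise from
`B` by replacing the vertices of `h` and `edge h` by `(h b c)` and `(edge h, d, a)`, where `(h a b)`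
is the vertex of `h` and `c`, `d` are the other half-edges at `edge h`, in one of the two orders. -/
theorem exists_graphIso_tetrahedron_of_bigon (hB : B.IsLoop 3) (hu : ∀ b, ¬ B.IsUnivalent b)
    (hl : ∀ x, ¬ B.rot.SameCycle x (B.edge x)) {h c d : Fin B.card}
    (hb : B.rot.SameCycle (B.edge (B.rot h)) (B.edge (B.rot (B.rot h))))
    (hc : B.rot.SameCycle (B.edge h) c) (hd : B.rot.SameCycle (B.edge h) d)
    (h1 : c ≠ B.edge h) (h2 : d ≠ B.edge h) (h3 : c ≠ d) (hB' : B'.IsLoop 3)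
    (hu' : ∀ b, ¬ B'.IsUnivalent b) (ψ : Fin B.card ≃ Fin B'.card)
    (he : ∀ x, B'.edge (ψ x) = ψ (B.edge x))
    (hr1 : B'.rot (ψ h) = ψ (B.rot (B.rot h))) (hr2 : B'.rot (ψ (B.rot (B.rot h))) = ψ c)
    (hr3 : B'.rot (ψ (B.edge h)) = ψ d) (hr4 : B'.rot (ψ d) = ψ (B.rot h))
    (hr : ∀ x, ¬ B.rot.SameCycle h x → ¬ B.rot.SameCycle (B.edge h) x →
      B'.rot (ψ x) = ψ (B.rot x)) : ∃ φ, GraphIso tetrahedron B' φ := by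
  obtain ⟨z, a1, a2, a3, a4, a5, a6, a7, a8, a9, a10, a11⟩ :=
    bigon_structure hB hu hl hb hc hd h1 h2 h3
  have c1 := B'.rot_cube (ψ h)
  rw [hr1, hr2] at c1
  have c2 := B'.rot_cube (ψ (B.edge h))
  rw [hr3, hr4] at c2
  have nab : B.rot h ≠ B.rot (B.rot h) := fun h' => hu (B.rot h) h'.symm
  have w := rot_cases_of_sameCycle hb a1 (fun h' => nab (B.edge.injective h')) a2.symm a3.symm
  have t := rot_cases_of_sameCycle a4 a5 (fun h' => h3 (B.edge.injective h'))
    (fun h' => a6 (B.edge.injective h').symm) (fun h' => a7 (B.edge.injective h').symm)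
  have far : ∀ p, ¬ B.rot.SameCycle h p → ¬ B.rot.SameCycle (B.edge h) p → ∀ q,
      B.rot.SameCycle p q → B'.rot (ψ q) = ψ (B.rot q) := fun p g1 g2 q g3 =>
    hr q (fun g => g1 (g.trans g3.symm)) (fun g => g2 (g.trans g3.symm))
  have w1 := far _ a8 a9 _ (Equiv.Perm.SameCycle.refl _ _)
  have w2 := far _ a8 a9 _ hb
  have w3 := far _ a8 a9 _ a1
  have t1 := far _ a10 a11 _ (Equiv.Perm.SameCycle.refl _ _)
  have t2 := far _ a10 a11 _ a4
  have t3 := far _ a10 a11 _ a5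
  -- the vertices are `(h b c)`, `(h' d a)`, the second end of the double edge, and the fourth one
  let f : Fin 12 → Fin B.card := ![h, B.rot (B.rot h), c, B.edge h, B.rot h, d,
    B.edge (B.rot (B.rot h)), B.edge (B.rot h), z, B.edge c, B.edge d, B.edge z]
  refine exists_graphIso_tetrahedron hB' hu' (fun k => ψ (f k)) (fun k => ?_) (fun k => ?_)
  · rw [he]
    refine congrArg ψ ?_
    have ee := B.edge_edge
    change f (tetrahedron.edge k) = B.edge (f k)
    revert k
    change ∀ k : Fin 12, f (tetrahedron.edge k) = B.edge (f k)
    intro k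
    fin_cases k <;> first | rfl | exact (ee _).symm
  · revert k
    change ∀ k : Fin 12, ψ (f (tetrahedron.rot k)) = B'.rot (ψ (f k)) ∨
      ψ (f (tetrahedron.rot k)) = B'.rot (B'.rot (ψ (f k)))
    have v0 : ∀ p q r : Fin B.card, B'.rot (ψ p) = ψ q → B'.rot (ψ q) = ψ r → B'.rot (ψ r) = ψ p →
        (ψ q = B'.rot (ψ p) ∨ ψ q = B'.rot (B'.rot (ψ p))) ∧
        (ψ r = B'.rot (ψ q) ∨ ψ r = B'.rot (B'.rot (ψ q))) ∧
        (ψ p = B'.rot (ψ r) ∨ ψ p = B'.rot (B'.rot (ψ r))) := fun p q r e1 e2 e3 =>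
      ⟨.inl e1.symm, .inl e2.symm, .inl e3.symm⟩
    have v1 : ∀ p q r : Fin B.card, B'.rot (ψ p) = ψ r → B'.rot (ψ r) = ψ q → B'.rot (ψ q) = ψ p →
        (ψ q = B'.rot (ψ p) ∨ ψ q = B'.rot (B'.rot (ψ p))) ∧
        (ψ r = B'.rot (ψ q) ∨ ψ r = B'.rot (B'.rot (ψ q))) ∧
        (ψ p = B'.rot (ψ r) ∨ ψ p = B'.rot (B'.rot (ψ r))) := fun p q r e1 e2 e3 =>
      ⟨.inr (by rw [e1, e2]), .inr (by rw [e3, e1]), .inr (by rw [e2, e3])⟩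
    have m0 := v0 _ _ _ hr1 hr2 c1
    have m1 := v1 _ _ _ hr3 hr4 c2
    have m2 : (ψ (B.edge (B.rot h)) = B'.rot (ψ (B.edge (B.rot (B.rot h)))) ∨
          ψ (B.edge (B.rot h)) = B'.rot (B'.rot (ψ (B.edge (B.rot (B.rot h)))))) ∧
        (ψ z = B'.rot (ψ (B.edge (B.rot h))) ∨ ψ z = B'.rot (B'.rot (ψ (B.edge (B.rot h))))) ∧
        (ψ (B.edge (B.rot (B.rot h))) = B'.rot (ψ z) ∨
          ψ (B.edge (B.rot (B.rot h))) = B'.rot (B'.rot (ψ z))) := by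
      rcases w with ⟨e1, e2, e3⟩ | ⟨e1, e2, e3⟩
      · exact v1 _ _ _ (by rw [w2, e2]) (by rw [w3, e3]) (by rw [w1, e1])
      · exact v0 _ _ _ (by rw [w2, e3]) (by rw [w1, e1]) (by rw [w3, e2])
    have m3 : (ψ (B.edge d) = B'.rot (ψ (B.edge c)) ∨
          ψ (B.edge d) = B'.rot (B'.rot (ψ (B.edge c)))) ∧
        (ψ (B.edge z) = B'.rot (ψ (B.edge d)) ∨ ψ (B.edge z) = B'.rot (B'.rot (ψ (B.edge d)))) ∧
        (ψ (B.edge c) = B'.rot (ψ (B.edge z)) ∨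
          ψ (B.edge c) = B'.rot (B'.rot (ψ (B.edge z)))) := by
      rcases t with ⟨e1, e2, e3⟩ | ⟨e1, e2, e3⟩
      · exact v0 _ _ _ (by rw [t1, e1]) (by rw [t2, e2]) (by rw [t3, e3])
      · exact v1 _ _ _ (by rw [t1, e1]) (by rw [t3, e2]) (by rw [t2, e3])
    intro k
    fin_cases k
    exacts [m0.1, m0.2.1, m0.2.2, m1.1, m1.2.1, m1.2.2, m2.1, m2.2.1, m2.2.2, m3.1, m3.2.1, m3.2.2]

/-- The half-edges of the loops. -/
noncomputable def loopHalfEdges (B : JacobiDiagram) : Finset (Fin B.card) := by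
  classical exact Finset.univ.filter fun x => B.rot.SameCycle x (B.edge x)

theorem mem_loopHalfEdges {x : Fin B.card} :
    x ∈ B.loopHalfEdges ↔ B.rot.SameCycle x (B.edge x) := by
  simp [loopHalfEdges]

/-- Removing the edge at a loop and joining its ends in another way destroys the loop. -/
theorem card_loopHalfEdges_lt {h c d : Fin B.card} (hh : B.IsInner h)
    (hab : B.edge (B.rot h) = B.rot (B.rot h))
    (hcd : (c = B.rot (B.edge h) ∧ d = B.rot (B.rot (B.edge h))) ∨
      (d = B.rot (B.edge h) ∧ c = B.rot (B.rot (B.edge h))))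
    (ψ : Fin B.card ≃ Fin B'.card) (he : ∀ x, B'.edge (ψ x) = ψ (B.edge x))
    (hr1 : B'.rot (ψ h) = ψ (B.rot (B.rot h))) (hr2 : B'.rot (ψ (B.rot (B.rot h))) = ψ c)
    (hr3 : B'.rot (ψ (B.edge h)) = ψ d) (hr4 : B'.rot (ψ d) = ψ (B.rot h))
    (hr : ∀ x, ¬ B.rot.SameCycle h x → ¬ B.rot.SameCycle (B.edge h) x →
      B'.rot (ψ x) = ψ (B.rot x)) : B'.loopHalfEdges.card < B.loopHalfEdges.card := by
  have hn := hh.nodup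
  have c1 := B'.rot_cube (ψ h)
  rw [hr1, hr2] at c1
  have c2 := B'.rot_cube (ψ (B.edge h))
  rw [hr3, hr4] at c2
  have q1 := B.rot_cube h
  have q2 := B.rot_cube (B.edge h)
  have hba : B.edge (B.rot (B.rot h)) = B.rot h := by rw [← hab, edge_edge]
  have ee := B.edge_edge h
  have key : ∀ y, B'.rot.SameCycle (ψ y) (B'.edge (ψ y)) →
      B.rot.SameCycle y (B.edge y) ∧ y ≠ B.rot h := by
    intro y hy
    rw [he] at hy
    simp only [sameCycle_rot_iff] at hy hr ⊢
    by_cases g1 : y = h ∨ y = B.rot h ∨ y = B.rot (B.rot h)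
    · exfalso
      simp only [List.nodup_cons, List.mem_cons, List.not_mem_nil, or_false, not_or] at hn
      rcases g1 with rfl | rfl | rfl <;>
        simp only [hr1, hr2, hr3, hr4, c1, c2, hab, hba, ψ.injective.eq_iff] at hy <;> grind
    by_cases g2 : y = B.edge h ∨ y = c ∨ y = d
    · exfalso
      have ey := B.edge_edge y
      have en := B.edge_ne y
      clear hr he
      simp only [List.nodup_cons, List.mem_cons, List.not_mem_nil, or_false, not_or] at hn
      rcases g2 with rfl | rfl | rfl <;>
        simp only [hr1, hr2, hr3, hr4, c1, c2, hab, hba, ψ.injective.eq_iff] at hy <;> grind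
    · have g3 : ¬ (y = B.edge h ∨ y = B.rot (B.edge h) ∨ y = B.rot (B.rot (B.edge h))) := by
        rcases hcd with ⟨rfl, rfl⟩ | ⟨rfl, rfl⟩
        · exact g2
        · rwa [or_comm (a := y = B.rot (B.edge h))]
      have n1 : ∀ z, (¬ (y = z ∨ y = B.rot z ∨ y = B.rot (B.rot z))) →
          ¬ (B.rot y = z ∨ B.rot y = B.rot z ∨ B.rot y = B.rot (B.rot z)) := by
        intro z hz h'
        rw [B.rot.injective.eq_iff, B.rot.injective.eq_iff] at h'
        refine hz (h'.elim (fun h' => .inr (.inr ?_)) (fun h' => h'.imp_right .inl))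
        rw [← h', rot_cube]
      rw [hr y g1 g3, hr _ (n1 _ g1) (n1 _ g3)] at hy
      simp only [ψ.injective.eq_iff] at hy
      exact ⟨hy, fun h' => g1 (.inr (.inl h'))⟩
  have hsub : B'.loopHalfEdges.map ψ.symm.toEmbedding ⊆ B.loopHalfEdges.erase (B.rot h) := by
    intro y hy
    rw [Finset.mem_map_equiv, Equiv.symm_symm, mem_loopHalfEdges] at hy
    rw [Finset.mem_erase, mem_loopHalfEdges]
    exact (key y hy).symm
  have hmem : B.rot h ∈ B.loopHalfEdges := by
    rw [mem_loopHalfEdges, hab, sameCycle_rot_iff]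
    exact .inr (.inl rfl)
  calc B'.loopHalfEdges.card = _ := (Finset.card_map _).symm
    _ ≤ _ := Finset.card_le_card hsub
    _ < _ := Finset.card_erase_lt_of_mem hmem

theorem not_isUnivalent_reattach {τ} (hu : ∀ b, ¬ B.IsUnivalent b) (b) :
    ¬ (B.reattach τ).IsUnivalent b := by
  obtain ⟨y, rfl⟩ := (τ.trans (B.reattachEquiv τ)).surjective b
  exact (isUnivalent_reattach τ y).not.2 (hu y)

/-- Modulo IHX, every three-loop graph with legs is a combination of tetrahedra with as many
legs. -/
theorem cls_withLegs_mem {S : ℕ → Submodule ℚ (Space (loopDiagrams 3) allSites)}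
    (hS : ∀ L : List (Fin tetrahedron.card),
      cls (loopDiagrams 3) allSites (tetrahedron.withLegs L) ∈ S L.length)
    (hB : B.IsLoop 3) (hu : ∀ b, ¬ B.IsUnivalent b) (L : List (Fin B.card)) :
    cls (loopDiagrams 3) allSites (B.withLegs L) ∈ S L.length := by
  have hiso : ∀ {B' : JacobiDiagram}, (∃ φ, GraphIso tetrahedron B' φ) →
      ∀ L : List (Fin B'.card), cls (loopDiagrams 3) allSites (B'.withLegs L) ∈ S L.length := by
    rintro B' ⟨φ, hφ⟩ L
    obtain ⟨χ, h1, -⟩ := hφ.symm.withLegs L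
    rw [← h1.cls_mem isGood_loopDiagrams]
    have := hS (L.map φ.symm)
    rwa [List.length_map] at this
  -- induction on the number of loops: removing the edge next to a loop destroys the loop, and in a
  -- graph without loops removing the edge next to a double edge leads to the tetrahedron
  induction hn : B.loopHalfEdges.card using Nat.strong_induction_on generalizing B with
  | _ n ih =>
  have rsc := fun x : Fin B.card => B.rot_cube x
  by_cases hl : ∃ x, B.rot.SameCycle x (B.edge x)
  · -- the third half-edge at a loop
    obtain ⟨h, hab⟩ : ∃ h, B.edge (B.rot h) = B.rot (B.rot h) := by
      obtain ⟨x, hx⟩ := hl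
      rcases sameCycle_rot_iff.1 hx with hx | hx | hx
      · exact absurd hx (B.edge_ne x)
      · exact ⟨B.rot (B.rot x), by rw [rsc, hx]⟩
      · exact ⟨B.rot x, by rw [← hx, edge_edge, hx, rsc]⟩
    have hba : B.edge (B.rot (B.rot h)) = B.rot h := by rw [← hab, edge_edge]
    have hh : B.IsInner h := by
      refine ⟨hu _, hu _, fun h' => ?_⟩
      rcases sameCycle_rot_iff.1 h' with h' | h' | h'
      · exact B.edge_ne h h'
      · exact hu h ((rot_sq_eq_iff h).1 (by rw [← hab, ← h', edge_edge]))
      · exact hu h (by rw [IsUnivalent, ← hba, ← h', edge_edge])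
    obtain ⟨r1, r2, r3, r4, r5, r6⟩ := rot_equivH_vertices hh
    obtain ⟨s1, s2, s3, s4, s5, s6⟩ := rot_equivX_vertices hh
    refine cls_withLegs_mem_of_ihx hB hh (fun L => ih _ ?_ (isLoop_diagramH hh hB)
      (not_isUnivalent_reattach hu) L rfl) (fun L => ih _ ?_ (isLoop_diagramX hh hB)
      (not_isUnivalent_reattach hu) L rfl) L
    · rw [← hn]
      exact card_loopHalfEdges_lt hh hab (.inl ⟨rfl, rfl⟩) (B.equivH h) (fun _ => rfl)
        r1 r2 r4 r5 fun x => rot_equivH_of_notMem hh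
    · rw [← hn]
      exact card_loopHalfEdges_lt hh hab (.inr ⟨rfl, rfl⟩) (B.equivX h) (fun _ => rfl)
        s1 s2 s4 s5 fun x => rot_equivX_of_notMem hh
  push Not at hl
  by_cases hs : ∀ x y, B.rot.SameCycle x y → B.rot.SameCycle (B.edge x) (B.edge y) → x = y
  · exact hiso (exists_graphIso_tetrahedron_of_simple hB hu hs) L
  push Not at hs
  -- the third half-edge at a double edge
  obtain ⟨h, hb⟩ : ∃ h, B.rot.SameCycle (B.edge (B.rot h)) (B.edge (B.rot (B.rot h))) := by
    obtain ⟨x, y, h1, h2, h3⟩ := hs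
    rcases sameCycle_rot_iff.1 h1 with h4 | h4 | h4
    · exact absurd h4.symm h3
    · exact ⟨B.rot (B.rot x), by rwa [rsc, ← h4]⟩
    · exact ⟨B.rot x, by rw [← h4, h4, rsc, ← h4]; exact h2.symm⟩
  have hh : B.IsInner h := ⟨hu _, hu _, hl h⟩
  obtain ⟨r1, r2, r3, r4, r5, r6⟩ := rot_equivH_vertices hh
  obtain ⟨s1, s2, s3, s4, s5, s6⟩ := rot_equivX_vertices hh
  have m1 : B.rot.SameCycle (B.edge h) (B.rot (B.edge h)) := sameCycle_rot_iff.2 (by simp)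
  have m2 : B.rot.SameCycle (B.edge h) (B.rot (B.rot (B.edge h))) :=
    sameCycle_rot_iff.2 (by simp)
  have n1 : B.rot (B.edge h) ≠ B.edge h := hu _
  have n2 : B.rot (B.rot (B.edge h)) ≠ B.edge h := mt (rot_sq_eq_iff _).1 (hu _)
  have n3 : B.rot (B.edge h) ≠ B.rot (B.rot (B.edge h)) := fun h' => hu (B.rot (B.edge h)) h'.symm
  refine cls_withLegs_mem_of_ihx hB hh (hiso ?_) (hiso ?_) L
  · exact exists_graphIso_tetrahedron_of_bigon hB hu hl hb m1 m2 n1 n2 n3 (isLoop_diagramH hh hB)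
      (not_isUnivalent_reattach hu) (B.equivH h) (fun _ => rfl) r1 r2 r4 r5
      fun x => rot_equivH_of_notMem hh
  · exact exists_graphIso_tetrahedron_of_bigon hB hu hl hb m2 m1 n2 n1 n3.symm
      (isLoop_diagramX hh hB) (not_isUnivalent_reattach hu) (B.equivX h) (fun _ => rfl) s1 s2 s4 s5
      fun x => rot_equivX_of_notMem hh

/-- Every three-loop diagram is a combination of tetrahedra with as many legs. -/
theorem cls_mem_of_isLoop {S : ℕ → Submodule ℚ (Space (loopDiagrams 3) allSites)}
    (hS : ∀ L : List (Fin tetrahedron.card),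
      cls (loopDiagrams 3) allSites (tetrahedron.withLegs L) ∈ S L.length)
    (hD : D.IsLoop 3) : cls (loopDiagrams 3) allSites D ∈ S D.numLegs := by
  by_cases hf : D.HasFork
  · rw [isGood_loopDiagrams.cls_of_hasFork hf]; exact zero_mem _
  obtain ⟨B, L, φ, h1, h2, h3⟩ := exists_graphIso_withLegs hD hf
  rw [← h3.cls_mem isGood_loopDiagrams, h3.numLegs_eq, numLegs_withLegs,
    numLegs_of_not_isUnivalent h2, zero_add]
  exact cls_withLegs_mem hS h1 h2 L

end JacobiDiagram

namespace JacobiDiagram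

/-! ### Products over vertices -/

section vertexProd

variable {α β R : Type*} [Fintype α] [Fintype β] [CommRing R]

/-- A set with exactly one element in every cycle of `r`. -/
def IsTransversal (r : Equiv.Perm α) (T : Finset α) : Prop :=
  ∀ x, ∃! y, y ∈ T ∧ r.SameCycle x y

/-- The product of `f` over the cycles of `r`; it is used for functions that are constant along
the cycles. -/
noncomputable def vertexProd (r : Equiv.Perm α) (f : α → R) : R := by
  classical exact ∏ q : Quotient (Equiv.Perm.SameCycle.setoid r), f q.out

theorem vertexProd_eq {r : Equiv.Perm α} {T : Finset α} (hT : IsTransversal r T) {f : α → R}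
    (hf : ∀ x, f (r x) = f x) : vertexProd r f = ∏ x ∈ T, f x := by
  classical
  have hf' : ∀ x y, r.SameCycle x y → f x = f y := by
    have h1 : ∀ (n : ℕ) x, f ((r ^ n) x) = f x := fun n x => by
      induction n with
      | zero => rfl
      | succ n ih => rw [pow_succ', Equiv.Perm.mul_apply, hf, ih]
    intro x y h
    obtain ⟨n, rfl⟩ := h.exists_nat_pow_eq
    exact (h1 n x).symm
  symm
  refine Finset.prod_bij (fun x _ => Quotient.mk (Equiv.Perm.SameCycle.setoid r) x)
    (fun _ _ => Finset.mem_univ _) (fun x hx y hy h => ?_) (fun q _ => ?_) (fun x _ => ?_)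
  · have h' : r.SameCycle x y := Quotient.exact h
    exact (hT x).unique ⟨hx, .refl _ _⟩ ⟨hy, h'⟩
  · obtain ⟨y, ⟨h1, h2⟩, -⟩ := hT q.out
    refine ⟨y, h1, ?_⟩
    rw [← q.out_eq]
    exact Quotient.sound h2.symm
  · exact (hf' _ _ (Quotient.mk_out (s := Equiv.Perm.SameCycle.setoid r) x)).symm

/-- A transversal through given elements of different cycles. -/
theorem exists_isTransversal (r : Equiv.Perm α) {s : Finset α}
    (hs : ∀ x ∈ s, ∀ y ∈ s, r.SameCycle x y → x = y) : ∃ T, s ⊆ T ∧ IsTransversal r T := by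
  classical
  let q : α → α := fun x =>
    (Quotient.mk (Equiv.Perm.SameCycle.setoid r) x).out
  have hq : ∀ x, r.SameCycle (q x) x := fun x =>
    Quotient.mk_out (s := Equiv.Perm.SameCycle.setoid r) x
  have hq' : ∀ x y, r.SameCycle x y → q x = q y := fun x y h =>
    congrArg Quotient.out (Quotient.sound h)
  let p : α → α := fun x => if h : ∃ y ∈ s, r.SameCycle x y then h.choose else q x
  have hp : ∀ x, r.SameCycle x (p x) := fun x => by
    simp only [p]
    split_ifs with h
    · exact h.choose_spec.2
    · exact (hq x).symm
  have hp' : ∀ x y, r.SameCycle x y → p x = p y := fun x y hxy => by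
    simp only [p]
    have e : (∃ z ∈ s, r.SameCycle x z) ↔ ∃ z ∈ s, r.SameCycle y z :=
      exists_congr fun z => and_congr_right fun _ => ⟨hxy.symm.trans, hxy.trans⟩
    by_cases h : ∃ z ∈ s, r.SameCycle x z
    · rw [dif_pos h, dif_pos (e.1 h)]
      exact hs _ h.choose_spec.1 _ (e.1 h).choose_spec.1
        ((h.choose_spec.2.symm.trans hxy).trans (e.1 h).choose_spec.2)
    · rw [dif_neg h, dif_neg (mt e.2 h)]
      exact hq' _ _ hxy
  refine ⟨Finset.univ.image p, fun x hx => ?_, fun x => ⟨p x, ⟨by simp, hp x⟩, ?_⟩⟩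
  · have h : ∃ y ∈ s, r.SameCycle x y := ⟨x, hx, .refl _ _⟩
    refine Finset.mem_image.2 ⟨x, Finset.mem_univ _, ?_⟩
    simp only [p]
    rw [dif_pos h]
    exact hs _ h.choose_spec.1 _ hx h.choose_spec.2.symm
  · rintro y ⟨hy, hxy⟩
    obtain ⟨z, -, rfl⟩ := Finset.mem_image.1 hy
    exact (hp' _ _ (hxy.trans (hp z).symm)).symm

theorem vertexProd_equiv {r : Equiv.Perm α} {r' : Equiv.Perm β} (e : α ≃ β)
    (he : ∀ x, e (r x) = r' (e x)) {f : β → R} (hf : ∀ x, f (r' x) = f x) :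
    vertexProd r' f = vertexProd r (f ∘ e) := by
  classical
  obtain ⟨T, -, hT⟩ := exists_isTransversal r (s := ∅) (by simp)
  have hs : ∀ x y, r'.SameCycle (e x) (e y) ↔ r.SameCycle x y := fun x y => by
    have e1 : r' = e.permCongr r := by ext z; simp [he]
    have h2 : ∀ n : ℕ, (r' ^ n) (e x) = e ((r ^ n) x) := fun n => by
      induction n with
      | zero => rfl
      | succ n ih => rw [pow_succ', Equiv.Perm.mul_apply, ih, ← he, pow_succ',
          Equiv.Perm.mul_apply]
    constructor
    · intro h
      obtain ⟨n, hn⟩ := h.exists_nat_pow_eq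
      rw [h2] at hn
      exact ⟨n, e.injective (by exact_mod_cast hn)⟩
    · intro h
      obtain ⟨n, rfl⟩ := h.exists_nat_pow_eq
      exact ⟨n, by exact_mod_cast h2 n⟩
  have hT' : IsTransversal r' (T.map e.toEmbedding) := by
    intro y
    obtain ⟨x, rfl⟩ := e.surjective y
    obtain ⟨z, ⟨h1, h2⟩, h3⟩ := hT x
    refine ⟨e z, ⟨Finset.mem_map_of_mem _ h1, (hs _ _).2 h2⟩, ?_⟩
    rintro w ⟨hw, hw'⟩
    obtain ⟨w, hwT, rfl⟩ := Finset.mem_map.1 hw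
    exact congrArg e (h3 w ⟨hwT, (hs _ _).1 hw'⟩)
  rw [vertexProd_eq hT' hf, vertexProd_eq hT (fun x => by simp [he, hf]), Finset.prod_map]
  rfl

theorem vertexProd_sumCongr {r : Equiv.Perm α} {r' : Equiv.Perm β} {f : α ⊕ β → R}
    (hf : ∀ x, f (Equiv.sumCongr r r' x) = f x) :
    vertexProd (Equiv.sumCongr r r') f =
      vertexProd r (fun x => f (.inl x)) * vertexProd r' (fun x => f (.inr x)) := by
  classical
  obtain ⟨T, -, hT⟩ := exists_isTransversal r (s := ∅) (by simp)
  obtain ⟨T', -, hT'⟩ := exists_isTransversal r' (s := ∅) (by simp)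
  have p1 : ∀ (n : ℕ) x, ((Equiv.sumCongr r r' : Equiv.Perm (α ⊕ β)) ^ n) (.inl x) =
      .inl ((r ^ n) x) := fun n x => by
    induction n with
    | zero => rfl
    | succ n ih => rw [pow_succ', Equiv.Perm.mul_apply, ih, pow_succ', Equiv.Perm.mul_apply]; rfl
  have p2 : ∀ (n : ℕ) x, ((Equiv.sumCongr r r' : Equiv.Perm (α ⊕ β)) ^ n) (.inr x) =
      .inr ((r' ^ n) x) := fun n x => by
    induction n with
    | zero => rfl
    | succ n ih => rw [pow_succ', Equiv.Perm.mul_apply, ih, pow_succ', Equiv.Perm.mul_apply]; rfl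
  have key : IsTransversal (Equiv.sumCongr r r' : Equiv.Perm (α ⊕ β)) (T.disjSum T') := by
    rintro (x | x)
    · obtain ⟨y, ⟨h1, h2⟩, h3⟩ := hT x
      refine ⟨.inl y, ⟨Finset.inl_mem_disjSum.2 h1, ?_⟩, ?_⟩
      · obtain ⟨n, rfl⟩ := h2.exists_nat_pow_eq
        exact ⟨n, by exact_mod_cast p1 n x⟩
      · rintro (z | z) ⟨hz, hz'⟩
        · obtain ⟨n, hn⟩ := hz'.exists_nat_pow_eq
          rw [p1, Sum.inl.injEq] at hn
          rw [h3 z ⟨Finset.inl_mem_disjSum.1 hz, n, by exact_mod_cast hn⟩]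
        · obtain ⟨n, hn⟩ := hz'.exists_nat_pow_eq
          rw [p1] at hn
          simp at hn
    · obtain ⟨y, ⟨h1, h2⟩, h3⟩ := hT' x
      refine ⟨.inr y, ⟨Finset.inr_mem_disjSum.2 h1, ?_⟩, ?_⟩
      · obtain ⟨n, rfl⟩ := h2.exists_nat_pow_eq
        exact ⟨n, by exact_mod_cast p2 n x⟩
      · rintro (z | z) ⟨hz, hz'⟩
        · obtain ⟨n, hn⟩ := hz'.exists_nat_pow_eq
          rw [p2] at hn
          simp at hn
        · obtain ⟨n, hn⟩ := hz'.exists_nat_pow_eq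
          rw [p2, Sum.inr.injEq] at hn
          rw [h3 z ⟨Finset.inr_mem_disjSum.1 hz, n, by exact_mod_cast hn⟩]
  rw [vertexProd_eq key hf, vertexProd_eq hT (fun x => hf (.inl x)),
    vertexProd_eq hT' (fun x => hf (.inr x)), Finset.prod_disjSum]

end vertexProd

/-! ### The weights of the vertices -/

section weights

variable {α β κ R : Type*} [Fintype α] [Fintype β] [DecidableEq α] [DecidableEq β]
  [DecidableEq κ] [CommRing R]

/-- The Kronecker delta. -/
def delta (R : Type*) [CommRing R] (a b : κ) : R := if a = b then 1 else 0

/-- The structure constants of the Lie algebra `gl` in the basis of matrix units, of which a pair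
`(i, j)` is the index: `Tr (e_u e_v e_w) - Tr (e_u e_w e_v)`. -/
def glTensor (R : Type*) [CommRing R] (u v w : κ × κ) : R :=
  delta R u.2 v.1 * delta R v.2 w.1 * delta R w.2 u.1 -
    delta R u.2 w.1 * delta R w.2 v.1 * delta R v.2 u.1

theorem glTensor_rot (u v w : κ × κ) : glTensor R v w u = glTensor R u v w := by
  unfold glTensor; ring

theorem glTensor_swap (u v w : κ × κ) : glTensor R u w v = - glTensor R u v w := by
  unfold glTensor; ring

/-- Two structure constants contracted along an edge, whose two half-edges carry the transposed pairs
`(i, j)` and `(j, i)`: the indices on both sides of the edge are identified. -/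
theorem sum_glTensor_mul (S : Finset κ) {a b c d : κ × κ} (ha : a.1 ∈ S ∧ a.2 ∈ S)
    (hb : b.1 ∈ S ∧ b.2 ∈ S) :
    ∑ i ∈ S, ∑ j ∈ S, glTensor R (i, j) a b * glTensor R (j, i) c d =
      delta R a.2 b.1 * delta R c.2 d.1 * delta R d.2 a.1 * delta R b.2 c.1
      - delta R a.2 b.1 * delta R d.2 c.1 * delta R c.2 a.1 * delta R b.2 d.1
      - delta R b.2 a.1 * delta R c.2 d.1 * delta R d.2 b.1 * delta R a.2 c.1
      + delta R b.2 a.1 * delta R d.2 c.1 * delta R c.2 b.1 * delta R a.2 d.1 := by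
  have h1 : ∀ (p q : κ) (x y : κ), p ∈ S → q ∈ S →
      ∑ i ∈ S, ∑ j ∈ S, delta R p i * delta R j q * (delta R x j * delta R i y) =
        delta R x q * delta R p y := by
    intro p q x y hp hq
    have : ∀ i ∈ S, ∑ j ∈ S, delta R p i * delta R j q * (delta R x j * delta R i y) =
        delta R p i * (delta R x q * delta R i y) := by
      intro i _
      rw [Finset.sum_eq_single q (fun j _ hj => by simp [delta, hj]) (fun h => absurd hq h)]
      simp [delta]
    rw [Finset.sum_congr rfl this,
      Finset.sum_eq_single p (fun j _ hj => by simp [delta, hj.symm]) (fun h => absurd hp h)]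
    simp [delta]
  have e : ∀ i j, glTensor R (i, j) a b * glTensor R (j, i) c d =
      delta R a.2 b.1 * delta R c.2 d.1 *
        (delta R b.2 i * delta R j a.1 * (delta R d.2 j * delta R i c.1))
      - delta R a.2 b.1 * delta R d.2 c.1 *
        (delta R b.2 i * delta R j a.1 * (delta R c.2 j * delta R i d.1))
      - delta R b.2 a.1 * delta R c.2 d.1 *
        (delta R a.2 i * delta R j b.1 * (delta R d.2 j * delta R i c.1))
      + delta R b.2 a.1 * delta R d.2 c.1 *
        (delta R a.2 i * delta R j b.1 * (delta R c.2 j * delta R i d.1)) := by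
    intro i j; unfold glTensor; ring
  simp only [e, Finset.sum_add_distrib, Finset.sum_sub_distrib, ← Finset.mul_sum,
    h1 _ _ _ _ hb.2 ha.1, h1 _ _ _ _ ha.2 hb.1]
  ring

/-- The Jacobi identity of the Lie algebra `gl`, whose matrices are indexed by `S`. -/
theorem sum_glTensor_ihx (S : Finset κ) {a b c d : κ × κ} (ha : a.1 ∈ S ∧ a.2 ∈ S)
    (hb : b.1 ∈ S ∧ b.2 ∈ S) (hc : c.1 ∈ S ∧ c.2 ∈ S) (hd : d.1 ∈ S ∧ d.2 ∈ S) :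
    ∑ i ∈ S, ∑ j ∈ S, glTensor R (i, j) a b * glTensor R (j, i) c d =
      ∑ i ∈ S, ∑ j ∈ S, glTensor R (i, j) b c * glTensor R (j, i) d a -
      ∑ i ∈ S, ∑ j ∈ S, glTensor R (i, j) b d * glTensor R (j, i) c a := by
  rw [sum_glTensor_mul S ha hb, sum_glTensor_mul S hb hc, sum_glTensor_mul S hb hd]
  ring

/-- The weight of the vertex of `x` when the half-edges are labelled by `c`: the structure constant
at a trivalent vertex, and the coefficient of the diagonal matrix with entries `t` at a univalent
one. -/
def vertexWeight (t : κ → R) (r : Equiv.Perm α) (c : α → κ × κ) (x : α) : R :=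
  if r x = x then delta R (c x).1 (c x).2 * t (c x).1 else glTensor R (c x) (c (r x)) (c (r (r x)))

theorem vertexWeight_rot (t : κ → R) {r : Equiv.Perm α} (hr : ∀ x, r (r (r x)) = x)
    (c : α → κ × κ) (x : α) : vertexWeight t r c (r x) = vertexWeight t r c x := by
  unfold vertexWeight
  simp only [r.injective.eq_iff, hr]
  split_ifs with h
  · rw [h]
  · exact glTensor_rot _ _ _

/-- The product of the weights of all vertices. -/
noncomputable def weightProd (t : κ → R) (r : Equiv.Perm α) (c : α → κ × κ) : R :=
  vertexProd r (vertexWeight t r c)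

theorem weightProd_equiv (t : κ → R) {r : Equiv.Perm α} {r' : Equiv.Perm β}
    (hr : ∀ x, r (r (r x)) = x) (e : α ≃ β)
    (he : ∀ x, e (r x) = r' (e x)) (c : β → κ × κ) :
    weightProd t r' c = weightProd t r (c ∘ e) := by
  have hr' : ∀ x, r' (r' (r' x)) = x := fun x => by
    obtain ⟨x, rfl⟩ := e.surjective x
    rw [← he, ← he, ← he, hr]
  rw [weightProd, vertexProd_equiv e he (vertexWeight_rot t hr' c), weightProd]
  refine congrArg (vertexProd r) (funext fun x => ?_)
  simp [vertexWeight, ← he]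

theorem weightProd_eq (t : κ → R) {r : Equiv.Perm α} (hr : ∀ x, r (r (r x)) = x) {T : Finset α}
    (hT : IsTransversal r T) (c : α → κ × κ) :
    weightProd t r c = ∏ x ∈ T, vertexWeight t r c x :=
  vertexProd_eq hT (vertexWeight_rot t hr c)

/-- Splitting off two vertices. -/
theorem weightProd_eq_mul_mul (t : κ → R) {r : Equiv.Perm α} (hr : ∀ x, r (r (r x)) = x) {h k : α}
    (hk : ¬ r.SameCycle h k) : ∃ T : Finset α,
      (∀ x ∈ T, ¬ r.SameCycle h x ∧ ¬ r.SameCycle k x) ∧ ∀ c : α → κ × κ,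
      weightProd t r c = vertexWeight t r c h * vertexWeight t r c k *
        ∏ x ∈ T, vertexWeight t r c x := by
  have hne : h ≠ k := fun e => hk (e ▸ .refl _ _)
  obtain ⟨T, h1, h2⟩ := exists_isTransversal r (s := {h, k}) (by
    intro x hx y hy hxy
    simp only [Finset.mem_insert, Finset.mem_singleton] at hx hy
    rcases hx with rfl | rfl <;> rcases hy with rfl | rfl
    exacts [rfl, absurd hxy hk, absurd hxy.symm hk, rfl])
  have hh : h ∈ T := h1 (by simp)
  have hk' : k ∈ T := h1 (by simp)
  refine ⟨(T.erase h).erase k, fun x hx => ?_, fun c => ?_⟩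
  · simp only [Finset.mem_erase] at hx
    exact ⟨fun h' => hx.2.1 ((h2 h).unique ⟨hx.2.2, h'⟩ ⟨hh, .refl _ _⟩),
      fun h' => hx.1 ((h2 k).unique ⟨hx.2.2, h'⟩ ⟨hk', .refl _ _⟩)⟩
  · rw [weightProd_eq t hr h2, mul_assoc, Finset.mul_prod_erase _ _
      (Finset.mem_erase.2 ⟨hne.symm, hk'⟩), Finset.mul_prod_erase _ _ hh]

/-- Splitting off one vertex. -/
theorem weightProd_eq_mul (t : κ → R) {r : Equiv.Perm α} (hr : ∀ x, r (r (r x)) = x) (h : α) :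
    ∃ T : Finset α, (∀ x ∈ T, ¬ r.SameCycle h x) ∧ ∀ c : α → κ × κ,
      weightProd t r c = vertexWeight t r c h * ∏ x ∈ T, vertexWeight t r c x := by
  obtain ⟨T, h1, h2⟩ := exists_isTransversal r (s := {h}) (by
    intro x hx y hy hxy
    simp only [Finset.mem_singleton] at hx hy
    rw [hx, hy])
  have hh : h ∈ T := h1 (by simp)
  refine ⟨T.erase h, fun x hx => ?_, fun c => ?_⟩
  · simp only [Finset.mem_erase] at hx
    exact fun h' => hx.1 ((h2 h).unique ⟨hx.2, h'⟩ ⟨hh, .refl _ _⟩)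
  · rw [weightProd_eq t hr h2, Finset.mul_prod_erase _ _ hh]

end weights

end JacobiDiagram

namespace JacobiDiagram

variable {D D' B : JacobiDiagram} {κ R : Type*} [DecidableEq κ] [CommRing R]

/-! ### State sums -/

/-- The pair of labels of the half-edges of an edge, as seen from one of its ends. -/
def colours (D : JacobiDiagram) (g : Fin D.card → κ) (x : Fin D.card) : κ × κ := (g x, g (D.edge x))

/-- The sum over all labellings of the half-edges by elements of `S` of the product of the weights
of the vertices, with an additional weight `M`. -/
noncomputable def stateSum (S : Finset κ) (t : κ → R) (D : JacobiDiagram)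
    (M : (Fin D.card → κ × κ) → R) : R :=
  ∑ g ∈ Fintype.piFinset fun _ : Fin D.card => S,
    weightProd t D.rot (D.colours g) * M (D.colours g)

/-- The labellings of a graph are those of an isomorphic graph, whatever the cyclic orders. -/
theorem stateSum_congr_diagram (S : Finset κ) (t : κ → R) (φ : Fin D.card ≃ Fin D'.card)
    (he : ∀ x, φ (D.edge x) = D'.edge (φ x)) :
    stateSum S t D' 1 = ∑ g ∈ Fintype.piFinset fun _ : Fin D.card => S,
      weightProd t D'.rot (D.colours g ∘ φ.symm) := by
  unfold stateSum
  refine Finset.sum_nbij' (fun g => g ∘ φ) (fun g => g ∘ φ.symm) ?_ ?_ ?_ ?_ ?_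
  · intro g hg; rw [Fintype.mem_piFinset] at hg ⊢; exact fun y => hg _
  · intro g hg; rw [Fintype.mem_piFinset] at hg ⊢; exact fun y => hg _
  · intro g _; ext; simp
  · intro g _; ext; simp
  · intro g _
    rw [Pi.one_apply, mul_one]
    congr 1
    funext y
    simp [colours, he]

theorem stateSum_iso (S : Finset κ) (t : κ → R) {φ : Fin D.card ≃ Fin D'.card}
    (h : IsIso D D' φ) : stateSum S t D' 1 = stateSum S t D 1 := by
  rw [stateSum_congr_diagram S t φ h.2, stateSum]
  refine Finset.sum_congr rfl fun g _ => ?_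
  rw [weightProd_equiv t D.rot_cube φ h.1, Pi.one_apply, mul_one, Function.comp_assoc,
    Equiv.symm_comp_self, Function.comp_id]

theorem stateSum_reattach (S : Finset κ) (t : κ → R) (τ : Equiv.Perm (Fin D.card)) :
    stateSum S t (D.reattach τ) 1 = ∑ g ∈ Fintype.piFinset fun _ : Fin D.card => S,
      weightProd t D.rot (D.colours g ∘ τ) := by
  rw [stateSum_congr_diagram S t (D.reattachEquiv τ) fun _ => rfl]
  refine Finset.sum_congr rfl fun g _ => ?_
  refine (weightProd_equiv t D.rot_cube (τ.trans (D.reattachEquiv τ)) (fun x => ?_) _).trans ?_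
  · rw [Equiv.trans_apply, Equiv.trans_apply, reattach_rot, Equiv.Perm.inv_def,
      Equiv.symm_apply_apply]
  · congr 1

/-- The state sum changes its sign when the cyclic order at a vertex is reversed. -/
theorem stateSum_flip (S : Finset κ) (t : κ → R) {h : Fin D.card} (hh : ¬ D.IsUnivalent h) :
    stateSum S t (D.flip h) 1 = - stateSum S t D 1 := by
  rw [flip, stateSum_reattach, stateSum, ← Finset.sum_neg_distrib]
  refine Finset.sum_congr rfl fun g _ => ?_
  obtain ⟨T, h1, h2⟩ := weightProd_eq_mul t D.rot_cube h
  have hh' : D.rot h ≠ h := hh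
  have n1 : h ≠ D.rot h := fun e => hh e.symm
  have n2 : h ≠ D.rot (D.rot h) := fun e => hh ((rot_sq_eq_iff h).1 e.symm)
  rw [h2, h2, Pi.one_apply, mul_one, ← neg_mul]
  refine congrArg₂ _ ?_ (Finset.prod_congr rfl fun x hx => ?_)
  · rw [vertexWeight, vertexWeight, if_neg hh', if_neg hh']
    simp only [Function.comp_apply, Equiv.swap_apply_left, Equiv.swap_apply_right,
      Equiv.swap_apply_of_ne_of_ne n1 n2]
    exact glTensor_swap _ _ _
  · have h3 : ∀ y, D.rot.SameCycle x y →
        Equiv.swap (D.rot h) (D.rot (D.rot h)) y = y := fun y hy => by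
      refine Equiv.swap_apply_of_ne_of_ne ?_ ?_ <;> rintro rfl <;>
        exact h1 x hx (by simpa using hy.symm)
    simp only [vertexWeight, Function.comp_apply, h3 x (.refl _ _),
      h3 (D.rot x) (sameCycle_rot_iff.2 (.inr (.inl rfl))),
      h3 (D.rot (D.rot x)) (sameCycle_rot_iff.2 (.inr (.inr rfl)))]

/-- Summing over the label of `h` twice counts every labelling `S.card` times. -/
theorem sum_piFinset_update {α : Type*} [Fintype α] [DecidableEq α] (S : Finset κ) (h : α)
    (f : (α → κ) → R) : ∑ g ∈ Fintype.piFinset fun _ : α => S, ∑ i ∈ S, f (Function.update g h i) =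
      S.card • ∑ g ∈ Fintype.piFinset fun _ : α => S, f g := by
  rw [← Finset.sum_product', ← Finset.sum_const, Finset.sum_comm' (t' := Fintype.piFinset fun _ => S)
    (s' := fun _ => S) (by simp [and_comm]), ← Finset.sum_product']
  refine Finset.sum_nbij' (fun p => (Function.update p.1 h p.2, p.1 h))
    (fun p => (Function.update p.1 h p.2, p.1 h)) ?_ ?_ ?_ ?_ ?_
  · rintro ⟨g, i⟩ hp
    simp only [Finset.mem_product, Fintype.mem_piFinset] at hp ⊢
    refine ⟨fun a => ?_, hp.1 _⟩
    by_cases ha : a = h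
    · subst ha; simpa using hp.2
    · simpa [ha] using hp.1 a
  · rintro ⟨g, i⟩ hp
    simp only [Finset.mem_product, Fintype.mem_piFinset] at hp ⊢
    refine ⟨fun a => ?_, hp.1 _⟩
    by_cases ha : a = h
    · subst ha; simpa using hp.2
    · simpa [ha] using hp.1 a
  · rintro ⟨g, i⟩ _; simp
  · rintro ⟨g, i⟩ _; simp
  · rintro ⟨g, i⟩ _; rfl

/-- The IHX relation for the state sums, which is the Jacobi identity of the Lie algebra. -/
theorem stateSum_ihx [IsDomain R] [CharZero R] (S : Finset κ) (t : κ → R) {h : Fin D.card}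
    (hh : D.IsInner h) : stateSum S t D 1 =
      stateSum S t (D.diagramH h) 1 - stateSum S t (D.diagramX h) 1 := by
  rcases S.eq_empty_or_nonempty with rfl | hS
  · have : (Fintype.piFinset fun _ : Fin D.card => (∅ : Finset κ)) = ∅ :=
      Finset.eq_empty_of_forall_notMem fun g hg => by simpa using Fintype.mem_piFinset.1 hg h
    rw [diagramH, diagramX, stateSum_reattach, stateSum_reattach, stateSum, this]
    simp
  obtain ⟨T, h1, h2⟩ := weightProd_eq_mul_mul t D.rot_cube hh.2.2
  have hn := hh.nodup
  have u1 : D.rot h ≠ h := hh.1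
  have u2 : D.rot (D.edge h) ≠ D.edge h := hh.2.1
  have ee := D.edge_edge h
  have q1 := D.rot_cube h
  have q2 := D.rot_cube (D.edge h)
  obtain ⟨a, ha⟩ : ∃ a, D.rot h = a := ⟨_, rfl⟩
  obtain ⟨b, hb⟩ : ∃ b, D.rot a = b := ⟨_, rfl⟩
  obtain ⟨h', hh'⟩ : ∃ h', D.edge h = h' := ⟨_, rfl⟩
  obtain ⟨c, hc⟩ : ∃ c, D.rot h' = c := ⟨_, rfl⟩
  obtain ⟨d, hd⟩ : ∃ d, D.rot c = d := ⟨_, rfl⟩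
  simp only [sameCycle_rot_iff] at h1
  rw [diagramH, diagramX, stateSum_reattach, stateSum_reattach, stateSum]
  simp only [ha, hb, hh', hc, hd] at h1 h2 hn u1 u2 ee q1 q2 ⊢
  simp only [List.nodup_cons, List.mem_cons, List.not_mem_nil, or_false, not_or] at hn
  obtain ⟨⟨n1, n2, n3, n4, n5⟩, ⟨n6, n7, n8, n9⟩, ⟨n10, n11, n12⟩, ⟨n13, n14⟩, n15, -⟩ := hn
  -- the vertices other than the two ends of the edge do not see the labels at these ends
  have rest : ∀ (c₀ c₁ : Fin D.card → κ × κ), (∀ y, y ≠ h → y ≠ a → y ≠ b → y ≠ h' → y ≠ c →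
      y ≠ d → c₀ y = c₁ y) → ∏ x ∈ T, vertexWeight t D.rot c₀ x =
        ∏ x ∈ T, vertexWeight t D.rot c₁ x := by
    intro c₀ c₁ hc₀
    refine Finset.prod_congr rfl fun x hx => ?_
    have hx' := h1 x hx
    have hxr : ∀ y, y = x ∨ y = D.rot x ∨ y = D.rot (D.rot x) → c₀ y = c₁ y := by
      intro y hy
      have r1 := D.rot_cube x
      have := D.rot.injective
      refine hc₀ y ?_ ?_ ?_ ?_ ?_ ?_ <;> rintro rfl <;> grind
    simp only [vertexWeight, hxr x (by simp), hxr (D.rot x) (by simp),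
      hxr (D.rot (D.rot x)) (by simp)]
  -- the weights of the two ends are split off
  have key : ∀ c₀ : Fin D.card → κ × κ, weightProd t D.rot c₀ =
      glTensor R (c₀ h) (c₀ a) (c₀ b) * glTensor R (c₀ h') (c₀ c) (c₀ d) *
        ∏ x ∈ T, vertexWeight t D.rot c₀ x := by
    intro c₀
    rw [h2, vertexWeight, vertexWeight, ha, hb, hc, hd, if_neg u1, if_neg u2]
  rw [← sub_eq_zero, ← Finset.sum_sub_distrib, ← Finset.sum_sub_distrib]
  have φ_eq : ∀ g : Fin D.card → κ, (weightProd t D.rot (D.colours g) *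
      (1 : (Fin D.card → κ × κ) → R) (D.colours g) -
      (weightProd t D.rot (D.colours g ∘
          ⇑(Equiv.swap a b * Equiv.swap b c * Equiv.swap c d : Equiv.Perm (Fin D.card))) -
        weightProd t D.rot (D.colours g ∘
          ⇑(Equiv.swap a b * Equiv.swap b d : Equiv.Perm (Fin D.card))))) =
      (glTensor R (D.colours g h) (D.colours g a) (D.colours g b) *
          glTensor R (D.colours g h') (D.colours g c) (D.colours g d) -
        (glTensor R (D.colours g h) (D.colours g b) (D.colours g c) *
          glTensor R (D.colours g h') (D.colours g d) (D.colours g a) -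
        glTensor R (D.colours g h) (D.colours g b) (D.colours g d) *
          glTensor R (D.colours g h') (D.colours g c) (D.colours g a))) *
        ∏ x ∈ T, vertexWeight t D.rot (D.colours g) x := by
    intro g
    rw [key, key, key, Pi.one_apply, mul_one,
      rest (D.colours g ∘
        ⇑(Equiv.swap a b * Equiv.swap b c * Equiv.swap c d : Equiv.Perm (Fin D.card)))
        (D.colours g),
      rest (D.colours g ∘ ⇑(Equiv.swap a b * Equiv.swap b d : Equiv.Perm (Fin D.card)))
        (D.colours g), sub_mul, sub_mul]
    · congr 3 <;> congr 2 <;> simp only [Function.comp_apply, Equiv.Perm.mul_apply,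
        Equiv.swap_apply_def] <;> congr 1 <;> grind
    · intro y m1 m2 m3 m4 m5 m6
      simp [Equiv.swap_apply_of_ne_of_ne, *]
    · intro y m1 m2 m3 m4 m5 m6
      simp [Equiv.swap_apply_of_ne_of_ne, *]
  simp only [φ_eq]
  -- the labels at the two ends of the edge `h` are summed first
  have hS' : S.card ≠ 0 := hS.card_pos.ne'
  have inj := D.edge.injective
  refine (mul_eq_zero.1 ?_).resolve_left (Nat.cast_ne_zero (R := R).2 hS')
  refine (mul_eq_zero.1 ?_).resolve_left (Nat.cast_ne_zero (R := R).2 hS')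
  rw [← nsmul_eq_mul, ← nsmul_eq_mul, ← sum_piFinset_update S h', ← sum_piFinset_update S h]
  refine Finset.sum_eq_zero fun g hg => ?_
  rw [Fintype.mem_piFinset] at hg
  have hcol : ∀ x, (D.colours g x).1 ∈ S ∧ (D.colours g x).2 ∈ S := fun x => ⟨hg _, hg _⟩
  have col : ∀ i j, ∀ y, y ≠ h → y ≠ h' →
      D.colours (Function.update (Function.update g h i) h' j) y = D.colours g y := by
    intro i j y m1 m2
    have m3 : D.edge y ≠ h' := fun e => m1 (inj (e.trans hh'.symm))
    have m4 : D.edge y ≠ h := fun e => m2 (inj (e.trans ee.symm))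
    simp [colours, Function.update_of_ne, *]
  have col1 : ∀ i j, D.colours (Function.update (Function.update g h i) h' j) h = (i, j) := by
    intro i j
    simp [colours, hh', n3]
  have col2 : ∀ i j, D.colours (Function.update (Function.update g h i) h' j) h' = (j, i) := by
    intro i j
    simp [colours, ee, n3]
  have step : ∀ i j, ∏ x ∈ T, vertexWeight t D.rot
      (D.colours (Function.update (Function.update g h i) h' j)) x =
        ∏ x ∈ T, vertexWeight t D.rot (D.colours g) x := fun i j =>
    rest _ _ fun y m1 _ _ m4 _ _ => col i j y m1 m4
  have m1 := fun i j => col i j a (Ne.symm n1) n7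
  have m2 := fun i j => col i j b (Ne.symm n2) n10
  have m3 := fun i j => col i j c (Ne.symm n4) (Ne.symm n13)
  have m4 := fun i j => col i j d (Ne.symm n5) (Ne.symm n14)
  simp only [step, col1, col2, m1, m2, m3, m4]
  simp only [← Finset.sum_mul, Finset.sum_sub_distrib]
  rw [sum_glTensor_ihx S (hcol a) (hcol b) (hcol c) (hcol d), sub_self, zero_mul]

/-- A new leg has one trivalent and one univalent vertex. -/
theorem weightProd_legRot (t : κ → R) (c : Fin 4 → κ × κ) :
    weightProd t legRot c =
      glTensor R (c 0) (c 1) (c 2) * (delta R (c 3).1 (c 3).2 * t (c 3).1) := by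
  have h : ∀ x, legRot (legRot (legRot x)) = x := by decide
  have hc : ∀ x y : Fin 4, legRot.SameCycle x y ↔ y = x ∨ y = legRot x ∨ y = legRot (legRot x) := by
    intro x y
    constructor
    · intro h'
      obtain ⟨n, rfl⟩ := h'.exists_nat_pow_eq
      induction n with
      | zero => exact .inl rfl
      | succ n ih =>
        rw [pow_succ', Equiv.Perm.mul_apply]
        rcases ih ⟨n, by simp⟩ with h1 | h1 | h1
        · exact .inr (.inl (congrArg legRot h1))
        · exact .inr (.inr (congrArg legRot h1))
        · exact .inl ((congrArg legRot h1).trans (h x))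
    · rintro (rfl | rfl | rfl)
      · exact .refl _ _
      · exact ⟨1, by simp⟩
      · exact ⟨2, by simp [zpow_ofNat, pow_succ]⟩
  have hT : IsTransversal legRot {0, 3} := by
    intro x
    simp only [hc, ExistsUnique]
    revert x
    decide
  rw [weightProd_eq t h hT, Finset.prod_pair (by decide)]
  rfl

theorem weightProd_attach (t : κ → R) (x : Fin D.card) (c : Fin (D.attach x).card → κ × κ) :
    weightProd t (D.attach x).rot c = weightProd t D.rot (fun y => c (D.old x y)) *
      (glTensor R (c (D.new x 0)) (c (D.new x 1)) (c (D.new x 2)) *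
        (delta R (c (D.new x 3)).1 (c (D.new x 3)).2 * t (c (D.new x 3)).1)) := by
  have hr : ∀ z, (Equiv.sumCongr D.rot legRot) ((Equiv.sumCongr D.rot legRot)
      ((Equiv.sumCongr D.rot legRot) z)) = z := by
    have h : ∀ x, legRot (legRot (legRot x)) = x := by decide
    rintro (y | k)
    · exact congrArg Sum.inl (D.rot_cube y)
    · exact congrArg Sum.inr (h k)
  have hs := vertexProd_sumCongr (r := D.rot) (r' := legRot)
    (vertexWeight_rot t hr (c ∘ D.attachEquiv x))
  refine (weightProd_equiv t hr (D.attachEquiv x) (fun z => (ofPerms_rot z).symm) c).trans ?_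
  refine hs.trans (congrArg₂ _ ?_ ?_)
  · refine congrArg (vertexProd D.rot) (funext fun y => ?_)
    simp [vertexWeight]
  · refine Eq.trans ?_ (weightProd_legRot t fun k => c (D.new x k))
    refine congrArg (vertexProd legRot) (funext fun y => ?_)
    simp [vertexWeight]

/-- The sum over the labels `n` of the four half-edges of a new leg on an edge with labels `p` and
`q`, which is the commutator with the diagonal matrix with entries `t`. -/
theorem sum_glTensor_leg (S : Finset κ) (t : κ → R) {p q : κ} (hp : p ∈ S) (hq : q ∈ S)
    (f : κ → κ → R) : ∑ n ∈ Fintype.piFinset fun _ : Fin 4 => S,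
      f (n 0) (n 1) * (glTensor R (n 0, p) (n 1, q) (n 2, n 3) *
        (delta R (n 3) (n 2) * t (n 3))) = f q p * (t q - t p) := by
  have e : ∀ n : Fin 4 → κ, f (n 0) (n 1) * (glTensor R (n 0, p) (n 1, q) (n 2, n 3) *
      (delta R (n 3) (n 2) * t (n 3))) =
      f (n 0) (n 1) * (delta R p (n 1) * delta R q (n 2) * delta R (n 3) (n 0) *
        (delta R (n 3) (n 2) * t (n 3))) -
      f (n 0) (n 1) * (delta R p (n 2) * delta R (n 3) (n 1) * delta R q (n 0) *
        (delta R (n 3) (n 2) * t (n 3))) := fun n => by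
    unfold glTensor; ring
  have ext4 : ∀ n m : Fin 4 → κ, n 0 = m 0 → n 1 = m 1 → n 2 = m 2 → n 3 = m 3 → n = m := by
    intro n m h0 h1 h2 h3
    funext k
    fin_cases k <;> assumption
  simp only [e, Finset.sum_sub_distrib]
  rw [Finset.sum_eq_single (![q, p, q, q] : Fin 4 → κ), Finset.sum_eq_single
    (![q, p, p, p] : Fin 4 → κ)]
  · simp [delta, mul_sub]
  · intro n _ hn
    by_contra h
    simp only [delta, mul_ite, ite_mul, mul_one, mul_zero, one_mul, zero_mul, ite_eq_right_iff,
      Classical.not_imp, ne_eq] at h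
    refine hn (ext4 _ _ ?_ ?_ ?_ ?_) <;> simp <;> grind
  · intro h
    refine absurd (Fintype.mem_piFinset.2 fun k => ?_) h
    fin_cases k <;> simp [hp, hq]
  · intro n _ hn
    by_contra h
    simp only [delta, mul_ite, ite_mul, mul_one, mul_zero, one_mul, zero_mul, ite_eq_right_iff,
      Classical.not_imp, ne_eq] at h
    refine hn (ext4 _ _ ?_ ?_ ?_ ?_) <;> simp <;> grind
  · intro h
    refine absurd (Fintype.mem_piFinset.2 fun k => ?_) h
    fin_cases k <;> simp [hp, hq]

/-- Attaching a leg to the edge of `x` multiplies the weights by the difference of the variables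
of the two labels of this edge. -/
theorem stateSum_attach (S : Finset κ) (t : κ → R) (x : Fin D.card)
    (M : (Fin D.card → κ × κ) → R) :
    stateSum S t (D.attach x) (fun c => M fun y => c (D.old x y)) =
      stateSum S t D fun c => (t (c x).2 - t (c x).1) * M c := by
  -- the pairs of labels seen from the old half-edges, where `a` and `b` are the labels of the new
  -- half-edges opposite to `x` and `edge x`
  let cx : (Fin D.card → κ) → κ → κ → Fin D.card → κ × κ := fun g a b y =>
    (g y, if y = x then a else if y = D.edge x then b else g (D.edge y))
  have hcx : ∀ g, cx g (g (D.edge x)) (g x) = D.colours g := by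
    intro g
    funext y
    refine Prod.ext rfl ?_
    simp only [cx, colours]
    split_ifs with h1 h2
    · rw [h1]
    · rw [h2, edge_edge]
    · rfl
  calc stateSum S t (D.attach x) (fun c => M fun y => c (D.old x y))
      = ∑ p ∈ (Fintype.piFinset fun _ : Fin D.card => S) ×ˢ Fintype.piFinset fun _ : Fin 4 => S,
        (weightProd t D.rot (cx p.1 (p.2 0) (p.2 1)) * M (cx p.1 (p.2 0) (p.2 1))) *
          (glTensor R (p.2 0, p.1 x) (p.2 1, p.1 (D.edge x)) (p.2 2, p.2 3) *
            (delta R (p.2 3) (p.2 2) * t (p.2 3))) := by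
        refine Finset.sum_nbij' (fun g => (fun y => g (D.old x y), fun k => g (D.new x k)))
          (fun p z => Sum.elim p.1 p.2 ((D.attachEquiv x).symm z)) ?_ ?_ ?_ ?_ ?_
        · intro g hg
          rw [Fintype.mem_piFinset] at hg
          rw [Finset.mem_product, Fintype.mem_piFinset, Fintype.mem_piFinset]
          exact ⟨fun y => hg _, fun k => hg _⟩
        · intro p hp
          rw [Finset.mem_product, Fintype.mem_piFinset, Fintype.mem_piFinset] at hp
          rw [Fintype.mem_piFinset]
          intro z
          rcases (D.attachEquiv x).symm z with y | k
          exacts [hp.1 y, hp.2 k]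
        · intro g _
          funext z
          obtain ⟨y | k, rfl⟩ := (D.attachEquiv x).surjective z <;> simp
        · intro p _
          simp
        · intro g _
          have h1 : (fun y => (D.attach x).colours g (D.old x y)) =
              cx (fun y => g (D.old x y)) (g (D.new x 0)) (g (D.new x 1)) := by
            funext y
            refine Prod.ext rfl ?_
            simp only [cx, colours, attach_edge_old_eq_ite]
            split_ifs <;> rfl
          beta_reduce
          rw [weightProd_attach, h1]
          simp only [colours, attach_edge_new_zero, attach_edge_new_one, attach_edge_new_two,
            attach_edge_new_three]
          ring
    _ = stateSum S t D fun c => (t (c x).2 - t (c x).1) * M c := by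
        rw [Finset.sum_product]
        refine Finset.sum_congr rfl fun g hg => ?_
        rw [Fintype.mem_piFinset] at hg
        rw [sum_glTensor_leg S t (hg x) (hg (D.edge x)) fun a b =>
          weightProd t D.rot (cx g a b) * M (cx g a b), hcx]
        simp only [colours]
        ring

/-- Every leg contributes a difference of two variables to the state sum of the graph without
legs. -/
theorem stateSum_withLegs (S : Finset κ) (t : κ → R) (L : List (Fin B.card))
    (M : (Fin B.card → κ × κ) → R) :
    stateSum S t (B.withLegs L) (fun c => M fun y => c (B.base L y)) =
      stateSum S t B fun c => (L.map fun b => t (c b).2 - t (c b).1).prod * M c := by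
  induction L generalizing M with
  | nil => simp; rfl
  | cons b L ih =>
    refine (stateSum_attach S t (B.base L b) fun c => M fun y => c (B.base L y)).trans ?_
    refine (ih fun c => (t (c b).2 - t (c b).1) * M c).trans ?_
    congr 1
    funext c
    rw [List.map_cons, List.prod_cons]
    ring

end JacobiDiagram

namespace JacobiDiagram

open MvPolynomial

variable {D D' B : JacobiDiagram}

/-! ### The weight system of a three-loop diagram -/

/-- The alternating sum, over the sets `S` of labels, of the state sums with labels in
`S`. -/
noncomputable def surjSum (D : JacobiDiagram)
    (M : (Fin D.card → Fin 4 × Fin 4) → MvPolynomial (Fin 4) ℚ) : MvPolynomial (Fin 4) ℚ :=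
  ∑ S : Finset (Fin 4), (-1) ^ S.card * stateSum S X D M

theorem sum_neg_one_pow_card_of_subset : ∀ A : Finset (Fin 4),
    (∑ S : Finset (Fin 4), if A ⊆ S then (-1 : ℤ) ^ S.card else 0) =
      if A = Finset.univ then 1 else 0 := by
  decide

/-- By inclusion–exclusion, only the labellings by all of the four labels remain. -/
theorem surjSum_eq (M : (Fin D.card → Fin 4 × Fin 4) → MvPolynomial (Fin 4) ℚ) :
    surjSum D M = ∑ g : Fin D.card → Fin 4 with Function.Surjective g,
      weightProd X D.rot (D.colours g) * M (D.colours g) := by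
  have h1 : ∀ S : Finset (Fin 4), (-1) ^ S.card * stateSum S X D M =
      ∑ g : Fin D.card → Fin 4, (((if Finset.univ.image g ⊆ S then (-1 : ℤ) ^ S.card else 0 : ℤ)) :
        MvPolynomial (Fin 4) ℚ) * (weightProd X D.rot (D.colours g) * M (D.colours g)) := by
    intro S
    rw [stateSum, Finset.mul_sum]
    refine Finset.sum_subset_zero_on_sdiff (Finset.subset_univ _) (fun g hg => ?_) (fun g hg => ?_)
    · have : ¬ Finset.univ.image g ⊆ S := fun h => by
        refine (Finset.mem_sdiff.1 hg).2 (Fintype.mem_piFinset.2 fun a => h ?_)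
        exact Finset.mem_image_of_mem _ (Finset.mem_univ _)
      rw [if_neg this, Int.cast_zero, zero_mul]
    · have : Finset.univ.image g ⊆ S := fun y hy => by
        obtain ⟨a, -, rfl⟩ := Finset.mem_image.1 hy
        exact Fintype.mem_piFinset.1 hg a
      rw [if_pos this]
      push_cast
      rfl
  simp only [surjSum, h1]
  rw [Finset.sum_comm, Finset.sum_filter]
  refine Finset.sum_congr rfl fun g _ => ?_
  rw [← Finset.sum_mul, ← Int.cast_sum, sum_neg_one_pow_card_of_subset]
  have e : Finset.univ.image g = Finset.univ ↔ Function.Surjective g := by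
    rw [Finset.eq_univ_iff_forall]
    exact forall_congr' fun y => by simp
  simp only [e]
  split_ifs <;> simp

/-- The weight system on the space of three-loop diagrams: being an alternating sum of `gl` weight
systems it respects AS and IHX, while it counts only labellings by all of the four labels. -/
noncomputable def weightMap :
    Space (loopDiagrams 3) allSites →ₗ[ℚ] MvPolynomial (Fin 4) ℚ :=
  Submodule.liftQ _ (Finsupp.linearCombination ℚ fun D : loopDiagrams 3 => surjSum D.1 1) <| by
    have hn : ∀ (a b : MvPolynomial (Fin 4) ℚ), a = - b → a + b = 0 := fun a b h => by
      rw [h, neg_add_cancel]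
    rw [Submodule.span_le]
    rintro r (⟨D, D', φ, h1, h2⟩ | ⟨D, D', h, h1, h2⟩ | ⟨I, H, X', h, h1, -, h2, h3⟩)
    · simp only [SetLike.mem_coe, LinearMap.mem_ker, map_sub, Finsupp.linearCombination_single,
        one_smul, sub_eq_zero, surjSum]
      exact Finset.sum_congr rfl fun S _ => by rw [stateSum_iso S X ⟨h1, h2⟩]
    · simp only [SetLike.mem_coe, LinearMap.mem_ker, map_add, Finsupp.linearCombination_single,
        one_smul, surjSum]
      rw [h2, add_comm]
      refine hn _ _ ?_
      rw [← Finset.sum_neg_distrib]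
      exact Finset.sum_congr rfl fun S _ => by rw [stateSum_flip S X h1, mul_neg]
    · simp only [SetLike.mem_coe, LinearMap.mem_ker, map_sub, Finsupp.linearCombination_single,
        one_smul, sub_eq_zero, surjSum]
      rw [h2, h3, ← Finset.sum_sub_distrib]
      exact Finset.sum_congr rfl fun S _ => by rw [stateSum_ihx S X h1, mul_sub]

theorem weightMap_cls (hD : D.IsLoop 3) :
    weightMap (cls (loopDiagrams 3) allSites D) = surjSum D 1 := by
  have : cls (loopDiagrams 3) allSites D = toSpace _ _ ⟨D, hD⟩ :=
    (toSpace_eq_cls (⟨D, hD⟩ : loopDiagrams 3)).symm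
  rw [this]
  refine (Submodule.liftQ_apply _ _ _).trans ?_
  rw [Finsupp.linearCombination_single, one_smul]

theorem surjSum_withLegs (L : List (Fin B.card)) : surjSum (B.withLegs L) 1 =
    surjSum B fun c => (L.map fun b => X (c b).2 - X (c b).1).prod := by
  refine Finset.sum_congr rfl fun S _ => ?_
  have := stateSum_withLegs S X L fun _ => (1 : MvPolynomial (Fin 4) ℚ)
  simp only [mul_one] at this
  rw [← this]
  rfl

/-! ### The weight system on the tetrahedron -/

/-- The face of the planar tetrahedron on a fixed side of a half-edge, named after the opposite
vertex. -/
def face : Fin tetrahedron.card → Fin 4 := (![2, 3, 1, 3, 0, 2, 1, 3, 0, 2, 0, 1] : Fin 12 → Fin 4)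

/-- The rotation of the tetrahedron. -/
def tetRot : Fin 12 → Fin 12 := tetrahedron.rot

/-- The edges of the tetrahedron. -/
def tetEdge : Fin 12 → Fin 12 := tetrahedron.edge

/-- The next half-edge at a vertex, in the planar (`true`) cyclic order or in the opposite one. The
planar cyclic order differs from the one of `tetrahedron` at the odd vertices. -/
def planarRot (j : Bool) (z : Fin 12) : Fin 12 :=
  if j = (![true, true, true, false, false, false, true, true, true, false, false, false] :
    Fin 12 → Bool) z then tetRot z else tetRot (tetRot z)

/-- The vertex of a half-edge. -/
def tetVertex (z : Fin 12) : Fin 4 := ![0, 0, 0, 1, 1, 1, 2, 2, 2, 3, 3, 3] z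

/-- The next half-edge around a face, when the cyclic orders at the vertices are given by `ε`. -/
def faceStep (ε : Fin 4 → Bool) (z : Fin 12) : Fin 12 :=
  planarRot (ε (tetVertex (tetEdge z))) (tetEdge z)

/-- Unless all or none of the vertices have their planar cyclic order, every half-edge lies on the
face of `0` or on the face of some `a`. -/
theorem faceStep_iterate_mixed : ∀ ε : Fin 4 → Bool, ε ≠ (fun _ => true) → ε ≠ (fun _ => false) →
    ∃ a, ∀ z, ∃ k : Fin 12, (faceStep ε)^[k] z = 0 ∨ (faceStep ε)^[k] z = a := by
  decide +kernel

/-- The labelling `g` is constant along the faces for the cyclic orders given by `ε`. -/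
def IsFaceLabelling (ε : Fin 4 → Bool) (g : Fin 12 → Fin 4) : Prop :=
  ∀ z : Fin 12, g (tetEdge z) = g (planarRot (ε (tetVertex z)) z)

theorem IsFaceLabelling.iterate {ε g} (h : IsFaceLabelling ε g) (k : ℕ) (z) :
    g ((faceStep ε)^[k] z) = g z := by
  induction k generalizing z with
  | zero => rfl
  | succ k ih =>
    rw [Function.iterate_succ_apply, ih]
    have := h (tetEdge z)
    rw [faceStep, ← this]
    exact congrArg g (tetrahedron.edge_edge z)

/-- If the cyclic orders are not those of a planar tetrahedron, then there are only two faces. -/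
theorem IsFaceLabelling.not_surjective {ε g} (h : IsFaceLabelling ε g) (h1 : ε ≠ fun _ => true)
    (h2 : ε ≠ fun _ => false) : ¬ Function.Surjective g := by
  obtain ⟨a, ha⟩ := faceStep_iterate_mixed ε h1 h2
  intro hs
  have h3 : ∀ y, y = g 0 ∨ y = g a := fun y => by
    obtain ⟨z, rfl⟩ := hs y
    obtain ⟨k, hk | hk⟩ := ha z
    · exact .inl (by rw [← hk, h.iterate])
    · exact .inr (by rw [← hk, h.iterate])
  have h4 : ∀ a b : Fin 4, ∃ y, ¬ (y = a ∨ y = b) := by decide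
  obtain ⟨y, hy⟩ := h4 (g 0) (g a)
  exact hy (h3 y)

open Classical in
/-- A structure constant is the signed sum over the two cyclic orders of a vertex, each of which asks
for the labels on both sides of every corner to agree. -/
theorem glTensor_colours {R κ : Type*} [CommRing R] [DecidableEq κ] (g : Fin D.card → κ)
    (x y z : Fin D.card) :
    glTensor R (D.colours g x) (D.colours g y) (D.colours g z) =
      (if (g (D.edge x) = g y ∧ g (D.edge y) = g z) ∧ g (D.edge z) = g x then 1 else 0) -
      if (g (D.edge x) = g z ∧ g (D.edge y) = g x) ∧ g (D.edge z) = g y then 1 else 0 := by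
  have hd : ∀ p q p' q' p'' q'' : κ, delta R p q * delta R p' q' * delta R p'' q'' =
      if (p = q ∧ p' = q') ∧ p'' = q'' then 1 else 0 := by
    intro p q p' q' p'' q''
    unfold delta
    split_ifs <;> simp_all
  rw [glTensor, mul_right_comm (delta R (D.colours g x).2 (D.colours g z).1), hd, hd]
  rfl

theorem vertexWeight_of_ne {α κ R : Type*} [DecidableEq α] [DecidableEq κ] [CommRing R] (t : κ → R)
    {r : Equiv.Perm α} (c : α → κ × κ) {x : α} (h : r x ≠ x) :
    vertexWeight t r c x = glTensor R (c x) (c (r x)) (c (r (r x))) :=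
  if_neg h

/-- A half-edge at each vertex of the tetrahedron. -/
def tetBase : Fin 4 → Fin 12 := ![0, 3, 6, 9]

theorem tetBase_injective : Function.Injective tetBase := by decide

/-- The labelling `g` is constant along the faces at the vertex `v`, for the planar or the opposite
cyclic order. -/
def IsFaceLabellingAt (g : Fin 12 → Fin 4) (j : Bool) (v : Fin 4) : Prop :=
  (g (tetEdge (tetBase v)) = g (planarRot j (tetBase v)) ∧
    g (tetEdge (tetRot (tetBase v))) =
      g (planarRot j (tetRot (tetBase v)))) ∧
    g (tetEdge (tetRot (tetRot (tetBase v)))) =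
      g (planarRot j (tetRot (tetRot (tetBase v))))

theorem forall_isFaceLabellingAt {g : Fin 12 → Fin 4} (ε : Fin 4 → Bool) :
    (∀ v, IsFaceLabellingAt g (ε v) v) ↔ IsFaceLabelling ε g := by
  have h1 : ∀ z : Fin 12, z = tetBase (tetVertex z) ∨
      z = tetRot (tetBase (tetVertex z)) ∨
      z = tetRot (tetRot (tetBase (tetVertex z))) := by decide
  have h2 : ∀ v, tetVertex (tetBase v) = v ∧ tetVertex (tetRot (tetBase v)) = v ∧
      tetVertex (tetRot (tetRot (tetBase v))) = v := by decide
  constructor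
  · intro h z
    have h3 := h (tetVertex z)
    generalize hv : tetVertex z = v at h3
    rcases h1 z with h4 | h4 | h4 <;> rw [h4, hv]
    exacts [h3.1.1, h3.1.2, h3.2]
  · intro h v
    have h3 := h (tetBase v)
    have h4 := h (tetRot (tetBase v))
    have h5 := h (tetRot (tetRot (tetBase v)))
    rw [(h2 v).1] at h3
    rw [(h2 v).2.1] at h4
    rw [(h2 v).2.2] at h5
    exact ⟨⟨h3, h4⟩, h5⟩

theorem isTransversal_tetBase :
    IsTransversal tetrahedron.rot (Finset.univ.map ⟨tetBase, tetBase_injective⟩) := by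
  have h : ∀ x : Fin 12, ∃ v, (tetBase v = x ∨ tetBase v = tetRot x ∨
      tetBase v = tetRot (tetRot x)) ∧ ∀ w, (tetBase w = x ∨
      tetBase w = tetRot x ∨ tetBase w = tetRot (tetRot x)) →
        w = v := by decide
  intro x
  obtain ⟨v, h1, h2⟩ := h x
  refine ⟨tetBase v, ⟨Finset.mem_map_of_mem _ (Finset.mem_univ v), sameCycle_rot_iff.2 h1⟩, ?_⟩
  rintro y ⟨hy, hy'⟩
  obtain ⟨w, -, rfl⟩ := Finset.mem_map.1 hy
  exact congrArg tetBase (h2 w (sameCycle_rot_iff.1 hy'))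

theorem planarRot_true_tetBase : ∀ v, (planarRot true (tetBase v) = (if v = 1 ∨ v = 3 then
      tetRot (tetRot (tetBase v)) else tetRot (tetBase v)) ∧
    planarRot true (tetRot (tetBase v)) = (if v = 1 ∨ v = 3 then
      tetBase v else tetRot (tetRot (tetBase v)))) ∧
    planarRot true (tetRot (tetRot (tetBase v))) = (if v = 1 ∨ v = 3 then
      tetRot (tetBase v) else tetBase v) := by decide

theorem planarRot_false_tetBase : ∀ v, (planarRot false (tetBase v) = (if v = 1 ∨ v = 3 then
        tetRot (tetBase v) else tetRot (tetRot (tetBase v))) ∧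
      planarRot false (tetRot (tetBase v)) = (if v = 1 ∨ v = 3 then
        tetRot (tetRot (tetBase v)) else tetBase v)) ∧
      planarRot false (tetRot (tetRot (tetBase v))) = (if v = 1 ∨ v = 3 then
        tetBase v else tetRot (tetBase v)) := by decide

open Classical in
/-- The weight of a vertex as a signed sum over its cyclic orders. The sign is reversed at the odd
vertices, where the cyclic order of `tetrahedron` is not the planar one. -/
theorem vertexWeight_tetBase (g : Fin 12 → Fin 4) (v : Fin 4) :
    vertexWeight (R := MvPolynomial (Fin 4) ℚ) X tetrahedron.rot (tetrahedron.colours g)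
      (tetBase v) = (if v = 1 ∨ v = 3 then -1 else 1) *
        ∑ j : Bool, (if j then 1 else -1) * if IsFaceLabellingAt g j v then 1 else 0 := by
  have hu : ¬ tetrahedron.rot (tetBase v) = tetBase v := not_isUnivalent_tetrahedron _
  have e1 := glTensor_colours (R := MvPolynomial (Fin 4) ℚ) (D := tetrahedron) g (tetBase v)
    (tetRot (tetBase v)) (tetRot (tetRot (tetBase v)))
  refine (vertexWeight_of_ne _ _ hu).trans (e1.trans ?_)
  rw [Fintype.sum_bool]
  unfold IsFaceLabellingAt
  rw [(planarRot_true_tetBase v).1.1, (planarRot_true_tetBase v).1.2,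
    (planarRot_true_tetBase v).2, (planarRot_false_tetBase v).1.1, (planarRot_false_tetBase v).1.2,
    (planarRot_false_tetBase v).2]
  unfold tetEdge
  by_cases hv : v = 1 ∨ v = 3
  · simp only [if_pos hv, if_true, Bool.false_eq_true, if_false]
    split_ifs <;> ring
  · simp only [if_neg hv, if_true, Bool.false_eq_true, if_false]
    split_ifs <;> ring

open Classical in
/-- The weight of a labelling of the tetrahedron by all of the four labels detects the labellings of
the faces of the planar tetrahedron: all other cyclic orders leave too few faces. -/
theorem weightProd_tetrahedron {g : Fin 12 → Fin 4} (hg : Function.Surjective g) :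
    weightProd (R := MvPolynomial (Fin 4) ℚ) X tetrahedron.rot (tetrahedron.colours g) =
      (if IsFaceLabelling (fun _ => true) g then 1 else 0) +
        if IsFaceLabelling (fun _ => false) g then 1 else 0 := by
  rw [weightProd_eq X tetrahedron.rot_cube isTransversal_tetBase, Finset.prod_map]
  have h2 : ∀ ε : Fin 4 → Bool, (∏ v, (if ε v then (1 : MvPolynomial (Fin 4) ℚ) else -1) *
      if IsFaceLabellingAt g (ε v) v then 1 else 0) =
      (∏ v, if ε v then (1 : MvPolynomial (Fin 4) ℚ) else -1) *
        if IsFaceLabelling ε g then 1 else 0 := by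
    intro ε
    rw [Finset.prod_mul_distrib, ← forall_isFaceLabellingAt]
    congr 1
    rw [Finset.prod_ite_zero]
    simp
  -- expand the product over the vertices into a sum over the choices `ε` of cyclic orders
  refine (Finset.prod_congr rfl fun v _ => vertexWeight_tetBase g v).trans ?_
  rw [Finset.prod_mul_distrib, Finset.prod_univ_sum, Fintype.piFinset_univ, Fin.prod_univ_four,
    Fintype.sum_eq_add (fun _ => true) (fun _ => false) (fun h => by simpa using congrFun h 0)]
  · rw [h2, h2]
    simp [Finset.card_univ, show ((-1 : MvPolynomial (Fin 4) ℚ)) ^ 4 = 1 by norm_num]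
  · intro ε hε
    rw [h2, if_neg fun h => h.not_surjective hε.1 hε.2 hg, mul_zero]

end JacobiDiagram

namespace JacobiDiagram

open MvPolynomial

theorem isFaceLabelling_face : IsFaceLabelling (fun _ => true) face := by
  have : ∀ z : Fin 12, face (tetEdge z) = face (planarRot true z) := by decide
  exact this

theorem isFaceLabelling_face_edge : IsFaceLabelling (fun _ => false) (face ∘ tetEdge) := by
  have : ∀ z : Fin 12, face (tetEdge (tetEdge z)) = face (tetEdge (planarRot false z)) := by decide
  exact this

/-- The labellings of the faces by all of the four labels are the permutations of `f`, if `f` numbers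
the faces and `rep` chooses a half-edge on each of them. -/
theorem sum_isFaceLabelling {A : Type*} [AddCommMonoid A] {f : Fin 12 → Fin 4} {ε : Fin 4 → Bool}
    (hf : IsFaceLabelling ε f) (rep : Fin 4 → Fin 12) (h1 : ∀ i, f (rep i) = i)
    (h2 : ∀ z, ∃ k : Fin 3, (faceStep ε)^[k] z = rep (f z)) (M : (Fin 12 → Fin 4) → A) :
    (by classical exact ∑ g : Fin 12 → Fin 4 with Function.Surjective g,
      if IsFaceLabelling ε g then M g else 0) = ∑ σ : Equiv.Perm (Fin 4), M (σ ∘ f) := by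
  classical
  rw [← Finset.sum_filter]
  have key : ∀ g, IsFaceLabelling ε g → g = (g ∘ rep) ∘ f := by
    intro g hg
    funext z
    obtain ⟨k, hk⟩ := h2 z
    rw [Function.comp_apply, Function.comp_apply, ← hk, hg.iterate]
  symm
  refine Finset.sum_bij (fun (σ : Equiv.Perm (Fin 4)) _ => σ ∘ f) (fun σ _ => ?_)
    (fun σ _ τ _ h => ?_) (fun g hg => ?_) (fun _ _ => rfl)
  · simp only [Finset.mem_filter, Finset.mem_univ, true_and]
    refine ⟨fun y => ⟨rep (σ.symm y), by simp [h1]⟩, fun z => ?_⟩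
    exact congrArg σ (hf z)
  · ext1 i
    have := congrFun h (rep i)
    rwa [Function.comp_apply, Function.comp_apply, h1] at this
  · simp only [Finset.mem_filter, Finset.mem_univ, true_and] at hg
    have h3 := key g hg.2
    have h4 : Function.Surjective (g ∘ rep) := fun y => by
      obtain ⟨z, rfl⟩ := hg.1 y
      exact ⟨f z, (congrFun h3 z).symm⟩
    exact ⟨Equiv.ofBijective _ (Finite.injective_iff_bijective.1
      (Finite.injective_iff_surjective.2 h4)), Finset.mem_univ _, h3.symm⟩

/-- The two terms belong to the two orientations of the sphere, which interchange the two sides of an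
edge. -/
theorem surjSum_tetrahedron
    (M : (Fin tetrahedron.card → Fin 4 × Fin 4) → MvPolynomial (Fin 4) ℚ) :
    surjSum tetrahedron M =
      ∑ σ : Equiv.Perm (Fin 4), M (tetrahedron.colours (σ ∘ face)) +
      ∑ σ : Equiv.Perm (Fin 4), M (tetrahedron.colours (σ ∘ (face ∘ tetEdge))) := by
  classical
  have r1 : ∀ i, face ((![4, 2, 0, 1] : Fin 4 → Fin 12) i) = i := by decide
  have r2 : ∀ i, (face ∘ tetEdge) ((![7, 9, 3, 6] : Fin 4 → Fin 12) i) = i := by decide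
  have k1 : ∀ z, ∃ k : Fin 3, (faceStep fun _ => true)^[k] z =
      (![4, 2, 0, 1] : Fin 4 → Fin 12) (face z) := by decide +kernel
  have k2 : ∀ z, ∃ k : Fin 3, (faceStep fun _ => false)^[k] z =
      (![7, 9, 3, 6] : Fin 4 → Fin 12) ((face ∘ tetEdge) z) := by decide +kernel
  have s1 := sum_isFaceLabelling isFaceLabelling_face _ r1 k1
    fun g => M (tetrahedron.colours g)
  have s2 := sum_isFaceLabelling isFaceLabelling_face_edge _ r2 k2
    fun g => M (tetrahedron.colours g)
  rw [surjSum_eq]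
  refine Eq.trans ?_ (congrArg₂ (· + ·) s1 s2)
  rw [← Finset.sum_add_distrib]
  refine Finset.sum_bij (fun g _ => g) (fun g hg => ?_) (fun _ _ _ _ h => h)
    (fun g hg => ⟨g, ?_, rfl⟩) (fun g hg => ?_)
  · exact Finset.mem_filter.2 ⟨Finset.mem_univ _, (Finset.mem_filter.1 hg).2⟩
  · exact Finset.mem_filter.2 ⟨Finset.mem_univ _, (Finset.mem_filter.1 hg).2⟩
  · refine (congrArg (· * M (tetrahedron.colours g))
      (weightProd_tetrahedron (Finset.mem_filter.1 hg).2)).trans ?_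
    beta_reduce
    rw [add_mul, ite_mul, ite_mul, one_mul, zero_mul]

/-- The factor by which a leg on the edge of `b` contributes to the weight of a tetrahedron. -/
noncomputable def edgeVar (b : Fin tetrahedron.card) : MvPolynomial (Fin 4) ℚ :=
  X (face (tetrahedron.edge b)) - X (face b)

/-- The weight of a tetrahedron with legs. The second orientation of the sphere changes the sign of
the contribution of every leg. -/
theorem weightMap_withLegs (L : List (Fin tetrahedron.card)) :
    weightMap (cls (loopDiagrams 3) allSites (tetrahedron.withLegs L)) =
      (1 + (-1) ^ L.length) * ∑ σ : Equiv.Perm (Fin 4), rename σ (L.map edgeVar).prod := by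
  rw [weightMap_cls (isGood_loopDiagrams.withLegs_mem isLoop_tetrahedron L), surjSum_withLegs,
    surjSum_tetrahedron, add_mul, one_mul, Finset.mul_sum]
  refine congrArg₂ _ (Finset.sum_congr rfl fun σ _ => ?_) (Finset.sum_congr rfl fun σ _ => ?_)
  · rw [map_list_prod, List.map_map]
    refine congrArg List.prod (List.map_congr_left fun b _ => ?_)
    simp [edgeVar, colours]
  · rw [map_list_prod, List.map_map, ← List.length_map (f := rename σ ∘ edgeVar) (as := L),
      ← List.prod_map_neg, List.map_map]
    refine congrArg List.prod (List.map_congr_left fun b _ => ?_)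
    have e : tetEdge (tetrahedron.edge b) = b := tetrahedron.edge_edge b
    simp only [colours, Function.comp_apply, edgeVar, neg_sub, map_sub, rename_X]
    change X (σ (face (tetEdge (tetrahedron.edge b)))) - X (σ (face (tetrahedron.edge b))) = _
    rw [e]

end JacobiDiagram

namespace JacobiDiagram

open MvPolynomial

variable {P : Set JacobiDiagram} {site : (D : JacobiDiagram) → Fin D.card → Prop}

/-! ### Polynomials in the faces of the tetrahedron -/

/-- The sum of `f` over the half-edges whose opposite half-edges lie at the face `i`. -/
def faceSum {A : Type*} [AddCommGroup A] (f : Fin tetrahedron.card → A) (i : Fin 4) : A :=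
  let f' : Fin 12 → A := f
  (![f' 7 + f' 11 + f' 5, f' 9 + f' 8 + f' 1, f' 3 + f' 10 + f' 2, f' 6 + f' 4 + f' 0] :
    Fin 4 → A) i

/-- A flow on the tetrahedron is determined by its sums around the faces. -/
theorem IsFlow.faceSum_sub {A : Type*} [CommRing A] {f : Fin tetrahedron.card → A}
    (hf : IsFlow tetrahedron f) (b) :
    faceSum f (face (tetrahedron.edge b)) - faceSum f (face b) = 4 * f b := by
  let f' : Fin 12 → A := f
  have e : ∀ x : Fin 12, f' (tetEdge x) = - f' x := hf.edge
  have v : ∀ x : Fin 12, f' x + f' (tetRot x) + f' (tetRot (tetRot x)) = 0 := fun x =>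
    hf.vertex x (not_isUnivalent_tetrahedron x)
  have e0 : f' 3 = - f' 0 := e 0
  have e1 : f' 6 = - f' 1 := e 1
  have e2 : f' 9 = - f' 2 := e 2
  have e4 : f' 7 = - f' 4 := e 4
  have e5 : f' 10 = - f' 5 := e 5
  have e8 : f' 11 = - f' 8 := e 8
  have v0 : f' 0 + f' 1 + f' 2 = 0 := v 0
  have v3 : f' 3 + f' 4 + f' 5 = 0 := v 3
  have v6 : f' 6 + f' 7 + f' 8 = 0 := v 6
  have h2 : f' 2 = - f' 0 - f' 1 := by linear_combination v0
  have h5 : f' 5 = f' 0 - f' 4 := by linear_combination v3 - e0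
  have h8 : f' 8 = f' 1 + f' 4 := by linear_combination v6 - e1 - e4
  rw [h2] at e2
  rw [h5] at e5
  rw [h8] at e8
  have key : ∀ b : Fin 12, faceSum f (face (tetEdge b)) - faceSum f (face b) = 4 * f' b := by
    have s0 : faceSum f 0 = f' 7 + f' 11 + f' 5 := rfl
    have s1 : faceSum f 1 = f' 9 + f' 8 + f' 1 := rfl
    have s2 : faceSum f 2 = f' 3 + f' 10 + f' 2 := rfl
    have s3 : faceSum f 3 = f' 6 + f' 4 + f' 0 := rfl
    rw [e4, e8, h5] at s0
    rw [e2, h8] at s1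
    rw [e0, e5, h2] at s2
    rw [e1] at s3
    intro b
    fin_cases b
    · change faceSum f 3 - faceSum f 2 = 4 * f' 0
      rw [s3, s2]; ring
    · change faceSum f 1 - faceSum f 3 = 4 * f' 1
      rw [s1, s3]; ring
    · change faceSum f 2 - faceSum f 1 = 4 * f' 2
      rw [s2, s1, h2]; ring
    · change faceSum f 2 - faceSum f 3 = 4 * f' 3
      rw [s2, s3, e0]; ring
    · change faceSum f 3 - faceSum f 0 = 4 * f' 4
      rw [s3, s0]; ring
    · change faceSum f 0 - faceSum f 2 = 4 * f' 5
      rw [s0, s2, h5]; ring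
    · change faceSum f 3 - faceSum f 1 = 4 * f' 6
      rw [s3, s1, e1]; ring
    · change faceSum f 0 - faceSum f 3 = 4 * f' 7
      rw [s0, s3, e4]; ring
    · change faceSum f 1 - faceSum f 0 = 4 * f' 8
      rw [s1, s0, h8]; ring
    · change faceSum f 1 - faceSum f 2 = 4 * f' 9
      rw [s1, s2, e2]; ring
    · change faceSum f 2 - faceSum f 0 = 4 * f' 10
      rw [s2, s0, e5]; ring
    · change faceSum f 0 - faceSum f 1 = 4 * f' 11
      rw [s0, s1, e8]; ring
  exact key b

theorem IsFlow.sum_faceSum {A : Type*} [CommRing A] {f : Fin tetrahedron.card → A}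
    (hf : IsFlow tetrahedron f) : ∑ i, faceSum f i = 0 := by
  let f' : Fin 12 → A := f
  have e : ∀ x : Fin 12, f' (tetEdge x) = - f' x := hf.edge
  have e0 : f' 3 = - f' 0 := e 0
  have e1 : f' 6 = - f' 1 := e 1
  have e2 : f' 9 = - f' 2 := e 2
  have e4 : f' 7 = - f' 4 := e 4
  have e5 : f' 10 = - f' 5 := e 5
  have e8 : f' 11 = - f' 8 := e 8
  rw [Fin.sum_univ_four]
  change f' 7 + f' 11 + f' 5 + (f' 9 + f' 8 + f' 1) + (f' 3 + f' 10 + f' 2) +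
    (f' 6 + f' 4 + f' 0) = 0
  rw [e0, e1, e2, e4, e5, e8]
  ring

theorem map_faceSum {A A' : Type*} [CommRing A] [CommRing A'] (φ : A →+* A')
    (f : Fin tetrahedron.card → A) (i) : φ (faceSum f i) = faceSum (fun b => φ (f b)) i := by
  fin_cases i <;> simp [faceSum]

theorem faceSum_neg {A : Type*} [CommRing A] (f : Fin tetrahedron.card → A) (i) :
    faceSum (fun b => - f b) i = - faceSum f i := by
  fin_cases i <;> simp [faceSum] <;> ring

/-- The variables of the half-edges as differences of the variables of the faces. -/
noncomputable def edgeHom : MvPolynomial (Fin tetrahedron.card) ℚ →ₐ[ℚ] MvPolynomial (Fin 4) ℚ :=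
  aeval edgeVar

/-- A face is replaced by one quarter of the sum of the half-edges around it. -/
noncomputable def faceHom : MvPolynomial (Fin 4) ℚ →ₐ[ℚ] MvPolynomial (Fin tetrahedron.card) ℚ :=
  aeval fun i => C (1 / 4) * faceSum X i

/-- The algebra endomorphism that changes the signs of the variables. -/
noncomputable def negHom (σ : Type*) : MvPolynomial σ ℚ →ₐ[ℚ] MvPolynomial σ ℚ :=
  aeval fun i => - X i

section

variable {σ τ : Type*}

@[simp] theorem negHom_X (i : σ) : negHom σ (X i) = - X i := aeval_X _ _

theorem negHom_rename (f : σ → τ) (p) : negHom τ (rename f p) = rename f (negHom σ p) := by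
  have : (negHom τ).comp (rename f) = (rename f).comp (negHom σ) := by
    apply algHom_ext; intro i; simp
  exact DFunLike.congr_fun this p

theorem negHom_prod_X (L : List σ) :
    negHom σ (L.map X).prod = (-1) ^ L.length * (L.map X).prod := by
  rw [map_list_prod, List.map_map, ← List.length_map (f := (X : σ → MvPolynomial σ ℚ)) (as := L),
    ← List.prod_map_neg, List.map_map]
  refine congrArg List.prod (List.map_congr_left fun b _ => ?_)
  simp

theorem coeff_negHom (m : σ →₀ ℕ) (p : MvPolynomial σ ℚ) :
    coeff m (negHom σ p) = (-1) ^ m.degree * coeff m p := by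
  classical
  induction p using MvPolynomial.induction_on' with
  | monomial u a =>
    have : negHom σ (monomial u a) = C ((-1) ^ u.degree) * monomial u a := by
      rw [negHom, aeval_monomial, monomial_eq, Finsupp.prod, Finsupp.prod,
        Finset.prod_congr rfl fun i _ => neg_pow (X i : MvPolynomial σ ℚ) (u i),
        Finset.prod_mul_distrib, Finset.prod_pow_eq_pow_sum, Finsupp.degree]
      simp only [algebraMap_eq, map_pow, map_neg, map_one]
      exact mul_left_comm _ _ _
    rw [this, coeff_C_mul, coeff_monomial]
    split_ifs with h
    · rw [h]
    · rw [mul_zero, mul_zero]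
  | add p q hp hq => rw [map_add, coeff_add, coeff_add, hp, hq, mul_add]

theorem negHom_eq_self_iff {p : MvPolynomial σ ℚ} :
    negHom σ p = p ↔ ∀ m ∈ p.support, Even m.degree := by
  constructor
  · intro h m hm
    by_contra ho
    have h1 := coeff_negHom m p
    rw [h, (Nat.not_even_iff_odd.1 ho).neg_one_pow] at h1
    exact mem_support_iff.1 hm (by linarith)
  · intro h
    ext m
    rw [coeff_negHom]
    by_cases hm : m ∈ p.support
    · rw [(h m hm).neg_one_pow, one_mul]
    · rw [notMem_support_iff.1 hm, mul_zero]

end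

theorem negHom_edgeHom (p) : negHom _ (edgeHom p) = edgeHom (negHom _ p) := by
  have : (negHom _).comp edgeHom = edgeHom.comp (negHom _) := by
    apply algHom_ext; intro i; simp [edgeHom, edgeVar, neg_add_eq_sub]
  exact DFunLike.congr_fun this p

theorem negHom_faceHom (p) : negHom _ (faceHom p) = faceHom (negHom _ p) := by
  have : (negHom _).comp faceHom = faceHom.comp (negHom _) := by
    apply algHom_ext; intro i
    have h : negHom _ (faceSum X i) = - faceSum X i := by
      refine (map_faceSum (negHom (Fin tetrahedron.card)).toRingHom X i).trans ?_
      rw [← faceSum_neg]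
      exact congrArg (faceSum · i) (funext fun b => negHom_X b)
    have h' : ∀ q : ℚ, negHom (Fin tetrahedron.card) (C q) = C q := fun q =>
      (negHom (Fin tetrahedron.card)).commutes q
    simp [faceHom, h, h']
  exact DFunLike.congr_fun this p

/-- Passing from the faces to the half-edges and back subtracts the mean of the variables. -/
theorem edgeHom_faceHom_X (i : Fin 4) : edgeHom (faceHom (X i)) = X i - C (1 / 4) * ∑ j, X j := by
  have h : edgeHom (faceSum X i) = 4 * X i - ∑ j, X j := by
    refine (map_faceSum edgeHom.toRingHom X i).trans ?_
    have h0 : ∀ b, edgeHom (X b) = edgeVar b := fun b => aeval_X _ _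
    simp only [AlgHom.toRingHom_eq_coe, RingHom.coe_coe, h0]
    let g : Fin 12 → MvPolynomial (Fin 4) ℚ := fun b => X (face (tetEdge b)) - X (face b)
    rw [Fin.sum_univ_four]
    fin_cases i
    · change (X 0 - X 3) + (X 0 - X 1) + (X 0 - X 2) =
        4 * X 0 - (X 0 + X 1 + X 2 + X 3)
      ring
    · change (X 1 - X 2) + (X 1 - X 0) + (X 1 - X 3) =
        4 * X 1 - (X 0 + X 1 + X 2 + X 3)
      ring
    · change (X 2 - X 3) + (X 2 - X 0) + (X 2 - X 1) =
        4 * X 2 - (X 0 + X 1 + X 2 + X 3)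
      ring
    · change (X 3 - X 1) + (X 3 - X 0) + (X 3 - X 2) =
        4 * X 3 - (X 0 + X 1 + X 2 + X 3)
      ring
  have h' : ∀ q : ℚ, edgeHom (C q) = C q := fun q => edgeHom.commutes q
  rw [faceHom, aeval_X, map_mul, h', h, mul_sub]
  have h4 : (C (1 / 4) * (4 * X i) : MvPolynomial (Fin 4) ℚ) = X i := by
    rw [← mul_assoc, show (4 : MvPolynomial (Fin 4) ℚ) = C 4 from (map_ofNat C 4).symm, ← C_mul]
    norm_num
  rw [h4]

end JacobiDiagram

namespace JacobiDiagram

open MvPolynomial FaceAlgebra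

variable {P : Set JacobiDiagram} {site : (D : JacobiDiagram) → Fin D.card → Prop}

/-! ### Symmetries of the tetrahedron -/

theorem mk_faceHom_X (i : Fin 4) :
    Ideal.Quotient.mk (legIdeal P site tetrahedron) (faceHom (X i)) =
      Ideal.Quotient.mk _ (C (1 / 4)) *
        faceSum (fun b => Ideal.Quotient.mk (legIdeal P site tetrahedron) (X b)) i := by
  rw [faceHom, aeval_X, map_mul]
  exact congrArg _ (map_faceSum (Ideal.Quotient.mk _) X i)

theorem C_quarter_mul_four {σ : Type*} : (C (1 / 4) * 4 : MvPolynomial σ ℚ) = 1 := by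
  rw [show (4 : MvPolynomial σ ℚ) = C 4 from (map_ofNat C 4).symm, ← C_mul]
  norm_num

/-- Legs on the edges of the tetrahedron can be expressed through its faces. -/
theorem legMap_faceHom_edgeHom (hP : IsGood P site) (ht : tetrahedron ∈ P) (p) :
    legMap P site tetrahedron (faceHom (edgeHom p)) = legMap P site tetrahedron p := by
  refine legMap_eq_of_sub_mem (Ideal.Quotient.eq.1 ?_)
  have key : ((Ideal.Quotient.mkₐ ℚ (legIdeal P site tetrahedron)).comp
      (faceHom.comp edgeHom)) = Ideal.Quotient.mkₐ ℚ (legIdeal P site tetrahedron) := by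
    apply algHom_ext
    intro b
    have h := (isFlow_mk_X hP ht).faceSum_sub b
    have e : edgeHom (X b) = X (face (tetrahedron.edge b)) - X (face b) := aeval_X _ _
    change Ideal.Quotient.mk (legIdeal P site tetrahedron) (faceHom (edgeHom (X b))) =
      Ideal.Quotient.mk (legIdeal P site tetrahedron) (X b)
    rw [e, map_sub, map_sub, mk_faceHom_X, mk_faceHom_X, ← mul_sub]
    refine (congrArg _ h).trans ?_
    rw [← mul_assoc, ← map_ofNat (Ideal.Quotient.mk (legIdeal P site tetrahedron)) 4, ← map_mul,
      C_quarter_mul_four, map_one, one_mul]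
  exact DFunLike.congr_fun key p

/-- The linear map sending a polynomial in the faces of the tetrahedron to the combination of
tetrahedra with legs obtained by replacing each face by one quarter of the half-edges around it. -/
noncomputable def faceMap (P : Set JacobiDiagram)
    (site : (D : JacobiDiagram) → Fin D.card → Prop) : MvPolynomial (Fin 4) ℚ →ₗ[ℚ] Space P site :=
  legMap P site tetrahedron ∘ₗ faceHom.toLinearMap

theorem faceMap_edgeHom (hP : IsGood P site) (ht : tetrahedron ∈ P) (p) :
    faceMap P site (edgeHom p) = legMap P site tetrahedron p :=
  legMap_faceHom_edgeHom hP ht p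

/-- The sum of the variables of the faces acts by zero, as every edge occurs in both directions. -/
theorem faceMap_eq_of_proj_eq (hP : IsGood P site) (ht : tetrahedron ∈ P) {p q}
    (h : proj p = proj q) : faceMap P site p = faceMap P site q := by
  refine legMap_eq_of_sub_mem (?_ : faceHom p - faceHom q ∈ _)
  rw [← map_sub]
  obtain ⟨r, hr⟩ := Ideal.mem_span_singleton.1 (Ideal.Quotient.eq.1 h)
  rw [hr, map_mul]
  refine Ideal.mul_mem_right _ _ (Ideal.Quotient.eq_zero_iff_mem.1 ?_)
  rw [map_sum, map_sum, Finset.sum_congr rfl fun i _ => mk_faceHom_X i, ← Finset.mul_sum]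
  exact (congrArg _ (isFlow_mk_X hP ht).sum_faceSum).trans (mul_zero _)

/-- If a symmetry `φ` of the half-edges induces the permutation `σ` of the faces, but reverses the
direction in which they are traversed, then `faceMap` is invariant under `σ` up to the signs of the
variables. -/
theorem faceMap_rename_of_symmetry (hP : IsGood P site) (ht : tetrahedron ∈ P)
    (σ : Equiv.Perm (Fin 4)) (φ : Fin tetrahedron.card → Fin tetrahedron.card)
    (hφ : ∀ p, legMap P site tetrahedron (rename φ p) = legMap P site tetrahedron p)
    (h : ∀ {f : Fin tetrahedron.card → MvPolynomial _ ℚ ⧸ legIdeal P site tetrahedron},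
      IsFlow tetrahedron f → ∀ i, faceSum f (σ i) = - faceSum (f ∘ φ) i) (p) :
    faceMap P site (rename σ p) = faceMap P site (negHom _ p) := by
  refine Eq.trans ?_ (hφ (faceHom (negHom _ p)))
  refine legMap_eq_of_sub_mem (Ideal.Quotient.eq.1 ?_)
  have key : ((Ideal.Quotient.mkₐ ℚ (legIdeal P site tetrahedron)).comp
      (faceHom.comp (rename σ))) = (Ideal.Quotient.mkₐ ℚ (legIdeal P site tetrahedron)).comp
      ((rename φ).comp (faceHom.comp (negHom _))) := by
    apply algHom_ext
    intro i
    change Ideal.Quotient.mk (legIdeal P site tetrahedron) (faceHom (rename σ (X i))) =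
      Ideal.Quotient.mk (legIdeal P site tetrahedron) (rename φ (faceHom (negHom _ (X i))))
    have e : rename φ (faceHom (X i)) = C (1 / 4) * faceSum (fun b => X (φ b)) i := by
      rw [faceHom, aeval_X, map_mul, rename_C]
      have e0 : rename φ (faceSum X i) = faceSum (fun b => rename φ (X b)) i :=
        map_faceSum (rename (R := ℚ) φ).toRingHom X i
      simp only [e0, rename_X]
    rw [rename_X, negHom_X, map_neg, map_neg, map_neg, e, mk_faceHom_X, map_mul]
    have h1 := map_faceSum (Ideal.Quotient.mk (legIdeal P site tetrahedron)) (fun b => X (φ b)) i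
    have h2 : faceSum (fun b => Ideal.Quotient.mk (legIdeal P site tetrahedron) (X b)) (σ i) =
        - faceSum (fun b => Ideal.Quotient.mk (legIdeal P site tetrahedron) (X (φ b))) i :=
      h (isFlow_mk_X hP ht) i
    rw [h1, h2]
    exact mul_neg (Ideal.Quotient.mk (legIdeal P site tetrahedron) _) _
  exact DFunLike.congr_fun key p

/-- The symmetry of the half-edges that induces the cyclic permutation of the faces. -/
def tetCycle : Equiv.Perm (Fin 12) :=
  ⟨![4, 5, 3, 7, 8, 6, 10, 11, 9, 0, 1, 2], ![9, 10, 11, 2, 0, 1, 5, 3, 4, 8, 6, 7],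
    by decide, by decide⟩

/-- The symmetry of the half-edges that induces the transposition of the faces `0` and `1`. It
reverses the cyclic order at two of the vertices. -/
def tetSwap : Equiv.Perm (Fin 12) :=
  ⟨![3, 4, 5, 0, 1, 2, 7, 6, 8, 10, 9, 11], ![3, 4, 5, 0, 1, 2, 7, 6, 8, 10, 9, 11],
    by decide, by decide⟩

/-- `tetCycle`, acting on the half-edges of `tetrahedron`. -/
def cycleEquiv : Equiv.Perm (Fin tetrahedron.card) := tetCycle

/-- `tetSwap`, acting on the half-edges of `tetrahedron`. -/
def swapEquiv : Equiv.Perm (Fin tetrahedron.card) := tetSwap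

theorem isIso_cycleEquiv : IsIso tetrahedron tetrahedron cycleEquiv := by
  have h1 : ∀ x, tetCycle (tetRot x) = tetRot (tetCycle x) := by decide
  have h2 : ∀ x, tetCycle (tetEdge x) = tetEdge (tetCycle x) := by decide
  exact ⟨h1, h2⟩

theorem isIso_swapEquiv :
    IsIso ((tetrahedron.flip (6 : Fin 12)).flip (9 : Fin 12)) tetrahedron swapEquiv := by
  have h1 : ∀ x : Fin 12, tetSwap (((tetrahedron.flip (6 : Fin 12)).flip (9 : Fin 12)).rot x) =
    tetRot (tetSwap x) := by decide
  have h2 : ∀ x, tetSwap (tetEdge x) = tetEdge (tetSwap x) := by decide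
  exact ⟨h1, h2⟩

/-- The two reversed vertices contribute cancelling signs. -/
theorem legMap_rename_swapEquiv (hP : IsGood P site) (p) :
    legMap P site tetrahedron (rename swapEquiv p) = legMap P site tetrahedron p := by
  have h1 := legMap_rename hP isIso_swapEquiv (rename ((tetrahedron.flip (6 : Fin 12)).flipEquiv
    (9 : Fin 12)) (rename (tetrahedron.flipEquiv (6 : Fin 12)) p))
  have h9 : ¬ (tetrahedron.flip (6 : Fin 12)).IsUnivalent (9 : Fin 12) := fun h =>
    (by decide : (10 : Fin 12) ≠ 9) h
  have h2 := legMap_flip hP h9 (rename (tetrahedron.flipEquiv (6 : Fin 12)) p)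
  have h3 := legMap_flip hP (not_isUnivalent_tetrahedron (6 : Fin 12)) p
  rw [h3, neg_neg] at h2
  refine Eq.trans (congrArg _ ?_) (h1.trans h2)
  refine Eq.trans ?_ (congrArg (rename swapEquiv) (rename_rename _ _ _).symm)
  exact congrArg (rename swapEquiv) (rename_id_apply p).symm

theorem IsFlow.faceSum_finRotate {A : Type*} [CommRing A] {f : Fin tetrahedron.card → A}
    (hf : IsFlow tetrahedron f) (i) :
    faceSum f (finRotate 4 i) = - faceSum (f ∘ cycleEquiv) i := by
  let f' : Fin 12 → A := f
  have e : ∀ x y : Fin 12, tetEdge x = y → f' y = - f' x := fun x y h =>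
    (congrArg f' h).symm.trans (hf.edge x)
  fin_cases i
  · change f' 9 + f' 8 + f' 1 = - (f' 11 + f' 2 + f' 6)
    linear_combination e 11 8 rfl + e 2 9 rfl + e 6 1 rfl
  · change f' 3 + f' 10 + f' 2 = - (f' 0 + f' 9 + f' 5)
    linear_combination e 0 3 rfl + e 9 2 rfl + e 5 10 rfl
  · change f' 6 + f' 4 + f' 0 = - (f' 7 + f' 1 + f' 3)
    linear_combination e 7 4 rfl + e 1 6 rfl + e 3 0 rfl
  · change f' 7 + f' 11 + f' 5 = - (f' 10 + f' 8 + f' 4)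
    linear_combination e 10 5 rfl + e 8 11 rfl + e 4 7 rfl

theorem IsFlow.faceSum_swap {A : Type*} [CommRing A] {f : Fin tetrahedron.card → A}
    (hf : IsFlow tetrahedron f) (i) :
    faceSum f (Equiv.swap (0 : Fin 4) 1 i) = - faceSum (f ∘ swapEquiv) i := by
  let f' : Fin 12 → A := f
  have e : ∀ x y : Fin 12, tetEdge x = y → f' y = - f' x := fun x y h =>
    (congrArg f' h).symm.trans (hf.edge x)
  fin_cases i
  · change f' 9 + f' 8 + f' 1 = - (f' 6 + f' 11 + f' 2)
    linear_combination e 6 1 rfl + e 11 8 rfl + e 2 9 rfl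
  · change f' 7 + f' 11 + f' 5 = - (f' 10 + f' 8 + f' 4)
    linear_combination e 10 5 rfl + e 8 11 rfl + e 4 7 rfl
  · change f' 3 + f' 10 + f' 2 = - (f' 0 + f' 9 + f' 5)
    linear_combination e 0 3 rfl + e 9 2 rfl + e 5 10 rfl
  · change f' 6 + f' 4 + f' 0 = - (f' 7 + f' 1 + f' 3)
    linear_combination e 7 4 rfl + e 1 6 rfl + e 3 0 rfl

/-- On even polynomials `faceMap` is invariant under all permutations of the faces. -/
theorem faceMap_rename (hP : IsGood P site) (ht : tetrahedron ∈ P) (σ : Equiv.Perm (Fin 4)) :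
    ∀ p : MvPolynomial (Fin 4) ℚ, negHom _ p = p →
      faceMap P site (rename σ p) = faceMap P site p := by
  have hc : Subgroup.closure ({finRotate 4, Equiv.swap 0 (finRotate 4 0)} :
      Set (Equiv.Perm (Fin 4))) = ⊤ :=
    Equiv.Perm.closure_cycle_adjacent_swap isCycle_finRotate support_finRotate _
  have hσ : σ ∈ Subgroup.closure ({finRotate 4, Equiv.swap 0 (finRotate 4 0)} :
      Set (Equiv.Perm (Fin 4))) := hc ▸ Subgroup.mem_top σ
  have hr : ∀ (τ : Equiv.Perm (Fin 4)) (p : MvPolynomial (Fin 4) ℚ), negHom _ p = p →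
      negHom _ (rename τ p) = rename τ p := fun τ p hp => by rw [negHom_rename, hp]
  induction hσ using Subgroup.closure_induction with
  | mem τ hτ =>
    intro p hp
    rcases hτ with rfl | rfl
    · rw [faceMap_rename_of_symmetry hP ht _ cycleEquiv (legMap_rename hP isIso_cycleEquiv)
        IsFlow.faceSum_finRotate, hp]
    · refine (faceMap_rename_of_symmetry hP ht (Equiv.swap 0 1) swapEquiv
        (legMap_rename_swapEquiv hP) IsFlow.faceSum_swap p).trans ?_
      rw [hp]
  | one => intro p _; simp
  | mul a b _ _ ha hb =>
    intro p hp
    have : rename (⇑(a * b)) p = rename a (rename b p) := by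
      rw [rename_rename]; rfl
    rw [this, ha _ (hr b p hp), hb p hp]
  | inv a _ ha =>
    intro p hp
    rw [← ha _ (hr a⁻¹ p hp), rename_rename]
    have : ⇑a ∘ ⇑a⁻¹ = id := by ext1 x; simp
    rw [this, rename_id_apply]

end JacobiDiagram

namespace JacobiDiagram

open MvPolynomial FaceAlgebra

variable {P : Set JacobiDiagram} {site : (D : JacobiDiagram) → Fin D.card → Prop}

/-! ### Even symmetric polynomials in the faces -/

theorem IsHomogeneous.aeval_one {σ τ : Type*} {p : MvPolynomial σ ℚ} {n : ℕ}
    (hp : p.IsHomogeneous n) {f : σ → MvPolynomial τ ℚ} (hf : ∀ i, (f i).IsHomogeneous 1) :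
    (aeval f p).IsHomogeneous n := by
  simpa using hp.aeval f hf

theorem isHomogeneous_edgeHom {p : MvPolynomial (Fin tetrahedron.card) ℚ} {n : ℕ}
    (hp : p.IsHomogeneous n) : (edgeHom p).IsHomogeneous n :=
  IsHomogeneous.aeval_one hp fun _ => (isHomogeneous_X _ _).sub (isHomogeneous_X _ _)

theorem isHomogeneous_faceHom {p : MvPolynomial (Fin 4) ℚ} {n : ℕ}
    (hp : p.IsHomogeneous n) : (faceHom p).IsHomogeneous n := by
  refine IsHomogeneous.aeval_one hp fun i => ?_
  have h : (faceSum X i : MvPolynomial (Fin tetrahedron.card) ℚ).IsHomogeneous 1 := by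
    fin_cases i <;>
      exact ((isHomogeneous_X _ _).add (isHomogeneous_X _ _)).add (isHomogeneous_X _ _)
  simpa using (isHomogeneous_C _ (1 / 4 : ℚ)).mul h

theorem isHomogeneous_negHom {σ : Type*} {p : MvPolynomial σ ℚ} {n : ℕ}
    (hp : p.IsHomogeneous n) : (negHom σ p).IsHomogeneous n :=
  IsHomogeneous.aeval_one hp fun _ => (isHomogeneous_X _ _).neg

theorem isHomogeneous_prod_X {σ : Type*} (L : List σ) :
    ((L.map X).prod : MvPolynomial σ ℚ).IsHomogeneous L.length := by
  induction L with
  | nil => exact isHomogeneous_one _ _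
  | cons i L ih =>
    rw [List.map_cons, List.prod_cons, List.length_cons, add_comm]
    exact (isHomogeneous_X _ i).mul ih

/-- The symmetric polynomials which do not change when the signs of the variables change. -/
noncomputable def evenSymmetric : Submodule ℚ (MvPolynomial (Fin 4) ℚ) where
  carrier := {p | p.IsSymmetric ∧ negHom _ p = p}
  add_mem' hp hq := ⟨hp.1.add hq.1, by rw [map_add, hp.2, hq.2]⟩
  zero_mem' := ⟨IsSymmetric.zero, map_zero _⟩
  smul_mem' c p hp := ⟨hp.1.smul c, by rw [map_smul, hp.2]⟩

/-- An even polynomial may be replaced by its average over the permutations of the faces. -/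
theorem exists_mem_evenSymmetric (hP : IsGood P site) (ht : tetrahedron ∈ P)
    {p : MvPolynomial (Fin 4) ℚ} (hp : negHom _ p = p) :
    ∃ q ∈ evenSymmetric, faceMap P site q = faceMap P site p := by
  refine ⟨(1 / 24 : ℚ) • ∑ σ : Equiv.Perm (Fin 4), rename σ p,
    evenSymmetric.smul_mem _ ⟨fun τ => ?_, ?_⟩, ?_⟩
  · rw [map_sum]
    refine Fintype.sum_equiv (Equiv.mulLeft τ) _ _ fun σ => ?_
    rw [rename_rename]; rfl
  · rw [map_sum]
    exact Finset.sum_congr rfl fun σ _ => by rw [negHom_rename, hp]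
  · rw [map_smul, map_sum, Finset.sum_congr rfl fun σ _ => faceMap_rename hP ht σ p hp,
      Finset.sum_const, Finset.card_univ, Fintype.card_perm, Fintype.card_fin,
      ← Nat.cast_smul_eq_nsmul ℚ, smul_smul]
    norm_num [Nat.factorial]

/-- The image of a polynomial is a combination of tetrahedra whose numbers of legs are degrees of its
monomials. -/
theorem legMap_mem_of_support (hP : IsGood P site) {S : Submodule ℚ (Space P site)}
    {p : MvPolynomial (Fin tetrahedron.card) ℚ}
    (h : ∀ L : List (Fin tetrahedron.card), (∃ m ∈ p.support, m.degree = L.length) →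
      cls P site (tetrahedron.withLegs L) ∈ S) : legMap P site tetrahedron p ∈ S := by
  classical
  rw [p.as_sum, map_sum]
  refine Submodule.sum_mem _ fun m hm => ?_
  have h1 : monomial m (coeff m p) = coeff m p •
      (((Finsupp.toMultiset m).toList.map X).prod : MvPolynomial _ ℚ) := by
    rw [prod_map_X, Multiset.coe_toList, Finsupp.toMultiset_toFinsupp, smul_monomial]
    simp
  rw [h1, map_smul, legMap_prod hP]
  refine S.smul_mem _ (h _ ⟨m, hm, ?_⟩)
  rw [Multiset.length_toList, Finsupp.card_toMultiset, Finsupp.degree_eq_sum]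
  simp [Finsupp.sum_fintype]

theorem numLegs_tetrahedron_withLegs (L : List (Fin tetrahedron.card)) :
    (tetrahedron.withLegs L).numLegs = L.length := by
  rw [numLegs_withLegs, numLegs_of_not_isUnivalent not_isUnivalent_tetrahedron, zero_add]

section

variable (hP : IsGood P site) (ht : tetrahedron ∈ P)
  (hC : ∀ {S : ℕ → Submodule ℚ (Space P site)}, (∀ L : List (Fin tetrahedron.card),
    cls P site (tetrahedron.withLegs L) ∈ S L.length) → ∀ D ∈ P, cls P site D ∈ S D.numLegs)
include hP ht hC

/-- If the space is spanned by tetrahedra with legs, its even part is spanned by the even symmetric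
polynomials in the faces. -/
theorem evenPart_eq : evenPart P site = evenSymmetric.map (faceMap P site) := by
  classical
  refine le_antisymm (Submodule.span_le.2 ?_) ?_
  · rintro _ ⟨D, hD, rfl⟩
    rw [toSpace_eq_cls]
    have h1 := hC (S := fun n => if Even n then evenSymmetric.map (faceMap P site) else ⊤)
      (fun L => ?_) D.1 D.2
    -- the submodules are irrelevant for an odd number of legs
    · beta_reduce at h1
      rwa [if_pos ((hP.isLoop D.2).even_degree_iff.1 hD)] at h1
    · split_ifs with h
      · obtain ⟨q, hq, h2⟩ := exists_mem_evenSymmetric (p := edgeHom (L.map X).prod) hP ht (by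
          rw [negHom_edgeHom, negHom_prod_X, h.neg_one_pow, one_mul])
        refine ⟨q, hq, h2.trans ?_⟩
        rw [faceMap_edgeHom hP ht, legMap_prod hP]
      · trivial
  · rintro _ ⟨q, hq, rfl⟩
    refine legMap_mem_of_support hP fun L ⟨m, hm, hL⟩ => ?_
    have hq' : negHom _ (faceHom q) = faceHom q := by rw [negHom_faceHom, hq.2]
    have hm' := negHom_eq_self_iff.1 hq' m hm
    have hw := hP.withLegs_mem ht L
    refine Submodule.subset_span ⟨⟨_, hw⟩, ?_, toSpace_eq_cls _⟩
    rw [(hP.isLoop hw).even_degree_iff, numLegs_tetrahedron_withLegs, ← hL]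
    exact hm'

theorem legPart_eq (n : ℕ) :
    legPart P site n = (homogeneousSubmodule (Fin 4) ℚ n).map (faceMap P site) := by
  refine le_antisymm (Submodule.span_le.2 ?_) ?_
  · rintro _ ⟨D, rfl, rfl⟩
    rw [toSpace_eq_cls]
    refine hC (S := fun n => (homogeneousSubmodule (Fin 4) ℚ n).map (faceMap P site))
      (fun L => ?_) D.1 D.2
    refine ⟨edgeHom (L.map X).prod, isHomogeneous_edgeHom (isHomogeneous_prod_X L), ?_⟩
    rw [faceMap_edgeHom hP ht, legMap_prod hP]
  · rintro _ ⟨q, hq, rfl⟩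
    refine legMap_mem_of_support hP fun L ⟨m, hm, hL⟩ => ?_
    refine Submodule.subset_span ⟨⟨_, hP.withLegs_mem ht L⟩, ?_, toSpace_eq_cls _⟩
    refine (numLegs_tetrahedron_withLegs L).trans (hL.symm.trans ?_)
    have := isHomogeneous_faceHom hq (mem_support_iff.1 hm)
    rw [Finsupp.degree_eq_weight_one]
    exact this

end

end JacobiDiagram

namespace JacobiDiagram

open MvPolynomial FaceAlgebra

variable {P : Set JacobiDiagram} {site : (D : JacobiDiagram) → Fin D.card → Prop}

/-! ### The comparison with the face algebra -/

/-- The map induced by the inclusion of tetrahedral diagrams in all three-loop diagrams. -/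
noncomputable def inclusion (Γ : JacobiDiagram) :
    Space (internalDiagrams 3 Γ) IsLegSite →ₗ[ℚ] Space (loopDiagrams 3) allSites :=
  Submodule.liftQ _ (Finsupp.linearCombination ℚ fun D : internalDiagrams 3 Γ =>
    cls (loopDiagrams 3) allSites D.1) <| by
    have hg := isGood_loopDiagrams
    rw [Submodule.span_le]
    rintro r (⟨D, D', φ, h1, h2⟩ | ⟨D, D', h, h1, h2⟩ | ⟨I, H, X', h, h1, -, h2, h3⟩)
    · simp only [SetLike.mem_coe, LinearMap.mem_ker, map_sub, Finsupp.linearCombination_single,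
        one_smul, sub_eq_zero]
      exact (hg.cls_eq_of_iso h1 h2).symm
    · simp only [SetLike.mem_coe, LinearMap.mem_ker, map_add, Finsupp.linearCombination_single,
        one_smul]
      rw [h2, hg.cls_flip h1, add_neg_cancel]
    · simp only [SetLike.mem_coe, LinearMap.mem_ker, map_sub, Finsupp.linearCombination_single,
        one_smul, sub_eq_zero]
      rw [h2, h3]
      exact IsGood.cls_ihx h1 trivial I.2.1 (h2 ▸ H.2.1) (h3 ▸ X'.2.1)

theorem inclusion_cls {Γ D : JacobiDiagram} (hD : D ∈ internalDiagrams 3 Γ) :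
    inclusion Γ (cls (internalDiagrams 3 Γ) IsLegSite D) = cls (loopDiagrams 3) allSites D := by
  rw [cls, dif_pos hD]
  refine (Submodule.liftQ_apply _ _ _).trans ?_
  rw [Finsupp.linearCombination_single, one_smul]

theorem inclusion_legMap (p) :
    inclusion tetrahedron (legMap (internalDiagrams 3 tetrahedron) IsLegSite tetrahedron p) =
      legMap (loopDiagrams 3) allSites tetrahedron p := by
  have : inclusion tetrahedron ∘ₗ legMap (internalDiagrams 3 tetrahedron) IsLegSite tetrahedron =
      legMap (loopDiagrams 3) allSites tetrahedron := by
    have hg := isGood_internalDiagrams tetrahedron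
    refine linearMap_ext_prod_X fun L => ?_
    rw [LinearMap.comp_apply, legMap_prod hg, legMap_prod isGood_loopDiagrams,
      inclusion_cls (hg.withLegs_mem tetrahedron_mem L)]
  exact LinearMap.congr_fun this p

/-- The weights of all tetrahedra with legs at once. -/
theorem weightMap_legMap (p) :
    weightMap (legMap (loopDiagrams 3) allSites tetrahedron p) =
      ∑ σ : Equiv.Perm (Fin 4), rename σ (edgeHom (p + negHom _ p)) := by
  have : weightMap ∘ₗ legMap (loopDiagrams 3) allSites tetrahedron =
      ∑ σ : Equiv.Perm (Fin 4), ((rename σ).toLinearMap ∘ₗ edgeHom.toLinearMap ∘ₗ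
        (LinearMap.id + (negHom (Fin tetrahedron.card)).toLinearMap)) := by
    refine linearMap_ext_prod_X fun L => ?_
    rw [LinearMap.comp_apply, legMap_prod isGood_loopDiagrams, weightMap_withLegs,
      LinearMap.sum_apply, Finset.mul_sum]
    refine Finset.sum_congr rfl fun σ _ => ?_
    simp only [LinearMap.comp_apply, LinearMap.add_apply, LinearMap.id_apply,
      AlgHom.toLinearMap_apply]
    have e : edgeHom (L.map X).prod = (L.map edgeVar).prod := by
      rw [map_list_prod, List.map_map]
      exact congrArg List.prod (List.map_congr_left fun b _ => aeval_X _ _)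
    rw [negHom_prod_X, map_add, map_mul, e, map_add, map_mul, map_pow, map_pow, map_neg, map_neg,
      map_one, map_one, add_mul, one_mul]
  have h := LinearMap.congr_fun this p
  rw [LinearMap.comp_apply, LinearMap.sum_apply] at h
  exact h

/-- The weight system with values in the face algebra, normalized to be the identity on even
symmetric polynomials in the faces of the tetrahedron. -/
noncomputable def faceWeight : Space (loopDiagrams 3) allSites →ₗ[ℚ] FaceRing :=
  (1 / 48 : ℚ) • proj.toLinearMap ∘ₗ weightMap

theorem proj_sum_X : proj (∑ i, X i) = 0 :=
  Ideal.Quotient.eq_zero_iff_mem.2 (Ideal.subset_span rfl)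

theorem proj_edgeHom_faceHom (p) : proj (edgeHom (faceHom p)) = proj p := by
  have : proj.comp (edgeHom.comp faceHom) = proj := by
    apply algHom_ext
    intro i
    change proj (edgeHom (faceHom (X i))) = proj (X i)
    rw [edgeHom_faceHom_X, map_sub, map_mul, proj_sum_X, mul_zero, sub_zero]
  exact DFunLike.congr_fun this p

theorem rename_edgeHom_faceHom (σ : Equiv.Perm (Fin 4)) (p) :
    rename σ (edgeHom (faceHom p)) = edgeHom (faceHom (rename σ p)) := by
  have : (rename σ).comp (edgeHom.comp faceHom) = (edgeHom.comp faceHom).comp (rename σ) := by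
    apply algHom_ext
    intro i
    change rename σ (edgeHom (faceHom (X i))) = edgeHom (faceHom (rename σ (X i)))
    rw [rename_X, edgeHom_faceHom_X, edgeHom_faceHom_X, map_sub, map_mul, rename_C, rename_X,
      map_sum]
    simp only [rename_X]
    rw [Equiv.sum_comp σ fun j => (X j : MvPolynomial (Fin 4) ℚ)]
  exact DFunLike.congr_fun this p

/-- The factor `48` is due to the `24` permutations of the faces and the two orientations of the
sphere. -/
theorem faceWeight_faceMap {q} (hq : q ∈ evenSymmetric) :
    faceWeight (faceMap (loopDiagrams 3) allSites q) = proj q := by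
  change (1 / 48 : ℚ) • proj (weightMap (legMap _ _ tetrahedron (faceHom q))) = proj q
  have h : ∀ σ : Equiv.Perm (Fin 4),
      rename σ (edgeHom (faceHom q + negHom _ (faceHom q))) = (2 : ℚ) • edgeHom (faceHom q) := by
    intro σ
    rw [negHom_faceHom, hq.2, ← two_smul ℚ, map_smul, map_smul, rename_edgeHom_faceHom, hq.1 σ]
  rw [weightMap_legMap, Finset.sum_congr rfl fun σ _ => h σ, Finset.sum_const, Finset.card_univ,
    Fintype.card_perm, Fintype.card_fin, ← Nat.cast_smul_eq_nsmul ℚ, smul_smul, map_smul, smul_smul,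
    proj_edgeHom_faceHom]
  norm_num [Nat.factorial]

theorem faceWeight_faceMap_mem {n : ℕ} {q : MvPolynomial (Fin 4) ℚ} (hq : q.IsHomogeneous n) :
    faceWeight (faceMap (loopDiagrams 3) allSites q) ∈ homogeneous n := by
  change (1 / 48 : ℚ) • proj (weightMap (legMap _ _ tetrahedron (faceHom q))) ∈ _
  refine Submodule.smul_mem _ _ ⟨_, ?_, rfl⟩
  rw [weightMap_legMap]
  refine Submodule.sum_mem _ fun σ _ => ?_
  have h := isHomogeneous_faceHom hq
  exact (isHomogeneous_edgeHom (h.add (isHomogeneous_negHom h))).rename_isHomogeneous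

section

variable (hP : IsGood P site) (ht : tetrahedron ∈ P)
  (hC : ∀ {S : ℕ → Submodule ℚ (Space P site)}, (∀ L : List (Fin tetrahedron.card),
    cls P site (tetrahedron.withLegs L) ∈ S L.length) → ∀ D ∈ P, cls P site D ∈ S D.numLegs)
  {w : Space P site →ₗ[ℚ] FaceRing} (hw : ∀ q ∈ evenSymmetric, w (faceMap P site q) = proj q)
  (hw' : ∀ n q, q.IsHomogeneous n → w (faceMap P site q) ∈ homogeneous n)
include hP ht hC hw

/-- The even part of a space of diagrams that is spanned by tetrahedra with legs consists of the
even symmetric polynomials, if it carries a weight system that detects them. -/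
theorem bijOn_evenPart : Set.BijOn w (evenPart P site) (evenSymmetric.map proj.toLinearMap) := by
  rw [evenPart_eq hP ht hC]
  refine ⟨?_, ?_, ?_⟩
  · rintro _ ⟨q, hq, rfl⟩
    exact ⟨q, hq, (hw q hq).symm⟩
  · rintro _ ⟨q, hq, rfl⟩ _ ⟨q', hq', rfl⟩ h
    rw [hw q hq, hw q' hq'] at h
    exact faceMap_eq_of_proj_eq hP ht h
  · rintro _ ⟨q, hq, rfl⟩
    exact ⟨_, ⟨q, hq, rfl⟩, hw q hq⟩

include hw' in
/-- On the even part, the number of legs corresponds to the degree in the face algebra. -/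
theorem mem_legPart_iff {a : Space P site} (ha : a ∈ evenPart P site) (n : ℕ) :
    a ∈ legPart P site n ↔ w a ∈ homogeneous n := by
  rw [legPart_eq hP ht hC]
  constructor
  · rintro ⟨q, hq, rfl⟩
    exact hw' n q hq
  · rintro ⟨q', hq', h⟩
    rw [evenPart_eq hP ht hC] at ha
    obtain ⟨q, hq, rfl⟩ := ha
    rw [hw q hq] at h
    exact ⟨q', hq', faceMap_eq_of_proj_eq hP ht h⟩

end

theorem bijOn_faceWeight : Set.BijOn faceWeight (evenPart (loopDiagrams 3) allSites)
    (evenSymmetric.map proj.toLinearMap) :=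
  bijOn_evenPart isGood_loopDiagrams isLoop_tetrahedron (fun h _ => cls_mem_of_isLoop h)
    fun _ => faceWeight_faceMap

theorem mem_legPart_loopDiagrams_iff {a : Space (loopDiagrams 3) allSites}
    (ha : a ∈ evenPart (loopDiagrams 3) allSites) (n : ℕ) :
    a ∈ legPart (loopDiagrams 3) allSites n ↔ faceWeight a ∈ homogeneous n :=
  mem_legPart_iff isGood_loopDiagrams isLoop_tetrahedron (fun h _ => cls_mem_of_isLoop h)
    (fun _ => faceWeight_faceMap) (fun _ _ => faceWeight_faceMap_mem) ha n

theorem cls_mem_of_mem_internalDiagrams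
    {S : ℕ → Submodule ℚ (Space (internalDiagrams 3 tetrahedron) IsLegSite)}
    (hS : ∀ L : List (Fin tetrahedron.card),
      cls (internalDiagrams 3 tetrahedron) IsLegSite (tetrahedron.withLegs L) ∈ S L.length)
    (D : JacobiDiagram) (hD : D ∈ internalDiagrams 3 tetrahedron) :
    cls (internalDiagrams 3 tetrahedron) IsLegSite D ∈ S D.numLegs :=
  cls_mem_of_internalDiagrams hD (isGood_internalDiagrams tetrahedron) fun L hL => hL ▸ hS L

theorem inclusion_faceMap (q) :
    inclusion tetrahedron (faceMap (internalDiagrams 3 tetrahedron) IsLegSite q) =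
      faceMap (loopDiagrams 3) allSites q :=
  inclusion_legMap _

theorem bijOn_faceWeight_inclusion : Set.BijOn (faceWeight ∘ₗ inclusion tetrahedron)
    (evenPart (internalDiagrams 3 tetrahedron) IsLegSite) (evenSymmetric.map proj.toLinearMap) :=
  bijOn_evenPart (isGood_internalDiagrams tetrahedron) tetrahedron_mem
    cls_mem_of_mem_internalDiagrams fun q hq => by
      rw [LinearMap.comp_apply, inclusion_faceMap, faceWeight_faceMap hq]

theorem mem_legPart_internalDiagrams_iff {a : Space (internalDiagrams 3 tetrahedron) IsLegSite}
    (ha : a ∈ evenPart (internalDiagrams 3 tetrahedron) IsLegSite) (n : ℕ) :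
    a ∈ legPart (internalDiagrams 3 tetrahedron) IsLegSite n ↔
      faceWeight (inclusion tetrahedron a) ∈ homogeneous n :=
  mem_legPart_iff (w := faceWeight ∘ₗ inclusion tetrahedron)
    (isGood_internalDiagrams tetrahedron) tetrahedron_mem
    cls_mem_of_mem_internalDiagrams (fun q hq => by
      rw [LinearMap.comp_apply, inclusion_faceMap, faceWeight_faceMap hq]) (fun n q hq => by
      rw [LinearMap.comp_apply, inclusion_faceMap]
      exact faceWeight_faceMap_mem hq) ha n

/-- A linear map that is a bijection between two subspaces restricts to an equivalence. -/
theorem exists_equiv_of_bijOn {V W : Type*} [AddCommGroup V] [Module ℚ V] [AddCommGroup W]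
    [Module ℚ W] (w : V →ₗ[ℚ] W) {p : Submodule ℚ V} {q : Submodule ℚ W} (h : Set.BijOn w p q) :
    ∃ e : p ≃ₗ[ℚ] q, ∀ a, (e a : W) = w a := by
  refine ⟨LinearEquiv.ofBijective (w.restrict h.mapsTo) ⟨fun a b hab => ?_, fun b => ?_⟩,
    fun a => rfl⟩
  · exact Subtype.ext (h.injOn a.2 b.2 (congrArg Subtype.val hab))
  · obtain ⟨a, ha, hab⟩ := h.surjOn b.2
    exact ⟨⟨a, ha⟩, Subtype.ext hab⟩

/-- The even parts of the spaces of tetrahedral diagrams and of all three-loop diagrams are isomorphic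
through the inclusion, as both are identified with even symmetric polynomials by the same weight
system. -/
theorem exists_evenPart_equiv :
    ∃ e : evenPart (internalDiagrams 3 tetrahedron) IsLegSite ≃ₗ[ℚ]
        evenPart (loopDiagrams 3) allSites,
      (∀ (D : internalDiagrams 3 tetrahedron) (D' : loopDiagrams 3) (hD : Even D.1.degree),
        D'.1 = D.1 →
          (e ⟨toSpace _ _ D, Submodule.subset_span ⟨D, hD, rfl⟩⟩ :
            Space (loopDiagrams 3) allSites) = toSpace _ _ D') ∧
      ∀ (n : ℕ) (a : evenPart (internalDiagrams 3 tetrahedron) IsLegSite),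
        a.1 ∈ legPart (internalDiagrams 3 tetrahedron) IsLegSite n ↔
          (e a).1 ∈ legPart (loopDiagrams 3) allSites n := by
  obtain ⟨e₁, h₁⟩ := exists_equiv_of_bijOn _ bijOn_faceWeight_inclusion
  obtain ⟨e₂, h₂⟩ := exists_equiv_of_bijOn _ bijOn_faceWeight
  have h : ∀ a, faceWeight (e₁.trans e₂.symm a).1 = faceWeight (inclusion tetrahedron a.1) := by
    intro a
    rw [← h₂, LinearEquiv.trans_apply, LinearEquiv.apply_symm_apply, h₁, LinearMap.comp_apply]
  refine ⟨e₁.trans e₂.symm, fun D D' hD hDD' => ?_, fun n a => ?_⟩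
  · have hD' : toSpace (loopDiagrams 3) allSites D' ∈ evenPart (loopDiagrams 3) allSites :=
      Submodule.subset_span ⟨D', hDD' ▸ hD, rfl⟩
    refine bijOn_faceWeight.injOn (Subtype.prop _) hD' ((h _).trans ?_)
    change faceWeight (inclusion tetrahedron (toSpace _ _ D)) = _
    rw [toSpace_eq_cls, toSpace_eq_cls, inclusion_cls D.2, hDD']
  · rw [mem_legPart_internalDiagrams_iff a.2, mem_legPart_loopDiagrams_iff (Subtype.prop _), h]

end JacobiDiagram

/-! ### Even symmetric polynomials on the hyperplane -/

namespace FaceAlgebra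

open MvPolynomial JacobiDiagram

theorem negHom_of_isHomogeneous {σ : Type*} {p : MvPolynomial σ ℚ} {n : ℕ}
    (hp : p.IsHomogeneous n) : negHom σ p = (-1) ^ n * p := by
  ext m
  have h : ((-1) ^ n * p : MvPolynomial σ ℚ) = C ((-1) ^ n) * p := by simp
  rw [h, coeff_negHom, coeff_C_mul]
  by_cases hm : coeff m p = 0
  · rw [hm, mul_zero, mul_zero]
  · have := hp hm
    rw [Finsupp.degree_eq_weight_one]
    exact congrArg (fun k => (-1) ^ k * coeff m p) this

theorem isHomogeneous_esymm (σ : Type*) [Fintype σ] (n : ℕ) : (esymm σ ℚ n).IsHomogeneous n := by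
  classical
  refine IsHomogeneous.sum _ _ _ fun t ht => ?_
  have := IsHomogeneous.prod t (fun i => (X i : MvPolynomial σ ℚ)) (fun _ => 1)
    fun i _ => isHomogeneous_X _ i
  simpa [(Finset.mem_powersetCard.1 ht).2] using this

theorem sigma_one : sigma 1 = 0 := by
  rw [sigma, esymm_one, proj_sum_X]

theorem sum_X_ne_zero : (∑ i, X i : MvPolynomial (Fin 4) ℚ) ≠ 0 := fun h => by
  have := congrArg (eval fun _ => 1) h
  simp at this

theorem aeval_esymm (f : MvPolynomial (Fin 4) ℚ) :
    ((esymmAlgHom (Fin 4) ℚ 4 f : symmetricSubalgebra (Fin 4) ℚ) : MvPolynomial (Fin 4) ℚ) =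
      aeval (fun i : Fin 4 => esymm (Fin 4) ℚ (i + 1)) f :=
  esymmAlgHom_apply f

/-- A polynomial relation among `σ₂`, `σ₃`, `σ₄` modulo `σ₁` would be a multiple of the first variable
in the polynomial ring in the four elementary symmetric polynomials. -/
theorem algebraicIndependent_sigma :
    AlgebraicIndependent ℚ ![sigma 2, sigma 3, sigma 4] := by
  rw [algebraicIndependent_iff]
  intro p hp
  set f : MvPolynomial (Fin 4) ℚ := rename Fin.succ p with hf
  set E := esymmAlgHom (Fin 4) ℚ 4 with hE
  have h1 : proj (E f : MvPolynomial (Fin 4) ℚ) = 0 := by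
    rw [aeval_esymm, hf, aeval_rename, ← AlgHom.comp_apply, comp_aeval, ← hp]
    congr 2
    ext1 i
    fin_cases i <;> rfl
  -- the cofactor of the first elementary symmetric polynomial is symmetric again
  obtain ⟨r, hr⟩ := Ideal.mem_span_singleton.1 (Ideal.Quotient.eq_zero_iff_mem.1 h1)
  have hs : r.IsSymmetric := fun τ => by
    have h2 := (E f).2 τ
    rw [hr, map_mul, map_sum] at h2
    simp only [rename_X] at h2
    rw [Equiv.sum_comp τ fun j => (X j : MvPolynomial (Fin 4) ℚ)] at h2
    exact mul_left_cancel₀ sum_X_ne_zero h2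
  obtain ⟨g, hg⟩ := esymmAlgHom_surjective (σ := Fin 4) ℚ (n := 4) (by simp) ⟨r, hs⟩
  have h3 : f = X 0 * g := by
    refine esymmAlgHom_injective (σ := Fin 4) ℚ (n := 4) (by simp) (Subtype.ext ?_)
    rw [map_mul, hg]
    refine hr.trans ?_
    have : ((E (X 0) : symmetricSubalgebra (Fin 4) ℚ) : MvPolynomial (Fin 4) ℚ) = ∑ i, X i := by
      rw [aeval_esymm, aeval_X]
      exact esymm_one _ _
    rw [← this]
    rfl
  have h4 := congrArg (aeval (Fin.cases 0 X : Fin 4 → MvPolynomial (Fin 3) ℚ)) h3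
  rw [map_mul, aeval_X, hf, aeval_rename] at h4
  have h5 : ((Fin.cases 0 X : Fin 4 → MvPolynomial (Fin 3) ℚ) ∘ Fin.succ) = X := by
    ext1 i; simp
  rw [h5, aeval_X_left_apply] at h4
  rw [h4]
  simp

theorem algebraicIndependent_sigma_sq :
    AlgebraicIndependent ℚ ![sigma 2, sigma 3 ^ 2, sigma 4] := by
  have h := algebraicIndependent_sigma.polynomial_aeval_of_transcendental
    (f := ![Polynomial.X, Polynomial.X ^ 2, Polynomial.X]) (by
      have hX := Polynomial.transcendental_X (R := ℚ)
      intro i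
      fin_cases i
      · exact hX
      · exact hX.pow two_pos
      · exact hX)
  convert h using 1
  ext1 i
  fin_cases i <;> simp

/-- A monomial in `0`, `t`, `u`, `v`, plus its image under multiplication of an element of degree `k`
by `(-1) ^ k`, where the four elements have the degrees `1`, `2`, `3`, `4`. It lies in any subalgebra
that contains `t`, `u ^ 2` and `v`. -/
theorem add_neg_mem {A : Type*} [CommRing A] [Algebra ℚ A] {S : Subalgebra ℚ A} {t u v : A}
    (ht : t ∈ S) (hu : u ^ 2 ∈ S) (hv : v ∈ S) (a b c d : ℕ) :
    0 ^ a * t ^ b * u ^ c * v ^ d + ((-1) ^ 1 * 0) ^ a * ((-1) ^ 2 * t) ^ b *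
      ((-1) ^ 3 * u) ^ c * ((-1) ^ 4 * v) ^ d ∈ S := by
  have h : ((-1) ^ 3 * u) ^ c = (-1) ^ c * u ^ c := by rw [← mul_pow]; ring
  simp only [even_two, Even.neg_pow, one_pow, one_mul, mul_zero, h,
    (by decide : Even 4)]
  obtain he | ho := Nat.even_or_odd c
  · obtain ⟨k, rfl⟩ := id he
    rw [he.neg_one_pow, one_mul]
    have hu' : u ^ (k + k) ∈ S := by
      rw [← two_mul, pow_mul]
      exact pow_mem hu k
    have := mul_mem (mul_mem (mul_mem (pow_mem (zero_mem S) a) (pow_mem ht b)) hu') (pow_mem hv d)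
    exact add_mem this this
  · rw [ho.neg_one_pow]
    convert zero_mem S using 1
    ring

/-- The even part of a symmetric polynomial, written in the elementary symmetric polynomials, involves
only even powers of the third one when the first one is zero. -/
theorem mem_sigmaAlgebra_iff (r : FaceRing) :
    r ∈ sigmaAlgebra ↔ ∃ q ∈ evenSymmetric, proj q = r := by
  have hneg : ∀ k, negHom _ (esymm (Fin 4) ℚ k) = (-1) ^ k * esymm (Fin 4) ℚ k := fun k =>
    negHom_of_isHomogeneous (isHomogeneous_esymm _ k)
  constructor
  · intro hr
    let S : Subalgebra ℚ FaceRing :=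
      (symmetricSubalgebra (Fin 4) ℚ ⊓ AlgHom.equalizer (negHom _) (AlgHom.id ℚ _)).map proj
    have h : sigmaAlgebra ≤ S := by
      refine Algebra.adjoin_le ?_
      rintro _ (rfl | rfl | rfl)
      · refine ⟨esymm (Fin 4) ℚ 2, ⟨esymm_isSymmetric _ _ _, (hneg 2).trans ?_⟩, rfl⟩
        norm_num
      · refine ⟨esymm (Fin 4) ℚ 3 ^ 2, ⟨Subalgebra.pow_mem _ (esymm_isSymmetric _ _ _) 2,
          (map_pow _ _ _).trans ?_⟩, map_pow _ _ _⟩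
        rw [hneg]
        simp only [AlgHom.id_apply]
        ring
      · refine ⟨esymm (Fin 4) ℚ 4, ⟨esymm_isSymmetric _ _ _, (hneg 4).trans ?_⟩, rfl⟩
        norm_num
    obtain ⟨q, hq, h1⟩ := h hr
    exact ⟨q, hq, h1⟩
  · rintro ⟨q, hq, rfl⟩
    -- twice the even part of a polynomial in the elementary symmetric polynomials
    have key : ∀ f : MvPolynomial (Fin 4) ℚ, proj (
        aeval (fun i : Fin 4 => esymm (Fin 4) ℚ (i + 1)) f +
        negHom _ (aeval (fun i : Fin 4 => esymm (Fin 4) ℚ (i + 1)) f)) ∈ sigmaAlgebra := by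
      intro f
      induction f using MvPolynomial.induction_on' with
      | monomial d a =>
        have h1 : aeval (fun i : Fin 4 => esymm (Fin 4) ℚ (i + 1)) (monomial d a) =
            C a * (esymm (Fin 4) ℚ 1 ^ d 0 * esymm (Fin 4) ℚ 2 ^ d 1 * esymm (Fin 4) ℚ 3 ^ d 2 *
              esymm (Fin 4) ℚ 4 ^ d 3) := by
          rw [aeval_monomial, Finsupp.prod_fintype _ _ (fun _ => pow_zero _), Fin.prod_univ_four]
          rfl
        have h2 : negHom (Fin 4) (C a) = C a := (negHom _).commutes a
        rw [h1]
        simp only [map_add, map_mul, map_pow, hneg, h2]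
        simp only [map_neg, map_one]
        change proj (C a) * (sigma 1 ^ d 0 * sigma 2 ^ d 1 * sigma 3 ^ d 2 * sigma 4 ^ d 3) +
          proj (C a) * (((-1) ^ 1 * sigma 1) ^ d 0 * ((-1) ^ 2 * sigma 2) ^ d 1 *
            ((-1) ^ 3 * sigma 3) ^ d 2 * ((-1) ^ 4 * sigma 4) ^ d 3) ∈ _
        rw [sigma_one, ← mul_add]
        exact mul_mem (sigmaAlgebra.algebraMap_mem a)
          (add_neg_mem (Algebra.subset_adjoin (by simp)) (Algebra.subset_adjoin (by simp))
            (Algebra.subset_adjoin (by simp)) _ _ _ _)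
      | add p q hp hq =>
        convert add_mem hp hq using 1
        simp only [map_add]
        ring
    obtain ⟨f, hf⟩ := esymmAlgHom_surjective (σ := Fin 4) ℚ (n := 4) (by simp) ⟨q, hq.1⟩
    have h1 := key f
    rw [← aeval_esymm, hf] at h1
    have h1 : proj (q + negHom _ q) ∈ sigmaAlgebra := h1
    rw [hq.2, map_add, ← two_smul ℚ] at h1
    have h2 := sigmaAlgebra.smul_mem h1 (1 / 2 : ℚ)
    rw [smul_smul] at h2
    norm_num at h2
    exact h2

theorem toSubmodule_sigmaAlgebra :
    Subalgebra.toSubmodule sigmaAlgebra = evenSymmetric.map proj.toLinearMap := by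
  ext r
  exact mem_sigmaAlgebra_iff r

end FaceAlgebra

/-! ### The grading of the algebra of even symmetric polynomials -/

namespace FaceAlgebra

open MvPolynomial JacobiDiagram

/-- The section of `proj` which is obtained by subtracting the mean of the variables. -/
noncomputable def centre : FaceRing →ₐ[ℚ] MvPolynomial (Fin 4) ℚ :=
  Ideal.Quotient.liftₐ _ (edgeHom.comp faceHom) fun p hp => by
    obtain ⟨r, rfl⟩ := Ideal.mem_span_singleton.1 hp
    change edgeHom (faceHom _) = 0
    rw [map_mul, map_mul, map_sum, map_sum, Finset.sum_congr rfl fun i _ => edgeHom_faceHom_X i,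
      Finset.sum_sub_distrib, Finset.sum_const, Finset.card_univ, Fintype.card_fin, ← mul_smul_comm,
      nsmul_eq_mul, ← mul_assoc]
    have : (C (1 / 4) * ((4 : ℕ) : MvPolynomial (Fin 4) ℚ)) = 1 := by
      rw [← map_natCast C, ← C_mul]
      norm_num
    rw [this, one_mul, sub_self, zero_mul]

theorem proj_centre (r) : proj (centre r) = r := by
  obtain ⟨p, rfl⟩ := Ideal.Quotient.mk_surjective r
  exact proj_edgeHom_faceHom p

theorem isHomogeneous_centre {r : FaceRing} {n : ℕ} (hr : r ∈ homogeneous n) :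
    (centre r).IsHomogeneous n := by
  obtain ⟨p, hp, rfl⟩ := hr
  exact isHomogeneous_edgeHom (isHomogeneous_faceHom hp)

theorem mem_homogeneous_iff {r : FaceRing} {n : ℕ} :
    r ∈ homogeneous n ↔ (centre r).IsHomogeneous n :=
  ⟨isHomogeneous_centre, fun h => ⟨_, h, proj_centre r⟩⟩

/-- The degrees of the generators of `sigmaAlgebra`. -/
def sigmaWeight : Fin 3 → ℕ := ![2, 6, 4]

theorem sigmaWeight_ne_zero : ∀ i, sigmaWeight i ≠ 0 := by decide

/-- The polynomials in the generators of `sigmaAlgebra`. -/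
noncomputable def sigmaHom : MvPolynomial (Fin 3) ℚ →ₐ[ℚ] FaceRing :=
  aeval ![sigma 2, sigma 3 ^ 2, sigma 4]

theorem sigmaHom_injective : Function.Injective sigmaHom :=
  algebraicIndependent_sigma_sq

theorem range_sigmaHom : sigmaHom.range = sigmaAlgebra := by
  rw [sigmaHom, ← Algebra.adjoin_range_eq_range_aeval, sigmaAlgebra]
  congr 1
  ext r
  simp
  tauto

theorem isHomogeneous_centre_sigmaHom_monomial (d : Fin 3 →₀ ℕ) (a : ℚ) :
    (centre (sigmaHom (monomial d a))).IsHomogeneous (Finsupp.weight sigmaWeight d) := by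
  have hs : ∀ k, (centre (sigma k)).IsHomogeneous k := fun k =>
    isHomogeneous_centre ⟨_, isHomogeneous_esymm _ k, rfl⟩
  have h : ∀ i, (centre (![sigma 2, sigma 3 ^ 2, sigma 4] i)).IsHomogeneous (sigmaWeight i) := by
    intro i
    fin_cases i
    · exact hs 2
    · have := (hs 3).pow 2
      rw [← map_pow] at this
      exact this
    · exact hs 4
  rw [sigmaHom, aeval_monomial, Finsupp.prod_fintype _ _ (fun _ => pow_zero _), map_mul,
    map_prod, AlgHom.commutes, Finsupp.weight_apply, Finsupp.sum_fintype _ _ (by simp)]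
  refine IsHomogeneous.C_mul (IsHomogeneous.prod _ _ _ fun i _ => ?_) a
  rw [map_pow, smul_eq_mul, mul_comm]
  exact (h i).pow _

/-- As `centre` embeds the face algebra into a polynomial ring compatibly with degrees, homogeneous
components can be compared there. -/
theorem homogeneousComponent_centre_sigmaHom (n : ℕ) (p) :
    homogeneousComponent n (centre (sigmaHom p)) =
      centre (sigmaHom (weightedHomogeneousComponent sigmaWeight n p)) := by
  classical
  induction p using MvPolynomial.induction_on' with
  | monomial d a =>
    rw [homogeneousComponent_of_mem (isHomogeneous_centre_sigmaHom_monomial d a),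
      weightedHomogeneousComponent_of_mem
        (isWeightedHomogeneous_monomial sigmaWeight d a rfl)]
    split_ifs
    · rfl
    · rw [map_zero, map_zero]
  | add p q hp hq => simp only [map_add, hp, hq]

theorem sigmaHom_mem_homogeneous_iff {n : ℕ} {p} :
    sigmaHom p ∈ homogeneous n ↔ p ∈ weightedHomogeneousSubmodule ℚ sigmaWeight n := by
  have hc : Function.Injective centre := Function.LeftInverse.injective proj_centre
  rw [mem_homogeneous_iff]
  constructor
  · intro h
    have h1 := homogeneousComponent_centre_sigmaHom n p
    rw [homogeneousComponent_eq_self h] at h1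
    rw [sigmaHom_injective (hc h1)]
    exact weightedHomogeneousComponent_mem _ _ _
  · intro h
    have h1 := homogeneousComponent_centre_sigmaHom n p
    rw [weightedHomogeneousComponent_of_mem h, if_pos rfl] at h1
    rw [← h1]
    exact homogeneousComponent_isHomogeneous _ _

theorem bijOn_sigmaHom (n : ℕ) : Set.BijOn sigmaHom
    (weightedHomogeneousSubmodule ℚ sigmaWeight n)
    (Subalgebra.toSubmodule sigmaAlgebra ⊓ homogeneous n : Submodule ℚ FaceRing) := by
  refine ⟨fun p hp => ⟨?_, sigmaHom_mem_homogeneous_iff.2 hp⟩, sigmaHom_injective.injOn, ?_⟩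
  · exact range_sigmaHom ▸ ⟨p, rfl⟩
  · rintro r ⟨h1, h2⟩
    obtain ⟨p, rfl⟩ := range_sigmaHom.symm ▸ h1
    exact ⟨p, sigmaHom_mem_homogeneous_iff.1 h2, rfl⟩

theorem finite_weightedHomogeneousSubmodule (n : ℕ) :
    Module.Finite ℚ (weightedHomogeneousSubmodule ℚ sigmaWeight n) :=
  Module.Finite.iff_fg.2 (weightedHomogeneousSubmodule_fg ℚ _ sigmaWeight_ne_zero n)

theorem finrank_weightedHomogeneousSubmodule {σ : Type*} (w : σ → ℕ) (n : ℕ) :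
    Module.finrank ℚ (weightedHomogeneousSubmodule ℚ w n) =
      Nat.card {d : σ →₀ ℕ // Finsupp.weight w d = n} := by
  rw [weightedHomogeneousSubmodule_eq_finsupp_supported]
  exact Module.finrank_eq_nat_card_basis
    (basisRestrictSupport ℚ {d | Finsupp.weight w d = n})

/-- The even part of the three-loop space with `n` legs has as many dimensions as there are monomials
of degree `n` in the generators of `sigmaAlgebra`. -/
theorem exists_evenPart_inf_legPart_equiv (n : ℕ) :
    Nonempty (weightedHomogeneousSubmodule ℚ sigmaWeight n ≃ₗ[ℚ]
      (evenPart (loopDiagrams 3) allSites ⊓ legPart (loopDiagrams 3) allSites n :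
        Submodule ℚ (Space (loopDiagrams 3) allSites))) := by
  have h : Set.BijOn faceWeight
      (evenPart (loopDiagrams 3) allSites ⊓ legPart (loopDiagrams 3) allSites n :
        Submodule ℚ (Space (loopDiagrams 3) allSites))
      (Subalgebra.toSubmodule sigmaAlgebra ⊓ homogeneous n : Submodule ℚ FaceRing) := by
    rw [toSubmodule_sigmaAlgebra]
    have h0 := bijOn_faceWeight
    refine ⟨fun a ha => ⟨h0.mapsTo ha.1, (mem_legPart_loopDiagrams_iff ha.1 n).1 ha.2⟩,
      h0.injOn.mono fun a ha => ha.1, ?_⟩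
    rintro r ⟨h1, h2⟩
    obtain ⟨a, ha, rfl⟩ := h0.surjOn h1
    exact ⟨a, ⟨ha, (mem_legPart_loopDiagrams_iff ha n).2 h2⟩, rfl⟩
  obtain ⟨e, -⟩ := exists_equiv_of_bijOn _ h
  obtain ⟨e', -⟩ := exists_equiv_of_bijOn sigmaHom.toLinearMap (bijOn_sigmaHom n)
  exact ⟨e'.trans e.symm⟩

end FaceAlgebra

/-! ### The generating function -/

namespace FaceAlgebra

open PowerSeries

/-- The geometric series in `X ^ k`. -/
def geometricSeries (k : ℕ) : PowerSeries ℚ := PowerSeries.mk fun n => if k ∣ n then 1 else 0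

theorem geometricSeries_mul {k : ℕ} (hk : k ≠ 0) : geometricSeries k * (1 - X ^ k) = 1 := by
  ext n
  rw [mul_sub, mul_one, map_sub, coeff_mul_X_pow', geometricSeries, coeff_mk, coeff_mk, coeff_one]
  by_cases hn : n = 0
  · subst hn; simp [hk]
  · rw [if_neg hn]
    by_cases h : k ≤ n
    · have h' : k ∣ n - k ↔ k ∣ n :=
        ⟨fun h' => by simpa [Nat.sub_add_cancel h] using dvd_add h' (dvd_refl k),
          fun h' => Nat.dvd_sub h' dvd_rfl⟩
      simp [h, h']
    · rw [if_neg h, if_neg fun h' => h (Nat.le_of_dvd (Nat.pos_of_ne_zero hn) h'), sub_zero]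

/-- The monomials of weight `n` are counted by a product of geometric series. -/
theorem coeff_prod_geometricSeries {ι : Type*} [Fintype ι] {w : ι → ℕ} (hw : ∀ i, w i ≠ 0)
    (n : ℕ) : coeff n (∏ i, geometricSeries (w i)) =
      (Nat.card {d : ι →₀ ℕ // Finsupp.weight w d = n} : ℚ) := by
  classical
  rw [coeff_prod]
  have h1 : ∀ l : ι →₀ ℕ, (∏ i, coeff (l i) (geometricSeries (w i)) : ℚ) =
      if ∀ i, w i ∣ l i then 1 else 0 := fun l => by
    simp only [geometricSeries, coeff_mk, Finset.prod_ite_zero, Finset.mem_univ, true_imp_iff,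
      Finset.prod_const_one]
  rw [Finset.sum_congr rfl fun l _ => h1 l, Finset.sum_boole, ← Nat.card_eq_finsetCard, Nat.cast_inj]
  have h2 : ∀ d : ι →₀ ℕ, Finsupp.weight w d = ∑ i, w i * d i := fun d => by
    rw [Finsupp.weight_apply, Finsupp.sum_fintype _ _ (by simp)]
    exact Finset.sum_congr rfl fun i _ => mul_comm _ _
  refine Nat.card_congr
    { toFun := fun l => ⟨Finsupp.equivFunOnFinite.symm fun i => l.1 i / w i, ?_⟩
      invFun := fun d => ⟨Finsupp.equivFunOnFinite.symm fun i => w i * d.1 i, ?_⟩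
      left_inv := fun l => ?_
      right_inv := fun d => ?_ }
  · obtain ⟨l, hl⟩ := l
    simp only [Finset.mem_filter, Finset.mem_finsuppAntidiag] at hl
    rw [h2]
    exact (Finset.sum_congr rfl fun i _ => Nat.mul_div_cancel' (hl.2 i)).trans hl.1.1
  · simp only [Finset.mem_filter, Finset.mem_finsuppAntidiag, Finset.subset_univ, and_true]
    exact ⟨(h2 _).symm.trans d.2, fun i => dvd_mul_right _ _⟩
  · ext i
    exact Nat.mul_div_cancel' ((Finset.mem_filter.1 l.2).2 i)
  · ext i
    exact Nat.mul_div_cancel_left _ (Nat.pos_of_ne_zero (hw i))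

theorem prod_geometricSeries : ∏ i, geometricSeries (sigmaWeight i) =
    ((1 - X ^ 2) * (1 - X ^ 4) * (1 - X ^ 6))⁻¹ := by
  rw [PowerSeries.eq_inv_iff_mul_eq_one (by simp), Fin.prod_univ_three]
  change geometricSeries 2 * geometricSeries 6 * geometricSeries 4 * _ = 1
  have h2 := geometricSeries_mul two_ne_zero
  have h4 := geometricSeries_mul four_ne_zero
  have h6 := geometricSeries_mul (k := 6) (by norm_num)
  calc _ = (geometricSeries 2 * (1 - X ^ 2)) * (geometricSeries 4 * (1 - X ^ 4)) *
      (geometricSeries 6 * (1 - X ^ 6)) := by ring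
    _ = 1 := by rw [h2, h4, h6, one_mul, one_mul]

/-- The coefficient of `X ^ (2 * k)` in the generating function, extended by zero to negative `k`. -/
def dimFormula (k : ℤ) : ℤ := if 0 ≤ k then (k ^ 2 + 6 * k) / 12 + 1 else 0

/-- The recurrence given by the product of `1 - X ^ 2`, `1 - X ^ 4` and `1 - X ^ 6`, as a polynomial in
`X ^ 2`. -/
theorem dimFormula_recurrence {k : ℤ} (hk : 0 < k) :
    dimFormula k - dimFormula (k - 1) - dimFormula (k - 2) + dimFormula (k - 4) +
      dimFormula (k - 5) - dimFormula (k - 6) = 0 := by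
  -- the formula happens to vanish at `-1`, …, `-5`, the only negative arguments that occur
  have h0 : ∀ j : ℤ, -6 < j → dimFormula j = (j ^ 2 + 6 * j) / 12 + 1 := by
    intro j hj
    unfold dimFormula
    split_ifs with h
    · rfl
    · interval_cases j <;> rfl
  rw [h0 _ (by omega), h0 _ (by omega), h0 _ (by omega), h0 _ (by omega), h0 _ (by omega),
    h0 _ (by omega)]
  obtain ⟨q, r, hr, hr', rfl⟩ : ∃ q r : ℤ, 0 ≤ r ∧ r < 12 ∧ k = 12 * q + r :=
    ⟨k / 12, k % 12, by omega, by omega, by omega⟩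
  -- the formula is a quasi-polynomial of period `12`
  have h1 : ∀ c : ℤ, ((12 * q + r - c) ^ 2 + 6 * (12 * q + r - c)) / 12 =
      12 * q ^ 2 + 2 * q * (r - c) + 6 * q + ((r - c) ^ 2 + 6 * (r - c)) / 12 := by
    intro c
    rw [← Int.add_mul_ediv_left _ _ (by norm_num : (12 : ℤ) ≠ 0) |>.trans (add_comm _ _)]
    congr 1
    ring
  have h1' := h1 0
  rw [sub_zero, sub_zero] at h1'
  rw [h1', h1, h1, h1, h1, h1]
  interval_cases r <;> norm_num <;> ring

theorem floor_eq_dimFormula {n : ℕ} (k : ℕ) (h : n = 2 * k) :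
    ⌊((n : ℚ) ^ 2 + 12 * n) / 48⌋ + 1 = dimFormula k := by
  have h1 : ((n : ℚ) ^ 2 + 12 * n) / 48 = (((k : ℤ) ^ 2 + 6 * k : ℤ) : ℚ) / ((12 : ℕ) : ℚ) := by
    rw [h]
    push_cast
    ring
  rw [h1, Rat.floor_intCast_div_natCast, dimFormula, if_pos (Int.natCast_nonneg k)]
  rfl

theorem mk_floor_eq : PowerSeries.mk (fun n : ℕ =>
      if Even n then ((⌊((n : ℚ) ^ 2 + 12 * n) / 48⌋ + 1 : ℤ) : ℚ) else 0) =
    ((1 - X ^ 2) * (1 - X ^ 4) * (1 - X ^ 6))⁻¹ := by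
  rw [PowerSeries.eq_inv_iff_mul_eq_one (by simp)]
  set f : PowerSeries ℚ := PowerSeries.mk (fun n : ℕ =>
    if Even n then ((⌊((n : ℚ) ^ 2 + 12 * n) / 48⌋ + 1 : ℤ) : ℚ) else 0) with hf
  have hc : ∀ n j : ℕ, coeff n (f * X ^ (2 * j)) =
      if Even n then ((dimFormula (n / 2 - j) : ℤ) : ℚ) else 0 := by
    intro n j
    rw [coeff_mul_X_pow', hf, coeff_mk]
    by_cases hn : Even n
    · obtain ⟨k, hk⟩ := hn.two_dvd
      rw [if_pos hn]
      split_ifs with h1 h2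
      · rw [floor_eq_dimFormula (k - j) (by omega)]
        congr 2
        omega
      · exact absurd (hn.tsub (even_two_mul j)) h2
      · rw [dimFormula, if_neg (by omega), Int.cast_zero]
    · rw [if_neg hn]
      split_ifs with h1 h2
      · exact absurd (by simpa [Nat.sub_add_cancel h1] using h2.add (even_two_mul j)) hn
      · rfl
      · rfl
  have he : f * ((1 - X ^ 2) * (1 - X ^ 4) * (1 - X ^ 6)) = f * X ^ (2 * 0) - f * X ^ (2 * 1) -
      f * X ^ (2 * 2) + f * X ^ (2 * 4) + f * X ^ (2 * 5) - f * X ^ (2 * 6) := by ring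
  rw [he]
  ext n
  simp only [map_sub, map_add, hc, coeff_one]
  by_cases hn : Even n
  · simp only [if_pos hn]
    obtain ⟨k, rfl⟩ := hn.two_dvd
    have h2 : ((2 * k : ℕ) : ℤ) / 2 = k := by omega
    simp only [h2]
    obtain rfl | hk := Nat.eq_zero_or_pos k
    · norm_num [dimFormula]
    · rw [if_neg (by omega)]
      have := dimFormula_recurrence (k := k) (by omega)
      push_cast
      rw [sub_zero]
      exact_mod_cast this
  · simp only [if_neg hn]
    rw [if_neg (by rintro rfl; exact hn Even.zero)]
    norm_num

end FaceAlgebra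

open JacobiDiagram FaceAlgebra in
theorem mainTheorem3 :
    -- the inclusion of tetrahedral diagrams induces an isomorphism of the even parts
    (∃ e : evenPart (internalDiagrams 3 tetrahedron) IsLegSite ≃ₗ[ℚ]
          evenPart (loopDiagrams 3) allSites,
        (∀ (D : internalDiagrams 3 tetrahedron) (D' : loopDiagrams 3) (hD : Even D.1.degree),
          D'.1 = D.1 →
            (e ⟨toSpace _ _ D, Submodule.subset_span ⟨D, hD, rfl⟩⟩ :
              Space (loopDiagrams 3) allSites) = toSpace _ _ D') ∧
        ∀ (n : ℕ) (a : evenPart (internalDiagrams 3 tetrahedron) IsLegSite),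
          a.1 ∈ legPart (internalDiagrams 3 tetrahedron) IsLegSite n ↔
            (e a).1 ∈ legPart (loopDiagrams 3) allSites n) ∧
    -- they are isomorphic, as graded vector spaces, to `ℚ[σ₂, σ₃², σ₄]`
    (∃ Φ : evenPart (internalDiagrams 3 tetrahedron) IsLegSite ≃ₗ[ℚ] sigmaAlgebra,
        ∀ (n : ℕ) (a : evenPart (internalDiagrams 3 tetrahedron) IsLegSite),
          a.1 ∈ legPart (internalDiagrams 3 tetrahedron) IsLegSite n ↔
            (Φ a : FaceRing) ∈ homogeneous n) ∧
    -- which consists of the classes of the even symmetric polynomials and is a polynomial algebra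
    (∀ r : FaceRing, r ∈ sigmaAlgebra ↔
        ∃ p : MvPolynomial (Fin 4) ℚ,
          p.IsSymmetric ∧ (∀ m ∈ p.support, Even m.degree) ∧ proj p = r) ∧
    AlgebraicIndependent ℚ ![sigma 2, sigma 3 ^ 2, sigma 4] ∧
    -- the generating function of the dimensions
    (∀ n : ℕ, Module.Finite ℚ
        (evenPart (loopDiagrams 3) allSites ⊓ legPart (loopDiagrams 3) allSites n :
          Submodule ℚ (Space (loopDiagrams 3) allSites))) ∧
    PowerSeries.mk (fun n : ℕ => (Module.finrank ℚ
        (evenPart (loopDiagrams 3) allSites ⊓ legPart (loopDiagrams 3) allSites n :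
          Submodule ℚ (Space (loopDiagrams 3) allSites)) : ℚ)) =
      ((1 - PowerSeries.X ^ 2) * (1 - PowerSeries.X ^ 4) * (1 - PowerSeries.X ^ 6))⁻¹ ∧
    ((1 - PowerSeries.X ^ 2) * (1 - PowerSeries.X ^ 4) * (1 - PowerSeries.X ^ 6) :
        PowerSeries ℚ)⁻¹ =
      PowerSeries.mk (fun n : ℕ =>
        if Even n then ((⌊((n : ℚ) ^ 2 + 12 * n) / 48⌋ + 1 : ℤ) : ℚ) else 0) := by
  refine ⟨exists_evenPart_equiv, ?_, fun r => ?_, algebraicIndependent_sigma_sq, fun n => ?_, ?_,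
    mk_floor_eq.symm⟩
  · obtain ⟨Φ, hΦ⟩ := exists_equiv_of_bijOn (q := Subalgebra.toSubmodule sigmaAlgebra) _
      (toSubmodule_sigmaAlgebra ▸ bijOn_faceWeight_inclusion)
    refine ⟨Φ, fun n a => ?_⟩
    rw [mem_legPart_internalDiagrams_iff a.2]
    exact (hΦ a).symm ▸ Iff.rfl
  · rw [mem_sigmaAlgebra_iff]
    exact exists_congr fun q => by
      rw [← negHom_eq_self_iff, ← and_assoc]
      rfl
  · obtain ⟨e⟩ := exists_evenPart_inf_legPart_equiv n
    have := finite_weightedHomogeneousSubmodule n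
    exact Module.Finite.equiv e
  · rw [← prod_geometricSeries]
    ext n
    obtain ⟨e⟩ := exists_evenPart_inf_legPart_equiv n
    rw [PowerSeries.coeff_mk, coeff_prod_geometricSeries sigmaWeight_ne_zero, ← e.finrank_eq,
      finrank_weightedHomogeneousSubmodule]
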